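/- Let $\mathbb D$ be the open unit disc, $\mathbb T=\partial\mathbb D$, and let $\mu_1,\mu_2$ be finite positive Borel measures on $\overline{\mathbb D}$. For a finite positive Borel measure $\mu$ on $\overline{\mathbb D}$ and $w\in\mathbb D$ put $$U_\mu(w)=\int_{\mathbb D}\log\left|\frac{1-\overline\zeta w}{w-\zeta}\right|^2\frac{d\mu(\zeta)}{1-|\zeta|^2}+\int_{\mathbb T}\frac{1-|w|^2}{|\zeta-w|^2}\,d\mu(\zeta).$$ For $f$ holomorphic on the bidisc $\mathbb D^2$ let, with $dA$ the normalized area measure on $\mathbb D$, $$\mathcal D_{\mu_1,\mu_2}(f)=\sup_{0<r<1}\int_0^{2\pi}\!\int_{\mathbb D}|\partial_1f(z_1,re^{i\theta})|^2U_{\mu_1}(z_1)\,dA(z_1)\frac{d\theta}{2\pi}+\sup_{0<r<1}\int_0^{2\pi}\!\int_{\mathbb D}|\partial_2f(re^{i\theta},z_2)|^2U_{\mu_2}(z_2)\,dA(z_2)\frac{d\theta}{2\pi},$$ let $H^2(\mathbb D^2)$ be the Hardy space of holomorphic $f$ on $\mathbb D^2$ with $\|f\|_{H^2}^2=\sup_{0<r<1}\int_0^{2\pi}\!\int_0^{2\pi}|f(re^{i\theta_1},re^{i\theta_2})|^2\frac{d\theta_1}{2\pi}\frac{d\theta_2}{2\pi}<\infty$,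 and let $\mathcal D(\mu_1,\mu_2)=\{f\in H^2(\mathbb D^2):\mathcal D_{\mu_1,\mu_2}(f)<\infty\}$. Then $\|f\|^2=\|f\|_{H^2}^2+\mathcal D_{\mu_1,\mu_2}(f)$ is the square of a norm induced by an inner product which makes $\mathcal D(\mu_1,\mu_2)$ a Hilbert space; multiplication by the coordinate functions defines bounded operators $\mathscr M_{z_1},\mathscr M_{z_2}$ on it; and the pair $\mathscr M_z=(\mathscr M_{z_1},\mathscr M_{z_2})$ is a toral $2$-isometry if and only if $\mu_1$ and $\mu_2$ are both supported on $\mathbb T$. Here a commuting pair $T=(T_1,T_2)$ of bounded operators on a Hilbert space is called a toral $2$-isometry if $I-T_i^*T_i-T_j^*T_j+T_i^*T_j^*T_iT_j=0$ for all $i,j\in\{1,2\}$. -/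

import Mathlib

open MeasureTheory Set Metric

noncomputable section

namespace Bidisc

/-- The open unit bidisc `𝔻² ⊆ ℂ²`. -/
def bidisc : Set (ℂ × ℂ) := ball (0 : ℂ) 1 ×ˢ ball (0 : ℂ) 1

/-- Holomorphic functions on `𝔻²`. A function on `𝔻²` is encoded by its extension by `0` to `ℂ²`,
so that two elements are equal exactly when they agree on `𝔻²`. -/
def holo : Submodule ℂ (ℂ × ℂ → ℂ) where
  carrier := {f | DifferentiableOn ℂ f bidisc ∧ ∀ z, z ∉ bidisc → f z = 0}
  zero_mem' := ⟨differentiableOn_const 0, fun _ _ => rfl⟩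
  add_mem' := fun hf hg => ⟨hf.1.add hg.1, fun z hz => by simp [hf.2 z hz, hg.2 z hz]⟩
  smul_mem' := fun c _ hf => ⟨hf.1.const_smul c, fun z hz => by simp [hf.2 z hz]⟩

/-- The mean `∫₀^{2π} g(r e^{iθ}) dθ/(2π)` of a nonnegative function over the circle of
radius `r`. -/
def circleMean (g : ℂ → ENNReal) (r : ℝ) : ENNReal :=
  ENNReal.ofReal (1 / (2 * Real.pi)) *
    ∫⁻ θ in Ioc 0 (2 * Real.pi), g (circleMap 0 r θ)

/-- The square of the Hardy space norm,
`sup_{0<r<1} ∫∫ |f(r e^{iθ₁}, r e^{iθ₂})|² dθ₁/(2π) dθ₂/(2π)`. -/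
def hardyNormSq (f : ℂ × ℂ → ℂ) : ENNReal :=
  ⨆ r ∈ Ioo (0 : ℝ) 1, circleMean (fun z₁ => circleMean (fun z₂ => ‖f (z₁, z₂)‖ₑ ^ 2) r) r

/-- `log |(1 - ζ̄ w)/(w - ζ)|²`, with value `+∞` at `w = ζ`. -/
def greenKernel (ζ w : ℂ) : ENNReal :=
  if w = ζ then ⊤
  else ENNReal.ofReal (Real.log (‖(1 - (starRingEnd ℂ) ζ * w) / (w - ζ)‖ ^ 2))

/-- The Poisson kernel `(1 - |w|²)/|ζ - w|²`. -/
def poissonKer (ζ w : ℂ) : ENNReal :=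
  ENNReal.ofReal ((1 - ‖w‖ ^ 2) / ‖ζ - w‖ ^ 2)

/-- The superharmonic weight `U_μ` on the unit disc. -/
def weight (μ : Measure ℂ) (w : ℂ) : ENNReal :=
  (∫⁻ ζ in ball (0 : ℂ) 1, greenKernel ζ w * ENNReal.ofReal (1 / (1 - ‖ζ‖ ^ 2)) ∂μ) +
    ∫⁻ ζ in sphere (0 : ℂ) 1, poissonKer ζ w ∂μ

/-- The one-variable Dirichlet integral `∫_𝔻 |g'|² U_μ dA`, where `dA` is normalized area. -/
def diskEnergy (μ : Measure ℂ) (g : ℂ → ℂ) : ENNReal :=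
  ENNReal.ofReal (1 / Real.pi) * ∫⁻ z in ball (0 : ℂ) 1, ‖deriv g z‖ₑ ^ 2 * weight μ z

/-- The first summand of the Dirichlet integral, involving `∂₁ f` and `μ₁`. -/
def energy₁ (μ₁ : Measure ℂ) (f : ℂ × ℂ → ℂ) : ENNReal :=
  ⨆ r ∈ Ioo (0 : ℝ) 1, circleMean (fun w => diskEnergy μ₁ (fun z => f (z, w))) r

/-- The second summand of the Dirichlet integral, involving `∂₂ f` and `μ₂`. -/
def energy₂ (μ₂ : Measure ℂ) (f : ℂ × ℂ → ℂ) : ENNReal :=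
  ⨆ r ∈ Ioo (0 : ℝ) 1, circleMean (fun w => diskEnergy μ₂ (fun z => f (w, z))) r

/-- The Dirichlet integral `D_{μ₁,μ₂}(f)`. -/
def dirichletIntegral (μ₁ μ₂ : Measure ℂ) (f : ℂ × ℂ → ℂ) : ENNReal :=
  energy₁ μ₁ f + energy₂ μ₂ f

/-! Facts needed to see that the spaces below are vector spaces. -/

lemma isOpen_bidisc : IsOpen bidisc := isOpen_ball.prod isOpen_ball

open Classical in
lemma measurable_of_mem_holo {f : ℂ × ℂ → ℂ} (hf : f ∈ holo) : Measurable f := by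
  have h : f = bidisc.piecewise f (fun _ => 0) := by
    funext z
    by_cases hz : z ∈ bidisc
    · simp [hz]
    · simp [hz, hf.2 z hz]
  rw [h]
  exact hf.1.continuousOn.measurable_piecewise continuousOn_const isOpen_bidisc.measurableSet

lemma swap_mem_holo {f : ℂ × ℂ → ℂ} (hf : f ∈ holo) : (fun z => f z.swap) ∈ holo := by
  refine ⟨?_, fun z hz => hf.2 _ fun h => hz ⟨h.2, h.1⟩⟩
  exact hf.1.comp (differentiable_snd.prodMk differentiable_fst).differentiableOn
    fun z hz => ⟨hz.2, hz.1⟩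

lemma measurable_weight (μ : Measure ℂ) [IsFiniteMeasure μ] : Measurable (weight μ) := by
  have hg : Measurable (fun p : ℂ × ℂ =>
      greenKernel p.2 p.1 * ENNReal.ofReal (1 / (1 - ‖p.2‖ ^ 2))) := by
    refine Measurable.mul ?_ (by fun_prop)
    refine Measurable.ite (measurableSet_eq_fun measurable_fst measurable_snd)
      measurable_const ?_
    have : Measurable (fun p : ℂ × ℂ => (starRingEnd ℂ) p.2) :=
      (Complex.continuous_conj.comp continuous_snd).measurable
    fun_prop
  have hp : Measurable (fun p : ℂ × ℂ => poissonKer p.2 p.1) := by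
    unfold poissonKer
    fun_prop
  exact hg.lintegral_prod_right'.add hp.lintegral_prod_right'

lemma differentiableAt_slice {f : ℂ × ℂ → ℂ} (hf : f ∈ holo) {z : ℂ} (hz : z ∈ ball (0 : ℂ) 1)
    (w : ℂ) : DifferentiableAt ℂ (fun z => f (z, w)) z := by
  by_cases hw : w ∈ ball (0 : ℂ) 1
  · exact (hf.1.differentiableAt (x := (z, w)) (isOpen_bidisc.mem_nhds ⟨hz, hw⟩)).comp z
      (differentiableAt_id.prodMk (differentiableAt_const w))
  · have : (fun z => f (z, w)) = fun _ => 0 := by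
      funext z
      exact hf.2 _ fun h => hw h.2
    rw [this]
    exact differentiableAt_const 0

lemma measurable_deriv_slice {f : ℂ × ℂ → ℂ} (hf : f ∈ holo) :
    Measurable (fun p : ℂ × ℂ => (ball (0 : ℂ) 1).indicator
      (fun z => deriv (fun z => f (z, p.1)) z) p.2) := by
  have hm := measurable_of_mem_holo hf
  have hB : MeasurableSet {p : ℂ × ℂ | p.2 ∈ ball (0 : ℂ) 1} :=
    measurable_snd isOpen_ball.measurableSet
  let q : ℕ → ℂ × ℂ → ℂ := fun n p => {p : ℂ × ℂ | p.2 ∈ ball (0 : ℂ) 1}.indicator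
    (fun p => ((1 / ((n : ℝ) + 1) : ℝ) : ℂ)⁻¹ *
      (f (p.2 + ((1 / ((n : ℝ) + 1) : ℝ) : ℂ), p.1) - f (p.2, p.1))) p
  refine measurable_of_tendsto_metrizable (f := q) (fun n => ?_) ?_
  · refine Measurable.indicator ?_ hB
    refine Measurable.const_mul (Measurable.sub ?_ ?_) _
    · exact hm.comp ((measurable_snd.add_const _).prodMk measurable_fst)
    · exact hm.comp (measurable_snd.prodMk measurable_fst)
  · rw [tendsto_pi_nhds]
    intro p
    by_cases hp : p.2 ∈ ball (0 : ℂ) 1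
    · have hd := (differentiableAt_slice hf hp p.1).hasDerivAt.tendsto_slope_zero
      have ht : Filter.Tendsto (fun n : ℕ => ((1 / ((n : ℝ) + 1) : ℝ) : ℂ)) Filter.atTop
          (nhdsWithin 0 {0}ᶜ) := by
        refine tendsto_nhdsWithin_iff.2 ⟨?_, Filter.Eventually.of_forall fun n => ?_⟩
        · simpa only [Complex.ofReal_zero, Function.comp_def] using (Complex.continuous_ofReal.tendsto 0).comp
            (tendsto_one_div_add_atTop_nhds_zero_nat (𝕜 := ℝ))
        · have : (1 / ((n : ℝ) + 1) : ℝ) ≠ 0 := by positivity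
          simpa only [mem_compl_iff, mem_singleton_iff, Complex.ofReal_eq_zero] using this
      have h2 := hd.comp ht
      rw [indicator_of_mem hp]
      refine h2.congr fun n => ?_
      simp only [q, Function.comp, smul_eq_mul]
      rw [indicator_of_mem (show p ∈ {p : ℂ × ℂ | p.2 ∈ ball (0 : ℂ) 1} from hp)]
    · rw [indicator_of_notMem hp]
      refine tendsto_const_nhds.congr fun n => ?_
      exact (indicator_of_notMem (show p ∉ {p : ℂ × ℂ | p.2 ∈ ball (0 : ℂ) 1} from hp) _).symm

lemma measurable_diskEnergy_slice (μ : Measure ℂ) [IsFiniteMeasure μ] {f : ℂ × ℂ → ℂ}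
    (hf : f ∈ holo) : Measurable (fun w => diskEnergy μ (fun z => f (z, w))) := by
  refine Measurable.const_mul ?_ _
  have h : ∀ w, ∫⁻ z in ball (0 : ℂ) 1, ‖deriv (fun z => f (z, w)) z‖ₑ ^ 2 * weight μ z =
      ∫⁻ z in ball (0 : ℂ) 1, ‖(ball (0 : ℂ) 1).indicator
        (fun z => deriv (fun z => f (z, w)) z) z‖ₑ ^ 2 * weight μ z := fun w =>
    setLIntegral_congr_fun isOpen_ball.measurableSet fun z hz => by
      simp only [indicator_of_mem hz]
  simp only [h]
  refine Measurable.lintegral_prod_right' (f := fun p : ℂ × ℂ => ‖(ball (0 : ℂ) 1).indicator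
        (fun z => deriv (fun z => f (z, p.1)) z) p.2‖ₑ ^ 2 * weight μ p.2) ?_
  exact ((measurable_deriv_slice hf).enorm.pow_const 2).mul
    ((measurable_weight μ).comp measurable_snd)

lemma enorm_add_sq_le (a b : ℂ) : ‖a + b‖ₑ ^ 2 ≤ 2 * ‖a‖ₑ ^ 2 + 2 * ‖b‖ₑ ^ 2 := by
  have h : ‖a + b‖₊ ^ 2 ≤ 2 * ‖a‖₊ ^ 2 + 2 * ‖b‖₊ ^ 2 := by
    have h1 : ‖a + b‖ ^ 2 ≤ 2 * ‖a‖ ^ 2 + 2 * ‖b‖ ^ 2 := by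
      nlinarith [norm_add_le a b, norm_nonneg (a + b), norm_nonneg a, norm_nonneg b,
        sq_nonneg (‖a‖ - ‖b‖)]
    exact_mod_cast h1
  simp only [enorm_eq_nnnorm]
  exact_mod_cast h

lemma circleMean_mono {g h : ℂ → ENNReal} (H : ∀ z, g z ≤ h z) (r : ℝ) :
    circleMean g r ≤ circleMean h r :=
  mul_le_mul_right (lintegral_mono fun _ => H _) _

lemma circleMean_const_mul {g : ℂ → ENNReal} (c : ENNReal) (hg : Measurable g) (r : ℝ) :
    circleMean (fun z => c * g z) r = c * circleMean g r := by
  unfold circleMean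
  rw [lintegral_const_mul c (f := fun θ => g (circleMap 0 r θ))
    (hg.comp (continuous_circleMap 0 r).measurable)]
  ring

lemma circleMean_add {g h : ℂ → ENNReal} (hg : Measurable g) (r : ℝ) :
    circleMean (fun z => g z + h z) r = circleMean g r + circleMean h r := by
  unfold circleMean
  rw [lintegral_add_left (f := fun θ => g (circleMap 0 r θ))
    (hg.comp (continuous_circleMap 0 r).measurable), mul_add]

lemma measurable_circleMean {f : ℂ × ℂ → ENNReal} (hf : Measurable f) (r : ℝ) :
    Measurable (fun z => circleMean (fun w => f (z, w)) r) := by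
  refine Measurable.const_mul ?_ _
  refine Measurable.lintegral_prod_right'
    (f := fun p : ℂ × ℝ => f (p.1, circleMap 0 r p.2)) ?_
  exact hf.comp (measurable_fst.prodMk ((continuous_circleMap 0 r).measurable.comp measurable_snd))

lemma circleMean_two {A B C : ℂ → ENNReal} (hA : Measurable A) (hB : Measurable B)
    (H : ∀ z, C z ≤ 2 * A z + 2 * B z) (r : ℝ) :
    circleMean C r ≤ 2 * circleMean A r + 2 * circleMean B r := by
  refine (circleMean_mono H r).trans (le_of_eq ?_)
  rw [circleMean_add (hA.const_mul 2), circleMean_const_mul 2 hA, circleMean_const_mul 2 hB]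

lemma iSup_two {A B C : ℝ → ENNReal} (H : ∀ r, C r ≤ 2 * A r + 2 * B r) :
    ⨆ r ∈ Ioo (0 : ℝ) 1, C r ≤
      2 * (⨆ r ∈ Ioo (0 : ℝ) 1, A r) + 2 * ⨆ r ∈ Ioo (0 : ℝ) 1, B r :=
  iSup₂_le fun r hr => (H r).trans <| add_le_add
    (mul_le_mul_right (le_iSup₂ (f := fun r (_ : r ∈ Ioo (0 : ℝ) 1) => A r) r hr) _)
    (mul_le_mul_right (le_iSup₂ (f := fun r (_ : r ∈ Ioo (0 : ℝ) 1) => B r) r hr) _)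

lemma two_lt_top {a b : ENNReal} (ha : a < ⊤) (hb : b < ⊤) : 2 * a + 2 * b < ⊤ :=
  ENNReal.add_lt_top.2 ⟨ENNReal.mul_lt_top (by simp) ha, ENNReal.mul_lt_top (by simp) hb⟩

lemma hardyNormSq_add {f g : ℂ × ℂ → ℂ} (hf : f ∈ holo) (hg : g ∈ holo) :
    hardyNormSq (f + g) ≤ 2 * hardyNormSq f + 2 * hardyNormSq g := by
  have hf' : Measurable fun z => ‖f z‖ₑ ^ 2 := (measurable_of_mem_holo hf).enorm.pow_const 2
  have hg' : Measurable fun z => ‖g z‖ₑ ^ 2 := (measurable_of_mem_holo hg).enorm.pow_const 2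
  refine iSup_two fun r => circleMean_two (measurable_circleMean hf' r)
    (measurable_circleMean hg' r) (fun z => ?_) r
  exact circleMean_two (hf'.comp measurable_prodMk_left) (hg'.comp measurable_prodMk_left)
    (fun w => enorm_add_sq_le _ _) r

lemma hardyNormSq_smul {f : ℂ × ℂ → ℂ} (hf : f ∈ holo) (c : ℂ) (h : hardyNormSq f < ⊤) :
    hardyNormSq (c • f) < ⊤ := by
  have hf' : Measurable fun z => ‖f z‖ₑ ^ 2 := (measurable_of_mem_holo hf).enorm.pow_const 2
  have : hardyNormSq (c • f) = ‖c‖ₑ ^ 2 * hardyNormSq f := by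
    unfold hardyNormSq
    simp only [Pi.smul_apply, smul_eq_mul, enorm_mul, mul_pow, ENNReal.mul_iSup]
    refine iSup_congr fun r => iSup_congr fun _ => ?_
    rw [← circleMean_const_mul _ (measurable_circleMean hf' r)]
    congr 1
    funext z
    exact circleMean_const_mul _ (hf'.comp measurable_prodMk_left) r
  rw [this]
  exact ENNReal.mul_lt_top (by simp) h

lemma diskEnergy_add (μ : Measure ℂ) [IsFiniteMeasure μ] {f g : ℂ → ℂ}
    (hf : ∀ z ∈ ball (0 : ℂ) 1, DifferentiableAt ℂ f z)
    (hg : ∀ z ∈ ball (0 : ℂ) 1, DifferentiableAt ℂ g z) :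
    diskEnergy μ (fun z => f z + g z) ≤ 2 * diskEnergy μ f + 2 * diskEnergy μ g := by
  have hmf : Measurable fun z => ‖deriv f z‖ₑ ^ 2 * weight μ z :=
    ((measurable_deriv f).enorm.pow_const 2).mul (measurable_weight μ)
  have hmg : Measurable fun z => ‖deriv g z‖ₑ ^ 2 * weight μ z :=
    ((measurable_deriv g).enorm.pow_const 2).mul (measurable_weight μ)
  have key : ∫⁻ z in ball (0 : ℂ) 1, ‖deriv (fun z => f z + g z) z‖ₑ ^ 2 * weight μ z ≤
      2 * (∫⁻ z in ball (0 : ℂ) 1, ‖deriv f z‖ₑ ^ 2 * weight μ z) +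
      2 * ∫⁻ z in ball (0 : ℂ) 1, ‖deriv g z‖ₑ ^ 2 * weight μ z := by
    rw [← lintegral_const_mul _ hmf, ← lintegral_const_mul _ hmg,
      ← lintegral_add_left (hmf.const_mul 2)]
    refine setLIntegral_mono' isOpen_ball.measurableSet fun z hz => ?_
    rw [show deriv (fun z => f z + g z) z = deriv f z + deriv g z from
      deriv_add (hf z hz) (hg z hz)]
    calc _ ≤ _ := mul_le_mul_left (enorm_add_sq_le (deriv f z) (deriv g z)) (weight μ z)
      _ = _ := by ring
  unfold diskEnergy
  calc _ ≤ _ := mul_le_mul_right key _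
    _ = _ := by ring

lemma diskEnergy_smul (μ : Measure ℂ) [IsFiniteMeasure μ] (f : ℂ → ℂ) (c : ℂ) :
    diskEnergy μ (fun z => c * f z) = ‖c‖ₑ ^ 2 * diskEnergy μ f := by
  have hmf : Measurable fun z => ‖deriv f z‖ₑ ^ 2 * weight μ z :=
    ((measurable_deriv f).enorm.pow_const 2).mul (measurable_weight μ)
  unfold diskEnergy
  simp only [deriv_const_mul_field', enorm_mul, mul_pow, mul_assoc]
  rw [lintegral_const_mul _ hmf]
  ring

lemma energy₁_add (μ : Measure ℂ) [IsFiniteMeasure μ] {f g : ℂ × ℂ → ℂ} (hf : f ∈ holo)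
    (hg : g ∈ holo) : energy₁ μ (f + g) ≤ 2 * energy₁ μ f + 2 * energy₁ μ g :=
  iSup_two fun r => circleMean_two (measurable_diskEnergy_slice μ hf)
    (measurable_diskEnergy_slice μ hg) (fun w => diskEnergy_add μ
      (fun _ hz => differentiableAt_slice hf hz w) (fun _ hz => differentiableAt_slice hg hz w)) r

lemma energy₁_smul (μ : Measure ℂ) [IsFiniteMeasure μ] {f : ℂ × ℂ → ℂ} (hf : f ∈ holo) (c : ℂ) :
    energy₁ μ (c • f) = ‖c‖ₑ ^ 2 * energy₁ μ f := by
  unfold energy₁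
  simp only [Pi.smul_apply, smul_eq_mul, ENNReal.mul_iSup, diskEnergy_smul]
  exact iSup_congr fun r => iSup_congr fun _ => circleMean_const_mul _ (measurable_diskEnergy_slice μ hf) r

lemma energy₂_eq (μ : Measure ℂ) (f : ℂ × ℂ → ℂ) :
    energy₂ μ f = energy₁ μ (fun z => f z.swap) := rfl

lemma dirichletIntegral_add (μ₁ μ₂ : Measure ℂ) [IsFiniteMeasure μ₁] [IsFiniteMeasure μ₂]
    {f g : ℂ × ℂ → ℂ} (hf : f ∈ holo) (hg : g ∈ holo) :
    dirichletIntegral μ₁ μ₂ (f + g) ≤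
      2 * dirichletIntegral μ₁ μ₂ f + 2 * dirichletIntegral μ₁ μ₂ g := by
  have h1 := energy₁_add μ₁ hf hg
  have h2 := energy₁_add μ₂ (swap_mem_holo hf) (swap_mem_holo hg)
  calc _ ≤ _ := add_le_add h1 h2
    _ = _ := by simp only [dirichletIntegral, energy₂_eq]; ring

lemma dirichletIntegral_smul (μ₁ μ₂ : Measure ℂ) [IsFiniteMeasure μ₁] [IsFiniteMeasure μ₂]
    {f : ℂ × ℂ → ℂ} (hf : f ∈ holo) (c : ℂ) :
    dirichletIntegral μ₁ μ₂ (c • f) = ‖c‖ₑ ^ 2 * dirichletIntegral μ₁ μ₂ f := by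
  have h1 := energy₁_smul μ₁ hf c
  have h2 := energy₁_smul μ₂ (swap_mem_holo hf) c
  unfold dirichletIntegral
  rw [mul_add, h1, energy₂_eq, energy₂_eq, ← h2]
  rfl

/-- The Hardy space `H²(𝔻²)`. -/
def hardySpace : Submodule ℂ (ℂ × ℂ → ℂ) where
  carrier := {f | f ∈ holo ∧ hardyNormSq f < ⊤}
  zero_mem' := ⟨holo.zero_mem, by simp [hardyNormSq, circleMean]⟩
  add_mem' := fun hf hg => ⟨holo.add_mem hf.1 hg.1,
    (hardyNormSq_add hf.1 hg.1).trans_lt (two_lt_top hf.2 hg.2)⟩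
  smul_mem' := fun c _ hf => ⟨holo.smul_mem c hf.1, hardyNormSq_smul hf.1 c hf.2⟩

/-- The Dirichlet-type space `D(μ₁, μ₂) = {f ∈ H²(𝔻²) : D_{μ₁,μ₂}(f) < ∞}`. -/
def dirichletSpace (μ₁ μ₂ : Measure ℂ) [IsFiniteMeasure μ₁] [IsFiniteMeasure μ₂] :
    Submodule ℂ (ℂ × ℂ → ℂ) where
  carrier := {f | f ∈ hardySpace ∧ dirichletIntegral μ₁ μ₂ f < ⊤}
  zero_mem' := ⟨hardySpace.zero_mem, by
    simp [dirichletIntegral, energy₁, energy₂, diskEnergy, circleMean]⟩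
  add_mem' := fun hf hg => ⟨hardySpace.add_mem hf.1 hg.1,
    (dirichletIntegral_add μ₁ μ₂ hf.1.1 hg.1.1).trans_lt (two_lt_top hf.2 hg.2)⟩
  smul_mem' := fun c _ hf => ⟨hardySpace.smul_mem c hf.1, by
    rw [dirichletIntegral_smul μ₁ μ₂ hf.1.1 c]
    exact ENNReal.mul_lt_top (by simp) hf.2⟩

/-- `D(μ₁, μ₂)` as a type, with its vector space structure only. (It is not a reducible synonym, so
that it does not inherit the topology of pointwise convergence.) -/
def DirichletSpace (μ₁ μ₂ : Measure ℂ) [IsFiniteMeasure μ₁] [IsFiniteMeasure μ₂] : Type :=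
  dirichletSpace μ₁ μ₂

instance (μ₁ μ₂ : Measure ℂ) [IsFiniteMeasure μ₁] [IsFiniteMeasure μ₂] :
    AddCommGroup (DirichletSpace μ₁ μ₂) :=
  inferInstanceAs (AddCommGroup (dirichletSpace μ₁ μ₂))

instance (μ₁ μ₂ : Measure ℂ) [IsFiniteMeasure μ₁] [IsFiniteMeasure μ₂] :
    Module ℂ (DirichletSpace μ₁ μ₂) :=
  inferInstanceAs (Module ℂ (dirichletSpace μ₁ μ₂))

/-- The function underlying an element of `D(μ₁, μ₂)`. -/
def DirichletSpace.fn {μ₁ μ₂ : Measure ℂ} [IsFiniteMeasure μ₁] [IsFiniteMeasure μ₂]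
    (f : DirichletSpace μ₁ μ₂) : ℂ × ℂ → ℂ := f.1

/-- The `j`-th coordinate function on `ℂ²`. -/
def coord (j : Fin 2) (z : ℂ × ℂ) : ℂ := ![z.1, z.2] j

open ContinuousLinearMap in
/-- A toral `2`-isometry: a commuting pair `T = (T₁, T₂)` of bounded operators with
`I - Tᵢ* Tᵢ - Tⱼ* Tⱼ + Tᵢ* Tⱼ* Tᵢ Tⱼ = 0` for all `i, j`. -/
def IsToralTwoIsometry {H : Type*} [NormedAddCommGroup H] [InnerProductSpace ℂ H]
    [CompleteSpace H] (T : Fin 2 → H →L[ℂ] H) : Prop :=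
  (∀ i j, T i * T j = T j * T i) ∧
    ∀ i j, 1 - adjoint (T i) * T i - adjoint (T j) * T j +
      adjoint (T i) * adjoint (T j) * T i * T j = 0

end Bidisc

end

/-! Tested on vectors, the toral identity for `(i, j)` says that `‖x‖² - ‖Tᵢx‖² - ‖Tⱼx‖² + ‖TᵢTⱼx‖²
= 0` for every `x` (`isToralTwoIsometry_iff`). Multiplication by either coordinate preserves the
Hardy term, multiplication by `z₂` preserves `energy₁`, and multiplication by `z₁` preserves
`energy₂`. Hence the mixed identity always holds, and the diagonal ones say that the second
difference of `energyᵢ` under multiplication by `zᵢ` vanishes.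

This is a question in one variable. By Tonelli `diskEnergy μ g` is the `μ`-integral of `localEnergy
ζ g` over the closed disc (`diskEnergy_eq`), so it suffices to know how `localEnergy ζ` reacts to
multiplication by `z`. If `|ζ| = 1`, Taylor coefficients turn it into an explicit series whose
second difference is zero (`localEnergy_sphere_second_difference`). If `|ζ| < 1`, the automorphism
of the disc exchanging `0` and `ζ`, together with the Littlewood–Paley identity, gives `localEnergy
ζ (z f) = localEnergy ζ f + |f(ζ)|²` (`localEnergy_ball_mul`), with second difference `-(1 -
|ζ|²)|f(ζ)|²`. Taking `f = 1` shows that a vanishing second difference forces `μ` to have no mass in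
the open disc; the converse follows by integration.

Both cases also yield `localEnergy ζ (z f) ≤ 3 localEnergy ζ f + 2 |f(0)|²`, hence the boundedness
of the multiplications. The squared norm is a quadratic form, lower semicontinuous under locally
uniform convergence (`IsQuadForm`). The inner product comes from the parallelogram law; completeness
comes from the Hardy norm controlling point evaluations, which makes Cauchy sequences converge
locally uniformly, and from semicontinuity. -/

namespace Bidisc

open Filter Topology

/-! ### Taylor coefficients and Parseval's identity on circles -/

/-- `a` is the sequence of Taylor coefficients at `0` of the function `g` on the unit disc. -/
def HasTaylor (a : ℕ → ℂ) (g : ℂ → ℂ) : Prop :=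
  ∀ z ∈ ball (0 : ℂ) 1, HasSum (fun n => a n * z ^ n) (g z)

lemma hasTaylor_iteratedDeriv {g : ℂ → ℂ} (hg : DifferentiableOn ℂ g (ball 0 1)) :
    HasTaylor (fun n => (n.factorial : ℂ)⁻¹ * iteratedDeriv n g 0) g := by
  intro z hz
  refine (Complex.hasSum_taylorSeries_on_ball hg hz).congr_fun ?_
  intro n
  simp only [smul_eq_mul, sub_zero]
  ring

lemma exists_hasTaylor {g : ℂ → ℂ} (hg : DifferentiableOn ℂ g (ball 0 1)) :
    ∃ a, HasTaylor a g := ⟨_, hasTaylor_iteratedDeriv hg⟩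

lemma HasTaylor.apply_zero {a : ℕ → ℂ} {g : ℂ → ℂ} (h : HasTaylor a g) : g 0 = a 0 := by
  have h0 := h 0 (by simp)
  have h1 : HasSum (fun n => a n * (0 : ℂ) ^ n) (a 0) := by
    convert! hasSum_ite_eq (0 : ℕ) (a 0) using 2 with n
    by_cases hn : n = 0 <;> simp [hn]
  exact h0.unique h1

lemma HasTaylor.summable_norm {a : ℕ → ℂ} {g : ℂ → ℂ} (h : HasTaylor a g) {r : ℝ} (h0 : 0 ≤ r)
    (h1 : r < 1) : Summable fun n => ‖a n‖ * r ^ n := by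
  have hr : (r : ℂ) ∈ ball (0 : ℂ) 1 := by simpa [abs_of_nonneg h0] using h1
  refine (h r hr).summable.norm.congr fun n => ?_
  simp [abs_of_nonneg h0]

lemma circleMap_mem_ball_one {r : ℝ} (h0 : 0 ≤ r) (h1 : r < 1) (θ : ℝ) :
    circleMap 0 r θ ∈ ball (0 : ℂ) 1 := by
  simpa [abs_of_nonneg h0] using h1

lemma integral_norm_sum_sq (a : ℕ → ℂ) (r : ℝ) (N : ℕ) :
    (2 * Real.pi)⁻¹ * ∫ θ in (0 : ℝ)..2 * Real.pi,
      ‖∑ n ∈ Finset.range N, a n * circleMap 0 r θ ^ n‖ ^ 2 =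
    ∑ n ∈ Finset.range N, ‖a n‖ ^ 2 * r ^ (2 * n) := by
  -- The radius is absorbed into the coefficients, so that Parseval for polynomials on the unit
  -- circle applies.
  set p : Polynomial ℂ := ∑ n ∈ Finset.range N, Polynomial.monomial n (a n * r ^ n) with hp
  have hcoeff : ∀ n, p.coeff n = if n < N then a n * r ^ n else 0 := by
    intro n
    simp [hp, Polynomial.coeff_monomial]
  have h1 := p.sum_sq_norm_coeff_eq_circleAverage
  rw [Real.circleAverage, smul_eq_mul] at h1
  have h2 : ∀ θ : ℝ, Polynomial.eval (circleMap 0 1 θ) p =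
      ∑ n ∈ Finset.range N, a n * circleMap 0 r θ ^ n := by
    intro θ
    simp only [hp, Polynomial.eval_finsetSum, Polynomial.eval_monomial]
    refine Finset.sum_congr rfl fun n _ => ?_
    simp only [circleMap, zero_add, Complex.ofReal_one, one_mul, mul_pow]
    ring
  simp only [h2] at h1
  rw [← h1, Finset.sum_subset (s₂ := Finset.range N)]
  · refine Finset.sum_congr rfl fun n hn => ?_
    rw [hcoeff, if_pos (Finset.mem_range.1 hn), norm_mul, norm_pow, Complex.norm_real, mul_pow,
      ← pow_mul, mul_comm n 2, pow_mul, pow_mul, Real.norm_eq_abs, sq_abs]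
  · intro n hn
    rw [Finset.mem_range]
    by_contra hc
    rw [Polynomial.mem_support_iff, hcoeff, if_neg hc] at hn
    exact hn rfl
  · intro n _ hn
    simp [Polynomial.notMem_support_iff.1 hn]

lemma HasTaylor.continuousOn_circle {a : ℕ → ℂ} {g : ℂ → ℂ} (h : HasTaylor a g) {r : ℝ}
    (h0 : 0 ≤ r) (h1 : r < 1) : Continuous fun θ => g (circleMap 0 r θ) := by
  have : (fun θ => g (circleMap 0 r θ)) = fun θ => ∑' n, a n * circleMap 0 r θ ^ n := by
    funext θ
    exact (h _ (circleMap_mem_ball_one h0 h1 θ)).tsum_eq.symm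
  rw [this]
  refine continuous_tsum (u := fun n => ‖a n‖ * r ^ n) (fun n => ?_) (h.summable_norm h0 h1) ?_
  · exact continuous_const.mul ((continuous_circleMap 0 r).pow n)
  · intro n θ
    simp [abs_of_nonneg h0]

/-- Parseval's identity on the circle of radius `r`. -/
lemma HasTaylor.circleMean_sq {a : ℕ → ℂ} {g : ℂ → ℂ} (h : HasTaylor a g) {r : ℝ}
    (h0 : 0 ≤ r) (h1 : r < 1) :
    circleMean (fun z => ‖g z‖ₑ ^ 2) r = ∑' n, ‖a n‖ₑ ^ 2 * ENNReal.ofReal (r ^ (2 * n)) := by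
  have hs := h.summable_norm h0 h1
  have hcont := h.continuousOn_circle h0 h1
  have hpi : (0 : ℝ) ≤ 2 * Real.pi := by positivity
  have hlim : Tendsto (fun N => ∫ θ in (0 : ℝ)..2 * Real.pi,
      ‖∑ n ∈ Finset.range N, a n * circleMap 0 r θ ^ n‖ ^ 2) atTop
      (𝓝 (∫ θ in (0 : ℝ)..2 * Real.pi, ‖g (circleMap 0 r θ)‖ ^ 2)) := by
    refine intervalIntegral.tendsto_integral_filter_of_dominated_convergence
      (fun _ => (∑' n, ‖a n‖ * r ^ n) ^ 2) (Eventually.of_forall fun N => ?_)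
      (Eventually.of_forall fun N => Eventually.of_forall fun θ _ => ?_) (by simp)
      (Eventually.of_forall fun θ _ => ?_)
    · refine Continuous.aestronglyMeasurable ?_
      exact (continuous_norm.comp (continuous_finsetSum _ fun n _ =>
        continuous_const.mul ((continuous_circleMap 0 r).pow n))).pow 2
    · rw [Real.norm_of_nonneg (by positivity)]
      refine pow_le_pow_left₀ (norm_nonneg _) ?_ 2
      refine (norm_sum_le _ _).trans (le_trans (le_of_eq ?_)
        (hs.sum_le_tsum (Finset.range N) fun n _ => by positivity))
      refine Finset.sum_congr rfl fun n _ => ?_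
      simp [abs_of_nonneg h0]
    · exact ((h _ (circleMap_mem_ball_one h0 h1 θ)).tendsto_sum_nat.norm).pow 2
  have hlim2 := hlim.const_mul (2 * Real.pi)⁻¹
  simp only [integral_norm_sum_sq] at hlim2
  have hsum : HasSum (fun n => ‖a n‖ ^ 2 * r ^ (2 * n))
      ((2 * Real.pi)⁻¹ * ∫ θ in (0 : ℝ)..2 * Real.pi, ‖g (circleMap 0 r θ)‖ ^ 2) :=
    (hasSum_iff_tendsto_nat_of_nonneg (fun n => by positivity) _).2 hlim2
  have hint : IntegrableOn (fun θ => ‖g (circleMap 0 r θ)‖ ^ 2) (Ioc 0 (2 * Real.pi)) :=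
    (intervalIntegrable_iff_integrableOn_Ioc_of_le hpi).1
      ((hcont.norm.pow 2).intervalIntegrable _ _)
  have e1 : circleMean (fun z => ‖g z‖ₑ ^ 2) r = ENNReal.ofReal
      ((2 * Real.pi)⁻¹ * ∫ θ in (0 : ℝ)..2 * Real.pi, ‖g (circleMap 0 r θ)‖ ^ 2) := by
    rw [intervalIntegral.integral_of_le hpi, ENNReal.ofReal_mul (by positivity),
      ofReal_integral_eq_lintegral_ofReal hint (Eventually.of_forall fun _ => by positivity),
      circleMean, one_div]
    congr 1
    refine lintegral_congr fun θ => ?_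
    rw [ENNReal.ofReal_pow (norm_nonneg _), ofReal_norm]
  rw [e1, ← hsum.tsum_eq, ENNReal.ofReal_tsum_of_nonneg (fun n => by positivity) hsum.summable]
  refine tsum_congr fun n => ?_
  rw [ENNReal.ofReal_mul (by positivity), ENNReal.ofReal_pow (norm_nonneg _), ofReal_norm]

/-- Each term of Parseval's sum increases with the radius. Because of this, the suprema over `r`
that define the norms behave as limits and are additive. -/
lemma circleMean_sq_mono {g : ℂ → ℂ} (hg : DifferentiableOn ℂ g (ball 0 1)) {r s : ℝ}
    (h0 : 0 ≤ r) (hrs : r ≤ s) (hs : s < 1) :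
    circleMean (fun z => ‖g z‖ₑ ^ 2) r ≤ circleMean (fun z => ‖g z‖ₑ ^ 2) s := by
  obtain ⟨a, ha⟩ := exists_hasTaylor hg
  rw [ha.circleMean_sq h0 (hrs.trans_lt hs), ha.circleMean_sq (h0.trans hrs) hs]
  gcongr

lemma enorm_sq_apply_zero_le {g : ℂ → ℂ} (hg : DifferentiableOn ℂ g (ball 0 1)) {r : ℝ}
    (h0 : 0 ≤ r) (h1 : r < 1) : ‖g 0‖ₑ ^ 2 ≤ circleMean (fun z => ‖g z‖ₑ ^ 2) r := by
  obtain ⟨a, ha⟩ := exists_hasTaylor hg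
  rw [ha.circleMean_sq h0 h1, ha.apply_zero]
  refine le_trans (by simp) (ENNReal.le_tsum 0)

lemma HasTaylor.sub {a b : ℕ → ℂ} {f g : ℂ → ℂ} (hf : HasTaylor a f) (hg : HasTaylor b g) :
    HasTaylor (fun n => a n - b n) (fun z => f z - g z) := fun z hz => by
  simpa only [sub_mul] using (hf z hz).sub (hg z hz)

lemma HasTaylor.const_mul {a : ℕ → ℂ} {f : ℂ → ℂ} (c : ℂ) (hf : HasTaylor a f) :
    HasTaylor (fun n => c * a n) (fun z => c * f z) := fun z hz => by
  simpa only [mul_assoc] using (hf z hz).mul_left c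

/-- The coefficient sequence of `z g`. -/
def shift (a : ℕ → ℂ) : ℕ → ℂ
  | 0 => 0
  | n + 1 => a n

lemma HasTaylor.shift {a : ℕ → ℂ} {f : ℂ → ℂ} (hf : HasTaylor a f) :
    HasTaylor (shift a) (fun z => z * f z) := fun z hz => by
  rw [← hasSum_nat_add_iff' 1]
  simp only [Finset.range_one, Finset.sum_singleton, Bidisc.shift, zero_mul, sub_zero]
  convert! (hf z hz).mul_left z using 2 with n
  ring

lemma HasTaylor.congr {a : ℕ → ℂ} {f g : ℂ → ℂ} (hf : HasTaylor a f)
    (h : ∀ z ∈ ball (0 : ℂ) 1, g z = f z) : HasTaylor a g := fun z hz => by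
  rw [h z hz]
  exact hf z hz

lemma HasTaylor.unique {a b : ℕ → ℂ} {g : ℂ → ℂ} (ha : HasTaylor a g) (hb : HasTaylor b g) :
    a = b := by
  have h := (ha.sub hb).circleMean_sq (r := 1 / 2) (by norm_num) (by norm_num)
  have h0 : circleMean (fun z => ‖g z - g z‖ₑ ^ 2) (1 / 2) = 0 := by simp [circleMean]
  rw [h0, eq_comm, ENNReal.tsum_eq_zero] at h
  funext n
  have hn := h n
  rw [mul_eq_zero, ENNReal.ofReal_eq_zero] at hn
  rcases hn with hn | hn
  · simpa [sub_eq_zero] using hn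
  · exact absurd hn (not_le.2 (by positivity))

lemma HasTaylor.differentiableOn {a : ℕ → ℂ} {g : ℂ → ℂ} (h : HasTaylor a g) :
    DifferentiableOn ℂ g (ball 0 1) := by
  refine DifferentiableOn.congr (f := fun z => ∑' n, a n * z ^ n) ?_
    fun z hz => (h z hz).tsum_eq.symm
  intro z hz
  rw [mem_ball_zero_iff] at hz
  obtain ⟨r, hr, hr1⟩ := exists_between hz
  have hr0 : 0 ≤ r := (norm_nonneg z).trans hr.le
  have := Complex.differentiableOn_tsum_of_summable_norm (F := fun n z => a n * z ^ n)
    (h.summable_norm hr0 hr1) (U := ball 0 r)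
    (fun n => (by fun_prop)) isOpen_ball fun n w hw => by
      rw [norm_mul, norm_pow]
      rw [mem_ball_zero_iff] at hw
      gcongr
  exact (this.differentiableAt (isOpen_ball.mem_nhds (by simpa using hr))).differentiableWithinAt

/-- The derivative already has some Taylor expansion, so comparing iterated derivatives at `0`
replaces termwise differentiation. -/
lemma HasTaylor.deriv {a : ℕ → ℂ} {g : ℂ → ℂ} (h : HasTaylor a g) :
    HasTaylor (fun n => (n + 1) * a (n + 1)) (deriv g) := by
  have hd := h.differentiableOn
  have hd' : DifferentiableOn ℂ (_root_.deriv g) (ball 0 1) := hd.deriv isOpen_ball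
  have ha := h.unique (hasTaylor_iteratedDeriv hd)
  convert! hasTaylor_iteratedDeriv hd' using 2 with n
  rw [ha, ← iteratedDeriv_succ']
  simp only [Nat.factorial_succ]
  push_cast
  have : ((n : ℂ) + 1) ≠ 0 := by exact_mod_cast n.succ_ne_zero
  field_simp

/-! ### Polar coordinates and radial weights -/

lemma circleMean_eq_of_circle {g h : ℂ → ENNReal} {r : ℝ}
    (H : ∀ z, ‖z‖ = |r| → g z = h z) : circleMean g r = circleMean h r := by
  unfold circleMean
  congr 1
  refine lintegral_congr fun θ => H _ ?_
  simp

lemma circleMean_le_of_circle {g h : ℂ → ENNReal} {r : ℝ}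
    (H : ∀ z, ‖z‖ = |r| → g z ≤ h z) : circleMean g r ≤ circleMean h r := by
  unfold circleMean
  refine mul_le_mul_right (lintegral_mono fun θ => H _ ?_) _
  simp

/-- Polar coordinates use the angles `(-π, π)` whereas `circleMean` uses `(0, 2π]`; both are
fundamental domains of the period up to a null set. -/
lemma lintegral_Ioo_circleMap (F : ℂ → ENNReal) (r : ℝ) :
    ∫⁻ θ in Ioo (-Real.pi) Real.pi, F (circleMap 0 r θ) =
      ∫⁻ θ in Ioc 0 (2 * Real.pi), F (circleMap 0 r θ) := by
  have hT : (0 : ℝ) < 2 * Real.pi := by positivity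
  have : VAddInvariantMeasure (AddSubgroup.zmultiples (2 * Real.pi)) ℝ volume :=
    ⟨fun c s _ => measure_preimage_add _ _ _⟩
  have h := IsAddFundamentalDomain.setLIntegral_eq (G := AddSubgroup.zmultiples (2 * Real.pi))
    (isAddFundamentalDomain_Ioc hT (-Real.pi)) (isAddFundamentalDomain_Ioc hT 0)
    (fun θ => F (circleMap 0 r θ)) (((periodic_circleMap 0 r).comp F).map_vadd_zmultiples)
  rw [zero_add, show -Real.pi + 2 * Real.pi = Real.pi by ring] at h
  rw [← h]
  exact setLIntegral_congr Ioo_ae_eq_Ioc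

/-- Integration in polar coordinates over the unit disc. -/
lemma lintegral_ball_eq_circleMean {F : ℂ → ENNReal} (hF : Measurable F) :
    ENNReal.ofReal (1 / Real.pi) * ∫⁻ z in ball (0 : ℂ) 1, F z =
      ∫⁻ ρ in Ioo (0 : ℝ) 1, ENNReal.ofReal (2 * ρ) * circleMean F ρ := by
  have hpolar : ∀ p : ℝ × ℝ, Complex.polarCoord.symm p = circleMap 0 p.1 p.2 := by
    intro p
    rw [Complex.polarCoord_symm_apply, circleMap, zero_add, Complex.exp_mul_I]
    push_cast
    rfl
  rw [← lintegral_indicator isOpen_ball.measurableSet, ← Complex.lintegral_comp_polarCoord_symm]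
  have hm : Measurable fun p : ℝ × ℝ => circleMap 0 p.1 p.2 := by
    unfold circleMap
    fun_prop
  rw [polarCoord_target, Measure.volume_eq_prod, ← Measure.prod_restrict, lintegral_prod _
    (by
      simp only [hpolar, smul_eq_mul]
      exact Measurable.aemeasurable ((ENNReal.measurable_ofReal.comp measurable_fst).mul
        ((hF.indicator isOpen_ball.measurableSet).comp hm)))]
  simp only [hpolar, smul_eq_mul]
  rw [← lintegral_const_mul' _ _ ENNReal.ofReal_ne_top, ← lintegral_indicator measurableSet_Ioi,
    ← lintegral_indicator measurableSet_Ioo]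
  refine lintegral_congr fun ρ => ?_
  by_cases h0 : 0 < ρ
  · rw [indicator_of_mem (show ρ ∈ Ioi (0 : ℝ) from h0)]
    by_cases h1 : ρ < 1
    · rw [indicator_of_mem (show ρ ∈ Ioo (0 : ℝ) 1 from ⟨h0, h1⟩)]
      have : ∀ θ, (ball (0 : ℂ) 1).indicator F (circleMap 0 ρ θ) = F (circleMap 0 ρ θ) :=
        fun θ => indicator_of_mem (circleMap_mem_ball_one h0.le h1 θ) _
      simp only [this]
      rw [lintegral_const_mul' _ _ ENNReal.ofReal_ne_top, lintegral_Ioo_circleMap, circleMean,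
        ← mul_assoc, ← mul_assoc, ← ENNReal.ofReal_mul (by positivity),
        ← ENNReal.ofReal_mul (by positivity)]
      congr 2
      field_simp
    · rw [indicator_of_notMem (show ρ ∉ Ioo (0 : ℝ) 1 from fun h => h1 h.2)]
      have : ∀ θ, (ball (0 : ℂ) 1).indicator F (circleMap 0 ρ θ) = 0 := fun θ =>
        indicator_of_notMem (by simpa [abs_of_pos h0] using not_lt.1 h1) _
      simp [this]
  · rw [indicator_of_notMem (show ρ ∉ Ioi (0 : ℝ) from h0),
      indicator_of_notMem (show ρ ∉ Ioo (0 : ℝ) 1 from fun h => h0 h.1)]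

/-- The weighted area integral of `|k|²` against a radial weight. -/
lemma HasTaylor.lintegral_radial {a : ℕ → ℂ} {k : ℂ → ℂ} (h : HasTaylor a k) (hk : Measurable k)
    {W : ℝ → ENNReal} (hW : Measurable W) :
    ENNReal.ofReal (1 / Real.pi) * ∫⁻ z in ball (0 : ℂ) 1, ‖k z‖ₑ ^ 2 * W ‖z‖ =
      ∑' n, ‖a n‖ₑ ^ 2 * ∫⁻ ρ in Ioo (0 : ℝ) 1, ENNReal.ofReal (2 * ρ ^ (2 * n + 1)) * W ρ := by
  rw [lintegral_ball_eq_circleMean (F := fun z => ‖k z‖ₑ ^ 2 * W ‖z‖)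
    ((hk.enorm.pow_const 2).mul (hW.comp measurable_norm))]
  simp only [← lintegral_const_mul' _ _ (ENNReal.pow_ne_top enorm_ne_top)]
  rw [← lintegral_tsum fun n => (by fun_prop)]
  refine setLIntegral_congr_fun measurableSet_Ioo fun ρ hρ => ?_
  have h1 : circleMean (fun z => ‖k z‖ₑ ^ 2 * W ‖z‖) ρ =
      W ρ * circleMean (fun z => ‖k z‖ₑ ^ 2) ρ := by
    rw [← circleMean_const_mul _ (hk.enorm.pow_const 2)]
    refine circleMean_eq_of_circle fun z hz => ?_
    rw [hz, abs_of_pos hρ.1, mul_comm]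
  simp only [h1]
  rw [h.circleMean_sq hρ.1.le hρ.2, ← ENNReal.tsum_mul_left, ← ENNReal.tsum_mul_left]
  refine tsum_congr fun n => ?_
  rw [show 2 * ρ ^ (2 * n + 1) = 2 * ρ * ρ ^ (2 * n) by ring,
    ENNReal.ofReal_mul (p := 2 * ρ) (by linarith [hρ.1])]
  ring

lemma lintegral_Ioo_of_hasDerivAt {F f : ℝ → ℝ} (hF : ContinuousOn F (Icc 0 1))
    (hd : ∀ x ∈ Ioo (0 : ℝ) 1, HasDerivAt F (f x) x) (hf : ∀ x ∈ Ioo (0 : ℝ) 1, 0 ≤ f x) :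
    ∫⁻ x in Ioo (0 : ℝ) 1, ENNReal.ofReal (f x) = ENNReal.ofReal (F 1 - F 0) := by
  have hint : IntervalIntegrable f volume 0 1 :=
    (intervalIntegrable_iff_integrableOn_Ioc_of_le zero_le_one).2
      (intervalIntegral.integrableOn_deriv_of_nonneg hF hd hf)
  rw [← intervalIntegral.integral_eq_sub_of_hasDerivAt_of_le zero_le_one hF hd hint,
    intervalIntegral.integral_of_le zero_le_one, integral_Ioc_eq_integral_Ioo,
    ofReal_integral_eq_lintegral_ofReal]
  · exact ((intervalIntegrable_iff_integrableOn_Ioo_of_le zero_le_one).1 hint)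
  · exact (ae_restrict_iff' measurableSet_Ioo).2 (Eventually.of_forall hf)

/-- The moments of `1 - |z|²`, the numerator of the Poisson kernel; they are the weights in
`seqEnergy`. -/
lemma lintegral_pow_one_sub_sq (n : ℕ) :
    ∫⁻ ρ in Ioo (0 : ℝ) 1, ENNReal.ofReal (2 * ρ ^ (2 * n + 1)) * ENNReal.ofReal (1 - ρ ^ 2) =
      ENNReal.ofReal (1 / ((n + 1) * (n + 2))) := by
  have h : ∀ ρ ∈ Ioo (0 : ℝ) 1, ENNReal.ofReal (2 * ρ ^ (2 * n + 1)) * ENNReal.ofReal (1 - ρ ^ 2) =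
      ENNReal.ofReal (2 * ρ ^ (2 * n + 1) * (1 - ρ ^ 2)) := fun ρ hρ => by
    have := hρ.1
    rw [← ENNReal.ofReal_mul (by positivity)]
  rw [setLIntegral_congr_fun measurableSet_Ioo h, lintegral_Ioo_of_hasDerivAt
    (F := fun ρ => ρ ^ (2 * n + 2) / (n + 1) - ρ ^ (2 * n + 4) / (n + 2))]
  · congr 1
    simp
    field_simp
    ring
  · fun_prop
  · intro x _
    have h1 := ((hasDerivAt_pow (2 * n + 2) x).div_const ((n : ℝ) + 1)).sub
      ((hasDerivAt_pow (2 * n + 4) x).div_const ((n : ℝ) + 2))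
    convert! h1 using 1
    have : (n : ℝ) + 1 ≠ 0 := by positivity
    have : (n : ℝ) + 2 ≠ 0 := by positivity
    push_cast
    field_simp
    ring
  · intro x hx
    have h1 : x ^ 2 ≤ 1 := pow_le_one₀ hx.1.le hx.2.le
    have := hx.1
    exact mul_nonneg (by positivity) (by linarith)

/-- The moments of the Green kernel at `0`. The value `1/(n+1)²` cancels the factor `(n+1)²`
produced by differentiation in the Littlewood–Paley identity. -/
lemma lintegral_pow_neg_log (n : ℕ) :
    ∫⁻ ρ in Ioo (0 : ℝ) 1, ENNReal.ofReal (2 * ρ ^ (2 * n + 1)) *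
      ENNReal.ofReal (-(2 * Real.log ρ)) = ENNReal.ofReal (1 / ((n : ℝ) + 1) ^ 2) := by
  have h : ∀ ρ ∈ Ioo (0 : ℝ) 1, ENNReal.ofReal (2 * ρ ^ (2 * n + 1)) *
      ENNReal.ofReal (-(2 * Real.log ρ)) =
      ENNReal.ofReal (2 * ρ ^ (2 * n + 1) * (-(2 * Real.log ρ))) := fun ρ hρ => by
    have := hρ.1
    rw [← ENNReal.ofReal_mul (by positivity)]
  rw [setLIntegral_congr_fun measurableSet_Ioo h, lintegral_Ioo_of_hasDerivAt
    (F := fun ρ => ρ ^ (2 * n + 2) / ((n : ℝ) + 1) ^ 2 -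
      2 * (ρ ^ (2 * n + 1) * (ρ * Real.log ρ)) / (n + 1))]
  · congr 1
    simp
  · have := Real.continuous_mul_log
    fun_prop
  · intro x hx
    have hx0 : x ≠ 0 := hx.1.ne'
    have h1 := ((hasDerivAt_pow (2 * n + 2) x).div_const (((n : ℝ) + 1) ^ 2)).sub
      ((((hasDerivAt_pow (2 * n + 1) x).mul ((hasDerivAt_id x).mul
        (Real.hasDerivAt_log hx0))).const_mul 2).div_const ((n : ℝ) + 1))
    convert! h1 using 1
    have : (n : ℝ) + 1 ≠ 0 := by positivity
    push_cast
    simp only [id, Pi.mul_apply]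
    field_simp
    ring
  · intro x hx
    have h1 : Real.log x ≤ 0 := Real.log_nonpos hx.1.le hx.2.le
    have := hx.1
    exact mul_nonneg (by positivity) (by linarith)

/-! ### The local Dirichlet integral at a boundary point, in terms of sequences -/

/-- The sum `∑_{m ≤ n + 1} m α_m`. -/
def derivSum (α : ℕ → ℂ) (n : ℕ) : ℂ := ∑ m ∈ Finset.range (n + 2), m * α m

/-- The remainder term `|∑_{m ≤ n + 1} m α_m|² / (n + 1)`. -/
noncomputable def remTerm (α : ℕ → ℂ) (n : ℕ) : ℝ := ‖derivSum α n‖ ^ 2 / (n + 1)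

/-- The partial sums of `∑ₙ |∑_{m ≤ n + 1} m α_m|² / ((n + 1)(n + 2))`. -/
noncomputable def partialEnergy (α : ℕ → ℂ) (n : ℕ) : ℝ := ∑ j ∈ Finset.range n, remTerm α j / (j + 2)

/-- The local Dirichlet integral at `1` of `∑ α_m z^m`. -/
noncomputable def seqEnergy (α : ℕ → ℂ) : ENNReal := ∑' n : ℕ, ENNReal.ofReal (remTerm α n / (n + 2))

/-- The local Dirichlet integral at `1` of the polynomial `∑_{m ≤ n + 1} α_m z^m`. -/
noncomputable def polyEnergy (α : ℕ → ℂ) (n : ℕ) : ℝ := partialEnergy α n + remTerm α n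

lemma remTerm_nonneg (α : ℕ → ℂ) (n : ℕ) : 0 ≤ remTerm α n := by
  unfold remTerm; positivity

lemma remTerm_div_nonneg (α : ℕ → ℂ) (n : ℕ) : 0 ≤ remTerm α n / (n + 2) :=
  div_nonneg (remTerm_nonneg α n) (by positivity)

lemma derivSum_succ (α : ℕ → ℂ) (n : ℕ) :
    derivSum α (n + 1) = derivSum α n + (n + 2) * α (n + 2) := by
  rw [derivSum, Finset.sum_range_succ, ← derivSum]
  push_cast
  ring

lemma derivSum_shift (α : ℕ → ℂ) (n : ℕ) :
    derivSum (shift α) (n + 1) = derivSum α n + ∑ m ∈ Finset.range (n + 2), α m := by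
  rw [derivSum, Finset.sum_range_succ', derivSum, ← Finset.sum_add_distrib]
  simp only [shift, mul_zero, add_zero]
  refine Finset.sum_congr rfl fun m _ => ?_
  push_cast
  ring

/-- For a polynomial of degree at most `n + 1` the sums `derivSum` are constant from index `n` on,
and `1/((j+1)(j+2))` telescopes, so the tail of the series is exactly `remTerm α n`. Raising the
degree only changes that tail, from the index `n + 1` on. -/
lemma polyEnergy_succ (α : ℕ → ℂ) (n : ℕ) : polyEnergy α (n + 1) = polyEnergy α n +
    (‖derivSum α (n + 1)‖ ^ 2 - ‖derivSum α n‖ ^ 2) / (n + 2) := by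
  rw [polyEnergy, partialEnergy, Finset.sum_range_succ, ← partialEnergy, polyEnergy, remTerm,
    remTerm]
  push_cast
  have : (n : ℝ) + 1 ≠ 0 := by positivity
  have : (n : ℝ) + 2 ≠ 0 := by positivity
  have : (n : ℝ) + 1 + 1 ≠ 0 := by positivity
  field_simp
  ring

/-- For polynomials this is `D(zp) = D(p) + |p(1)|²`. By `polyEnergy_succ` the inductive step
compares the increments of both sides, which agree once the squared moduli are expanded. -/
lemma polyEnergy_shift (α : ℕ → ℂ) (n : ℕ) : polyEnergy (shift α) (n + 1) =
    polyEnergy α n + ‖∑ m ∈ Finset.range (n + 2), α m‖ ^ 2 := by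
  induction n with
  | zero =>
    simp only [polyEnergy, partialEnergy, remTerm, derivSum, Finset.sum_range_succ,
      Finset.sum_range_zero, shift]
    simp only [Complex.sq_norm, Complex.normSq_apply]
    simp
    ring
  | succ n ih =>
    rw [polyEnergy_succ, ih, polyEnergy_succ, derivSum_shift, derivSum_shift, derivSum_succ,
      Finset.sum_range_succ _ (n + 2)]
    set C := derivSum α n
    set s := ∑ m ∈ Finset.range (n + 2), α m
    set a := α (n + 2)
    have h2 : (n : ℝ) + 2 ≠ 0 := by positivity
    have h3 : (n : ℝ) + 1 + 2 ≠ 0 := by positivity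
    simp only [Complex.sq_norm, Complex.normSq_apply]
    simp
    field_simp
    ring

lemma polyEnergy_nonneg (α : ℕ → ℂ) (n : ℕ) : 0 ≤ polyEnergy α n :=
  add_nonneg (Finset.sum_nonneg fun j _ => remTerm_div_nonneg α j) (remTerm_nonneg α n)

/-- Write `p - p(0) = z q`. The constant term does not affect the energy, so `D(p) = D(zq) = D(q) +
|q(1)|²`, and `q(1) = p(1) - p(0)`. -/
lemma norm_sum_sub_sq_le (α : ℕ → ℂ) (n : ℕ) :
    ‖(∑ m ∈ Finset.range (n + 2), α m) - α 0‖ ^ 2 ≤ polyEnergy α n := by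
  set β : ℕ → ℂ := fun m => α (m + 1) with hβ
  have hC : derivSum (shift β) = derivSum α := by
    funext k
    rw [derivSum, derivSum, Finset.sum_range_succ', Finset.sum_range_succ' _ (k + 1)]
    simp [shift, hβ]
  have hE : polyEnergy (shift β) = polyEnergy α := by
    funext k
    simp only [polyEnergy, partialEnergy, remTerm, hC]
  rw [Finset.sum_range_succ', add_sub_cancel_right, ← hE]
  cases n with
  | zero =>
    simp [polyEnergy, partialEnergy, remTerm, derivSum, Finset.sum_range_succ, shift, hβ]
  | succ n =>
    rw [polyEnergy_shift]
    exact le_add_of_nonneg_left (polyEnergy_nonneg β n)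

lemma norm_sum_sq_le (α : ℕ → ℂ) (n : ℕ) :
    ‖∑ m ∈ Finset.range (n + 2), α m‖ ^ 2 ≤ 2 * ‖α 0‖ ^ 2 + 2 * polyEnergy α n := by
  have h := norm_sum_sub_sq_le α n
  set s := ∑ m ∈ Finset.range (n + 2), α m
  have h1 : ‖s‖ ≤ ‖s - α 0‖ + ‖α 0‖ := by simpa using norm_add_le (s - α 0) (α 0)
  nlinarith [norm_nonneg s, norm_nonneg (s - α 0), norm_nonneg (α 0),
    sq_nonneg (‖s - α 0‖ - ‖α 0‖)]

/-- The harmonic series diverges. Applied to `remTerm`, this makes the tails of the truncations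
small for infinitely many degrees, which is enough to pass from polynomials to power series. -/
lemma frequently_lt_of_summable_div {y : ℕ → ℝ} (hs : Summable fun n : ℕ => y n / (n + 2)) {ε : ℝ}
    (hε : 0 < ε) : ∃ᶠ n in atTop, y n < ε := by
  intro h
  simp only [not_lt] at h
  have h1 : Summable fun n : ℕ => ε / ((n : ℝ) + 2) := by
    refine Summable.of_norm_bounded_eventually_nat hs ?_
    filter_upwards [h] with n hn
    rw [Real.norm_of_nonneg (by positivity)]
    gcongr
  have h2 : Summable fun n : ℕ => 1 / (n : ℝ) := by
    rw [← summable_nat_add_iff 2]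
    refine (h1.mul_left ε⁻¹).congr fun n => ?_
    push_cast
    field_simp
  exact Real.not_summable_one_div_natCast h2

lemma seqEnergy_ne_top_iff (α : ℕ → ℂ) :
    seqEnergy α ≠ ⊤ ↔ Summable fun n : ℕ => remTerm α n / (n + 2) := by
  constructor
  · intro h
    refine (ENNReal.summable_toReal h).congr fun n => ?_
    rw [ENNReal.toReal_ofReal (remTerm_div_nonneg α n)]
  · intro h
    exact h.tsum_ofReal_ne_top

lemma seqEnergy_eq {α : ℕ → ℂ} (h : seqEnergy α ≠ ⊤) :
    seqEnergy α = ENNReal.ofReal (∑' n : ℕ, remTerm α n / (n + 2)) :=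
  (ENNReal.ofReal_tsum_of_nonneg (remTerm_div_nonneg α) ((seqEnergy_ne_top_iff α).1 h)).symm

lemma partialEnergy_le {α : ℕ → ℂ} (h : seqEnergy α ≠ ⊤) (n : ℕ) :
    partialEnergy α n ≤ ∑' n : ℕ, remTerm α n / (n + 2) :=
  ((seqEnergy_ne_top_iff α).1 h).sum_le_tsum _ fun j _ => remTerm_div_nonneg α j

/-- For truncations, `polyEnergy_shift` and `norm_sum_sq_le` bound the new energy by `polyEnergy α n
+ (2 ‖α 0‖² + 2 polyEnergy α n)`. The remainder in `polyEnergy α n` is removed along a sequence of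
degrees where it is small. -/
lemma seqEnergy_shift_le (α : ℕ → ℂ) :
    seqEnergy (shift α) ≤ 3 * seqEnergy α + 2 * ‖α 0‖ₑ ^ 2 := by
  by_cases h : seqEnergy α = ⊤
  · simp [h, ENNReal.mul_top]
  set D := ∑' n : ℕ, remTerm α n / (n + 2) with hD
  have hD0 : 0 ≤ D := tsum_nonneg (remTerm_div_nonneg α)
  have key : ∀ m, partialEnergy (shift α) m ≤ 3 * D + 2 * ‖α 0‖ ^ 2 := by
    intro m
    refine le_of_forall_pos_le_add fun ε hε => ?_
    -- The remainder enters with coefficient `3`, hence `ε / 3`.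
    obtain ⟨n, hx, hn⟩ := ((frequently_lt_of_summable_div ((seqEnergy_ne_top_iff α).1 h)
      (show (0 : ℝ) < ε / 3 by positivity)).and_eventually (eventually_ge_atTop m)).exists
    have h1 : partialEnergy (shift α) m ≤ partialEnergy (shift α) (n + 1) :=
      Finset.sum_le_sum_of_subset_of_nonneg (Finset.range_mono (by omega))
        fun j _ _ => remTerm_div_nonneg _ j
    have h2 : partialEnergy (shift α) (n + 1) ≤ polyEnergy (shift α) (n + 1) :=
      le_add_of_nonneg_right (remTerm_nonneg _ _)
    have h3 := polyEnergy_shift α n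
    have h4 := norm_sum_sq_le α n
    have h5 := partialEnergy_le h n
    have h6 : polyEnergy α n = partialEnergy α n + remTerm α n := rfl
    linarith
  have hs : Summable fun n : ℕ => remTerm (shift α) n / (n + 2) :=
    summable_of_sum_range_le (remTerm_div_nonneg _) key
  rw [seqEnergy_eq ((seqEnergy_ne_top_iff _).2 hs), seqEnergy_eq h]
  have h7 : ∑' n : ℕ, remTerm (shift α) n / (n + 2) ≤ 3 * D + 2 * ‖α 0‖ ^ 2 :=
    hs.tsum_le_of_sum_range_le key
  refine (ENNReal.ofReal_le_ofReal h7).trans (le_of_eq ?_)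
  rw [ENNReal.ofReal_add (by positivity) (by positivity), ENNReal.ofReal_mul (by norm_num),
    ENNReal.ofReal_mul (by norm_num), ENNReal.ofReal_pow (norm_nonneg _), ofReal_norm]
  simp [hD]

/-- The index shift costs only a bounded factor, since `n + k + 2 ≤ (k + 1)(n + 2)`. It allows
remainders at different indices to share the denominator `n + 2`. -/
lemma summable_remTerm_add {α : ℕ → ℂ} (h : seqEnergy α ≠ ⊤) (k : ℕ) :
    Summable fun n : ℕ => remTerm α (n + k) / (n + 2) := by
  have h1 := (summable_nat_add_iff k).2 ((seqEnergy_ne_top_iff α).1 h)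
  refine Summable.of_nonneg_of_le (fun n => div_nonneg (remTerm_nonneg _ _) (by positivity))
    (fun n => ?_) (h1.mul_left ((k : ℝ) + 1))
  have h0 := remTerm_nonneg α (n + k)
  rw [← mul_div_assoc, div_le_div_iff₀ (by positivity) (by positivity)]
  push_cast
  nlinarith [mul_nonneg h0 (mul_nonneg (Nat.cast_nonneg (α := ℝ) k) (Nat.cast_nonneg (α := ℝ) n)),
    mul_nonneg h0 (Nat.cast_nonneg (α := ℝ) k)]

lemma tendsto_partialEnergy {α : ℕ → ℂ} (h : seqEnergy α ≠ ⊤) :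
    Tendsto (partialEnergy α) atTop (𝓝 (∑' n : ℕ, remTerm α n / (n + 2))) :=
  ((seqEnergy_ne_top_iff α).1 h).hasSum.tendsto_sum_nat

/-- The increments `|p(1)|²` and `|(zp)(1)|²` of the two successive shifts coincide, so the identity
is exact for truncations. The three remainders are small simultaneously for infinitely many `n`,
because their sum is still summable against `1/(n+2)`. -/
lemma seqEnergy_shift_shift {α : ℕ → ℂ} (h : seqEnergy α ≠ ⊤) :
    seqEnergy (shift (shift α)) + seqEnergy α = 2 * seqEnergy (shift α) := by
  have h1 : seqEnergy (shift α) ≠ ⊤ := ne_top_of_le_ne_top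
    (ENNReal.add_ne_top.2 ⟨ENNReal.mul_ne_top (by simp) h, by finiteness⟩) (seqEnergy_shift_le α)
  have h2 : seqEnergy (shift (shift α)) ≠ ⊤ := ne_top_of_le_ne_top
    (ENNReal.add_ne_top.2 ⟨ENNReal.mul_ne_top (by simp) h1, by finiteness⟩)
    (seqEnergy_shift_le (shift α))
  rw [seqEnergy_eq h, seqEnergy_eq h1, seqEnergy_eq h2]
  have t0 := tendsto_partialEnergy h
  -- Each multiplication by `z` raises the degree by one; the truncations are compared at `n`, `n +
  -- 1` and `n + 2`.
  have t1 := (tendsto_partialEnergy h1).comp (tendsto_add_atTop_nat 1)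
  have t2 := (tendsto_partialEnergy h2).comp (tendsto_add_atTop_nat 2)
  set D := ∑' n : ℕ, remTerm α n / (n + 2)
  set D₁ := ∑' n : ℕ, remTerm (shift α) n / (n + 2)
  set D₂ := ∑' n : ℕ, remTerm (shift (shift α)) n / (n + 2)
  have t := ((t2.sub (t1.const_mul 2)).add t0).abs
  have hrel : ∀ n, polyEnergy (shift (shift α)) (n + 2) - 2 * polyEnergy (shift α) (n + 1) +
      polyEnergy α n = 0 := by
    intro n
    have e1 := polyEnergy_shift (shift α) (n + 1)
    have e2 := polyEnergy_shift α n
    have e3 : ∑ m ∈ Finset.range (n + 1 + 2), shift α m = ∑ m ∈ Finset.range (n + 2), α m := by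
      rw [Finset.sum_range_succ']
      simp [shift]
    rw [e3] at e1
    linarith
  have hsum : Summable fun n : ℕ => (remTerm (shift (shift α)) (n + 2) +
      2 * remTerm (shift α) (n + 1) + remTerm α n) / (n + 2) := by
    refine (((summable_remTerm_add h2 2).add ((summable_remTerm_add h1 1).mul_left 2)).add
      (summable_remTerm_add h 0)).congr fun n => ?_
    simp only [add_zero]
    ring
  have hL : |D₂ - 2 * D₁ + D| ≤ 0 := by
    refine le_of_forall_pos_le_add fun ε hε => ?_
    rw [zero_add]
    refine le_of_tendsto_of_frequently t ?_
    refine (frequently_lt_of_summable_div hsum hε).mono fun n hn => ?_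
    have e := hrel n
    simp only [polyEnergy] at e
    have p2 := remTerm_nonneg (shift (shift α)) (n + 2)
    have p1 := remTerm_nonneg (shift α) (n + 1)
    have p0 := remTerm_nonneg α n
    simp only [Function.comp]
    rw [abs_le]
    constructor <;> linarith
  have hL0 : D₂ + D = 2 * D₁ := by
    have := abs_eq_zero.1 (le_antisymm hL (abs_nonneg _))
    linarith
  rw [← ENNReal.ofReal_add (tsum_nonneg (remTerm_div_nonneg _)) (tsum_nonneg (remTerm_div_nonneg _)),
    hL0, ENNReal.ofReal_mul (by norm_num)]
  simp

lemma derivSum_const_mul (c : ℂ) (α : ℕ → ℂ) (n : ℕ) :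
    derivSum (fun m => c * α m) n = c * derivSum α n := by
  simp only [derivSum, Finset.mul_sum]
  refine Finset.sum_congr rfl fun m _ => ?_
  ring

lemma seqEnergy_const_mul {c : ℂ} (hc : ‖c‖ = 1) (α : ℕ → ℂ) :
    seqEnergy (fun m => c * α m) = seqEnergy α := by
  simp only [seqEnergy, remTerm, derivSum_const_mul, norm_mul, hc, one_mul]

/-! ### Local Dirichlet integrals at points of the closed disc -/

open Classical in
/-- The weight `U_{δ_ζ}` of the unit point mass at `ζ`, for `ζ` in the closed unit disc. -/
noncomputable def pointWeight (ζ w : ℂ) : ENNReal :=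
  if ζ ∈ ball (0 : ℂ) 1 then greenKernel ζ w * ENNReal.ofReal (1 / (1 - ‖ζ‖ ^ 2))
  else poissonKer ζ w

/-- The local Dirichlet integral at `ζ`. -/
noncomputable def localEnergy (ζ : ℂ) (g : ℂ → ℂ) : ENNReal :=
  ENNReal.ofReal (1 / Real.pi) * ∫⁻ z in ball (0 : ℂ) 1, ‖deriv g z‖ₑ ^ 2 * pointWeight ζ z

lemma deriv_eqOn_ball {f g : ℂ → ℂ} (h : ∀ z ∈ ball (0 : ℂ) 1, f z = g z) :
    ∀ z ∈ ball (0 : ℂ) 1, deriv f z = deriv g z := fun _ hz =>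
  Filter.EventuallyEq.deriv_eq (Filter.eventually_of_mem (isOpen_ball.mem_nhds hz) h)

lemma sub_ne_zero_of_mem_ball {ζ z : ℂ} (hζ : 1 ≤ ‖ζ‖) (hz : z ∈ ball (0 : ℂ) 1) : ζ - z ≠ 0 := by
  intro h
  rw [sub_eq_zero] at h
  rw [h] at hζ
  exact absurd (mem_ball_zero_iff.1 hz) (not_lt.2 hζ)

/-- The local Dirichlet integral at a point of the unit circle in terms of Taylor coefficients. -/
lemma HasTaylor.localEnergy_sphere {a : ℕ → ℂ} {g : ℂ → ℂ} (h : HasTaylor a g) {ζ : ℂ}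
    (hζ : ‖ζ‖ = 1) : localEnergy ζ g = seqEnergy (fun m => a m * ζ ^ m) := by
  have hne := fun z hz => sub_ne_zero_of_mem_ball (z := z) hζ.ge hz
  -- Dividing by `ζ - z` absorbs the denominator of the Poisson kernel and leaves the radial weight
  -- `1 - |z|²`.
  set k : ℂ → ℂ := fun z => _root_.deriv g z / (ζ - z) with hk
  have hkd : DifferentiableOn ℂ k (ball 0 1) :=
    (h.differentiableOn.deriv isOpen_ball).div (by fun_prop) hne
  have hkm : Measurable k := (measurable_deriv g).div (by fun_prop)
  obtain ⟨κ, hκ⟩ := exists_hasTaylor hkd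
  have hrel := h.deriv.unique (((hκ.const_mul ζ).sub hκ.shift).congr fun z hz => by
    have := hne z hz
    simp only [hk]
    field_simp)
  -- Comparing coefficients in `g' = (ζ - z) k` gives `(n+1) a_{n+1} = ζ κ_n - κ_{n-1}`; multiplied
  -- by `ζ^(n+1)`, this telescopes.
  have hC : ∀ n, derivSum (fun m => a m * ζ ^ m) n = κ n * ζ ^ (n + 2) := by
    intro n
    induction n with
    | zero =>
      have h0 := congrFun hrel 0
      simp only [Bidisc.shift] at h0
      simp [derivSum, Finset.sum_range_succ] at h0 ⊢
      rw [h0]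
      ring
    | succ n ih =>
      have h0 := congrFun hrel (n + 1)
      simp only [Bidisc.shift] at h0
      push_cast at h0
      rw [derivSum_succ, ih]
      linear_combination ζ ^ (n + 2) * h0
  have h1 := hκ.lintegral_radial hkm (W := fun ρ => ENNReal.ofReal (1 - ρ ^ 2)) (by fun_prop)
  have h2 : localEnergy ζ g = ENNReal.ofReal (1 / Real.pi) *
      ∫⁻ z in ball (0 : ℂ) 1, ‖k z‖ₑ ^ 2 * ENNReal.ofReal (1 - ‖z‖ ^ 2) := by
    unfold localEnergy
    congr 1
    refine setLIntegral_congr_fun isOpen_ball.measurableSet fun z hz => ?_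
    have hn : 0 < ‖ζ - z‖ ^ 2 := by
      have := norm_pos_iff.2 (hne z hz)
      positivity
    simp only [pointWeight, poissonKer]
    rw [if_neg (by simp [hζ]), ENNReal.ofReal_div_of_pos hn, ENNReal.ofReal_pow (norm_nonneg _),
      ofReal_norm, show _root_.deriv g z = k z * (ζ - z) by simp [hk, hne z hz], enorm_mul, mul_pow,
      mul_assoc, ENNReal.mul_div_cancel]
    · exact pow_ne_zero 2 (by simpa using hne z hz)
    · finiteness
  rw [h2, h1, seqEnergy]
  refine tsum_congr fun n => ?_
  rw [lintegral_pow_one_sub_sq, remTerm, hC, norm_mul, norm_pow, hζ, one_pow, mul_one, div_div,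
    div_eq_mul_one_div (‖κ n‖ ^ 2), ENNReal.ofReal_mul (by positivity), ENNReal.ofReal_pow (norm_nonneg _),
    ofReal_norm]

/-- Shifting before or after twisting the coefficients by `ζ^m` differs by the unimodular factor
`ζ`, which the energy ignores. -/
lemma HasTaylor.localEnergy_sphere_mul {a : ℕ → ℂ} {g : ℂ → ℂ} (h : HasTaylor a g) {ζ : ℂ}
    (hζ : ‖ζ‖ = 1) :
    localEnergy ζ (fun z => z * g z) = seqEnergy (Bidisc.shift fun m => a m * ζ ^ m) := by
  rw [h.shift.localEnergy_sphere hζ, ← seqEnergy_const_mul hζ (Bidisc.shift _)]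
  congr 1
  funext m
  cases m with
  | zero => simp [Bidisc.shift]
  | succ m =>
    simp only [Bidisc.shift]
    ring

lemma HasTaylor.localEnergy_sphere_mul_mul {a : ℕ → ℂ} {g : ℂ → ℂ} (h : HasTaylor a g) {ζ : ℂ}
    (hζ : ‖ζ‖ = 1) : localEnergy ζ (fun z => z * (z * g z)) =
      seqEnergy (Bidisc.shift (Bidisc.shift fun m => a m * ζ ^ m)) := by
  rw [h.shift.localEnergy_sphere_mul hζ, ← seqEnergy_const_mul hζ (Bidisc.shift (Bidisc.shift _))]
  congr 1
  funext m
  match m with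
  | 0 => simp [Bidisc.shift]
  | 1 => simp [Bidisc.shift]
  | m + 2 =>
    simp only [Bidisc.shift]
    ring

lemma localEnergy_sphere_second_difference {g : ℂ → ℂ} (hg : DifferentiableOn ℂ g (ball 0 1))
    {ζ : ℂ} (hζ : ‖ζ‖ = 1) (h : localEnergy ζ g ≠ ⊤) :
    localEnergy ζ (fun z => z * (z * g z)) + localEnergy ζ g =
      2 * localEnergy ζ (fun z => z * g z) := by
  obtain ⟨a, ha⟩ := exists_hasTaylor hg
  rw [ha.localEnergy_sphere hζ] at h
  rw [ha.localEnergy_sphere hζ, ha.localEnergy_sphere_mul hζ, ha.localEnergy_sphere_mul_mul hζ]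
  exact seqEnergy_shift_shift h

/-! ### Points of the open disc -/

/-- The square of the Hardy norm on the unit disc. -/
noncomputable def diskHardyNormSq (F : ℂ → ℂ) : ENNReal :=
  ⨆ r ∈ Ioo (0 : ℝ) 1, circleMean (fun z => ‖F z‖ₑ ^ 2) r

lemma le_diskHardyNormSq (F : ℂ → ℂ) {r : ℝ} (hr : r ∈ Ioo (0 : ℝ) 1) :
    circleMean (fun z => ‖F z‖ₑ ^ 2) r ≤ diskHardyNormSq F :=
  le_iSup₂ (f := fun r (_ : r ∈ Ioo (0 : ℝ) 1) => circleMean (fun z => ‖F z‖ₑ ^ 2) r) r hr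

lemma HasTaylor.diskHardyNormSq_eq {b : ℕ → ℂ} {F : ℂ → ℂ} (h : HasTaylor b F) :
    diskHardyNormSq F = ∑' n, ‖b n‖ₑ ^ 2 := by
  refine le_antisymm (iSup₂_le fun r hr => ?_) ?_
  · rw [h.circleMean_sq hr.1.le hr.2]
    refine ENNReal.tsum_le_tsum fun n => ?_
    refine mul_le_of_le_one_right' (by
      rw [← ENNReal.ofReal_one]
      exact ENNReal.ofReal_le_ofReal (pow_le_one₀ hr.1.le hr.2.le))
  · rw [ENNReal.tsum_eq_iSup_nat]
    refine iSup_le fun N => ?_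
    have ht : Tendsto (fun r : ℝ => ∑ n ∈ Finset.range N, ‖b n‖ₑ ^ 2 * ENNReal.ofReal (r ^ (2 * n)))
        (𝓝[<] 1) (𝓝 (∑ n ∈ Finset.range N, ‖b n‖ₑ ^ 2)) := by
      refine tendsto_finsetSum _ fun n _ => ?_
      have h1 : Tendsto (fun r : ℝ => ENNReal.ofReal (r ^ (2 * n))) (𝓝[<] 1) (𝓝 1) := by
        have : Continuous fun r : ℝ => ENNReal.ofReal (r ^ (2 * n)) :=
          ENNReal.continuous_ofReal.comp (by fun_prop)
        simpa using (this.tendsto 1).mono_left nhdsWithin_le_nhds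
      simpa using ENNReal.Tendsto.const_mul h1 (Or.inl one_ne_zero)
    refine le_of_tendsto ht ?_
    filter_upwards [Ioo_mem_nhdsLT (show (0 : ℝ) < 1 by norm_num)] with r hr
    refine le_trans ?_ (le_diskHardyNormSq F hr)
    rw [h.circleMean_sq hr.1.le hr.2]
    exact ENNReal.sum_le_tsum _

/-- The Littlewood–Paley identity. -/
lemma HasTaylor.littlewood_paley {b : ℕ → ℂ} {F : ℂ → ℂ} (h : HasTaylor b F) :
    ENNReal.ofReal (1 / Real.pi) * (∫⁻ z in ball (0 : ℂ) 1,
      ‖_root_.deriv F z‖ₑ ^ 2 * ENNReal.ofReal (-(2 * Real.log ‖z‖))) + ‖F 0‖ₑ ^ 2 =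
    diskHardyNormSq F := by
  have h1 := h.deriv.lintegral_radial (measurable_deriv F)
    (W := fun ρ => ENNReal.ofReal (-(2 * Real.log ρ))) (by fun_prop)
  rw [h1, h.diskHardyNormSq_eq, tsum_eq_zero_add' (f := fun n => ‖b n‖ₑ ^ 2) ENNReal.summable, h.apply_zero, add_comm]
  congr 1
  refine tsum_congr fun n => ?_
  rw [lintegral_pow_neg_log, enorm_mul, mul_pow, mul_right_comm]
  have : ‖(n : ℂ) + 1‖ₑ ^ 2 * ENNReal.ofReal (1 / ((n : ℝ) + 1) ^ 2) = 1 := by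
    have e : ‖(n : ℂ) + 1‖ₑ = ENNReal.ofReal ((n : ℝ) + 1) := by
      rw [← ofReal_norm]
      congr 1
      exact_mod_cast Complex.norm_natCast (n + 1)
    rw [e, ← ENNReal.ofReal_pow (by positivity), ← ENNReal.ofReal_mul (by positivity),
      mul_one_div_cancel (by positivity), ENNReal.ofReal_one]
  rw [this, one_mul]

/-- The involutive automorphism of the disc exchanging `0` and `ζ`. -/
noncomputable def involution (ζ w : ℂ) : ℂ := (ζ - w) / (1 - (starRingEnd ℂ) ζ * w)

section involution

variable {ζ : ℂ}

lemma one_sub_conj_mul_ne_zero (hζ : ζ ∈ ball (0 : ℂ) 1) {w : ℂ} (hw : w ∈ ball (0 : ℂ) 1) :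
    1 - (starRingEnd ℂ) ζ * w ≠ 0 := by
  intro h
  have h1 : ‖(starRingEnd ℂ) ζ * w‖ = 1 := by rw [← sub_eq_zero.1 h]; simp
  rw [norm_mul, RCLike.norm_conj] at h1
  rw [mem_ball_zero_iff] at hζ hw
  nlinarith [norm_nonneg ζ, norm_nonneg w]

lemma normSq_one_sub_conj_mul (ζ w : ℂ) : ‖1 - (starRingEnd ℂ) ζ * w‖ ^ 2 - ‖ζ - w‖ ^ 2 =
    (1 - ‖ζ‖ ^ 2) * (1 - ‖w‖ ^ 2) := by
  simp only [Complex.sq_norm, Complex.normSq_apply]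
  simp
  ring

lemma one_sub_norm_involution_sq (hζ : ζ ∈ ball (0 : ℂ) 1) {w : ℂ} (hw : w ∈ ball (0 : ℂ) 1) :
    1 - ‖involution ζ w‖ ^ 2 =
      (1 - ‖ζ‖ ^ 2) * (1 - ‖w‖ ^ 2) / ‖1 - (starRingEnd ℂ) ζ * w‖ ^ 2 := by
  have h := norm_pos_iff.2 (one_sub_conj_mul_ne_zero hζ hw)
  rw [← normSq_one_sub_conj_mul, involution, norm_div, div_pow, sub_div, div_self (by positivity)]

lemma one_sub_sq_pos {w : ℂ} (hw : w ∈ ball (0 : ℂ) 1) : 0 < 1 - ‖w‖ ^ 2 := by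
  rw [mem_ball_zero_iff] at hw
  nlinarith [norm_nonneg w]

lemma involution_mem (hζ : ζ ∈ ball (0 : ℂ) 1) {w : ℂ} (hw : w ∈ ball (0 : ℂ) 1) :
    involution ζ w ∈ ball (0 : ℂ) 1 := by
  have h := norm_pos_iff.2 (one_sub_conj_mul_ne_zero hζ hw)
  have h1 : 0 < 1 - ‖involution ζ w‖ ^ 2 := by
    rw [one_sub_norm_involution_sq hζ hw]
    have := one_sub_sq_pos hζ
    have := one_sub_sq_pos hw
    positivity
  rw [mem_ball_zero_iff]
  nlinarith [norm_nonneg (involution ζ w)]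

lemma involution_involution (hζ : ζ ∈ ball (0 : ℂ) 1) {w : ℂ} (hw : w ∈ ball (0 : ℂ) 1) :
    involution ζ (involution ζ w) = w := by
  have h := one_sub_conj_mul_ne_zero hζ hw
  have h3 := one_sub_conj_mul_ne_zero hζ (involution_mem hζ hw)
  rw [involution.eq_1 ζ (involution ζ w), div_eq_iff h3]
  have e : involution ζ w * (1 - (starRingEnd ℂ) ζ * w) = ζ - w := div_mul_cancel₀ _ h
  linear_combination -e

lemma image_involution (hζ : ζ ∈ ball (0 : ℂ) 1) :
    involution ζ '' ball (0 : ℂ) 1 = ball (0 : ℂ) 1 := by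
  refine Subset.antisymm ?_ fun w hw => ⟨_, involution_mem hζ hw, involution_involution hζ hw⟩
  rintro _ ⟨w, hw, rfl⟩
  exact involution_mem hζ hw

lemma injOn_involution (hζ : ζ ∈ ball (0 : ℂ) 1) : InjOn (involution ζ) (ball (0 : ℂ) 1) :=
  fun x hx y hy h => by
    rw [← involution_involution hζ hx, h, involution_involution hζ hy]

lemma involution_zero (ζ : ℂ) : involution ζ 0 = ζ := by simp [involution]

lemma involution_self (ζ : ℂ) : involution ζ ζ = 0 := by simp [involution]

lemma differentiableOn_involution (hζ : ζ ∈ ball (0 : ℂ) 1) :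
    DifferentiableOn ℂ (involution ζ) (ball 0 1) :=
  DifferentiableOn.div (by fun_prop) (by fun_prop) fun _ hw => one_sub_conj_mul_ne_zero hζ hw

/-- The automorphism moves the pole `ζ` to `0`, where the kernel is radial. The point `u = 0` is
excluded because there the left side is `⊤` while the convention `Real.log 0 = 0` makes the right
side `0`. -/
lemma greenKernel_involution (hζ : ζ ∈ ball (0 : ℂ) 1) {u : ℂ} (hu : u ∈ ball (0 : ℂ) 1)
    (hu0 : u ≠ 0) :
    greenKernel ζ (involution ζ u) = ENNReal.ofReal (-(2 * Real.log ‖u‖)) := by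
  have hne : involution ζ u ≠ ζ := fun h => hu0 (by
    rw [← involution_involution hζ hu, h, involution_self])
  rw [greenKernel, if_neg hne]
  have h : (1 - (starRingEnd ℂ) ζ * involution ζ u) / (involution ζ u - ζ) = -u⁻¹ := by
    conv_rhs => rw [← involution_involution hζ hu]
    rw [involution.eq_1 ζ (involution ζ u), inv_div, ← div_neg, neg_sub]
  rw [h, norm_neg, norm_inv, Real.log_pow, Real.log_inv]
  push_cast
  congr 1
  ring

/-- Change of variables: the real Jacobian of a holomorphic map is `|φ'|²`. -/
lemma lintegral_ball_involution (hζ : ζ ∈ ball (0 : ℂ) 1) (h : ℂ → ENNReal) :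
    ∫⁻ w in ball (0 : ℂ) 1, h w =
      ∫⁻ u in ball (0 : ℂ) 1, ‖deriv (involution ζ) u‖ₑ ^ 2 * h (involution ζ u) := by
  have hd : ∀ u ∈ ball (0 : ℂ) 1, HasFDerivWithinAt (involution ζ)
      ((ContinuousLinearMap.toSpanSingleton ℂ (deriv (involution ζ) u)).restrictScalars ℝ)
      (ball 0 1) u := fun u hu =>
    ((((differentiableOn_involution hζ).differentiableAt
      (isOpen_ball.mem_nhds hu)).hasDerivAt.hasFDerivAt).restrictScalars ℝ).hasFDerivWithinAt
  conv_lhs => rw [← image_involution hζ]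
  rw [lintegral_image_eq_lintegral_abs_det_fderiv_mul volume isOpen_ball.measurableSet hd
    (injOn_involution hζ)]
  refine lintegral_congr fun u => ?_
  congr 1
  have : ((ContinuousLinearMap.toSpanSingleton ℂ
      (deriv (involution ζ) u)).restrictScalars ℝ).det = ‖deriv (involution ζ) u‖ ^ 2 := by
    rw [Complex.sq_norm]
    simp [ContinuousLinearMap.det, LinearMap.det_restrictScalars, Algebra.norm_complex_apply]
  rw [this, abs_of_nonneg (by positivity), ENNReal.ofReal_pow (norm_nonneg _), ofReal_norm]

/-- The weighted area integral against the Green kernel. -/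
noncomputable def greenEnergy (ζ : ℂ) (f : ℂ → ℂ) : ENNReal :=
  ENNReal.ofReal (1 / Real.pi) * ∫⁻ z in ball (0 : ℂ) 1, ‖deriv f z‖ₑ ^ 2 * greenKernel ζ z

lemma localEnergy_of_mem_ball (hζ : ζ ∈ ball (0 : ℂ) 1) (f : ℂ → ℂ) :
    localEnergy ζ f = greenEnergy ζ f * ENNReal.ofReal (1 / (1 - ‖ζ‖ ^ 2)) := by
  unfold localEnergy greenEnergy pointWeight
  simp only [if_pos hζ, ← mul_assoc]
  rw [lintegral_mul_const' _ _ ENNReal.ofReal_ne_top, mul_assoc]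

lemma differentiableOn_comp_involution (hζ : ζ ∈ ball (0 : ℂ) 1) {f : ℂ → ℂ}
    (hf : DifferentiableOn ℂ f (ball 0 1)) :
    DifferentiableOn ℂ (fun u => f (involution ζ u)) (ball 0 1) :=
  hf.comp (differentiableOn_involution hζ) fun _ hu => involution_mem hζ hu

/-- This is the Littlewood–Paley identity for `f ∘ φ`, where `φ` is the involution: the Jacobian
`|φ'|²` combines with `|f' ∘ φ|²` to give `|(f ∘ φ)'|²`. -/
lemma greenEnergy_add (hζ : ζ ∈ ball (0 : ℂ) 1) {f : ℂ → ℂ}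
    (hf : DifferentiableOn ℂ f (ball 0 1)) :
    greenEnergy ζ f + ‖f ζ‖ₑ ^ 2 = diskHardyNormSq (fun u => f (involution ζ u)) := by
  obtain ⟨b, hb⟩ := exists_hasTaylor (differentiableOn_comp_involution hζ hf)
  rw [← hb.littlewood_paley, involution_zero, greenEnergy, lintegral_ball_involution hζ]
  congr 2
  refine setLIntegral_congr_fun_ae isOpen_ball.measurableSet ?_
  have h0 : ∀ᵐ u : ℂ, u ≠ 0 := by simp [ae_iff]
  filter_upwards [h0] with u hu0 hu
  have hc : deriv (fun u => f (involution ζ u)) u =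
      deriv f (involution ζ u) * deriv (involution ζ) u :=
    deriv_comp u (hf.differentiableAt (isOpen_ball.mem_nhds (involution_mem hζ hu)))
      ((differentiableOn_involution hζ).differentiableAt (isOpen_ball.mem_nhds hu))
  rw [hc, greenKernel_involution hζ hu hu0, enorm_mul, mul_pow]
  ring

/-- For fixed `s` and `r` in `(s, 1)`, monotonicity gives `c r * A s ≤ B r`; let `r` tend to `1`. -/
lemma iSup_le_iSup_of_tendsto_one {A B : ℝ → ENNReal} {c : ℝ → ENNReal}
    (hA : ∀ r s, 0 < r → r ≤ s → s < 1 → A r ≤ A s) (hc : Tendsto c (𝓝[<] 1) (𝓝 1))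
    (h : ∀ r ∈ Ioo (0 : ℝ) 1, c r * A r ≤ B r) :
    ⨆ r ∈ Ioo (0 : ℝ) 1, A r ≤ ⨆ r ∈ Ioo (0 : ℝ) 1, B r := by
  refine iSup₂_le fun s hs => ?_
  have ht : Tendsto (fun r => c r * A s) (𝓝[<] 1) (𝓝 (1 * A s)) :=
    ENNReal.Tendsto.mul_const hc (Or.inl one_ne_zero)
  rw [one_mul] at ht
  refine le_of_tendsto ht ?_
  filter_upwards [Ioo_mem_nhdsLT hs.2] with r hr
  have hr' : r ∈ Ioo (0 : ℝ) 1 := ⟨hs.1.trans hr.1, hr.2⟩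
  exact (mul_le_mul_right (hA s r hs.1 hr.1.le hr.2) _).trans ((h r hr').trans
    (le_iSup₂ (f := fun r (_ : r ∈ Ioo (0 : ℝ) 1) => B r) r hr'))

/-- The involution is an inner function whose modulus tends to `1` uniformly at the circle, so
multiplication by it preserves the Hardy norm. -/
lemma diskHardyNormSq_involution_mul (hζ : ζ ∈ ball (0 : ℂ) 1) {F : ℂ → ℂ}
    (hF : DifferentiableOn ℂ F (ball 0 1)) (hFm : Measurable F) :
    diskHardyNormSq (fun u => involution ζ u * F u) = diskHardyNormSq F := by
  have hζ' : ‖ζ‖ < 1 := mem_ball_zero_iff.1 hζ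
  refine le_antisymm (iSup₂_mono fun r hr => circleMean_le_of_circle fun z hz => ?_) ?_
  · have hz1 : z ∈ ball (0 : ℂ) 1 := by
      rw [mem_ball_zero_iff, hz, abs_of_pos hr.1]
      exact hr.2
    rw [enorm_mul, mul_pow]
    refine mul_le_of_le_one_left' (pow_le_one' ?_ 2)
    rw [← ofReal_norm, ← ENNReal.ofReal_one]
    exact ENNReal.ofReal_le_ofReal (mem_ball_zero_iff.1 (involution_mem hζ hz1)).le
  · refine iSup_le_iSup_of_tendsto_one
      -- A lower bound for `|φ|²` on the circle of radius `r`, obtained from the formula for `1 -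
      -- |φ|²` and `|1 - ζ̄ z| ≥ 1 - |ζ|`.
      (c := fun r => ENNReal.ofReal (1 - (1 - ‖ζ‖ ^ 2) * (1 - r ^ 2) / (1 - ‖ζ‖) ^ 2))
      (fun r s hr hrs hs => circleMean_sq_mono hF hr.le hrs hs) ?_ fun r hr => ?_
    · have : Continuous fun r : ℝ =>
          ENNReal.ofReal (1 - (1 - ‖ζ‖ ^ 2) * (1 - r ^ 2) / (1 - ‖ζ‖) ^ 2) :=
        ENNReal.continuous_ofReal.comp (by fun_prop)
      simpa using (this.tendsto 1).mono_left nhdsWithin_le_nhds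
    · rw [← circleMean_const_mul _ (hFm.enorm.pow_const 2)]
      refine circleMean_le_of_circle fun z hz => ?_
      rw [abs_of_pos hr.1] at hz
      have hz1 : z ∈ ball (0 : ℂ) 1 := by
        rw [mem_ball_zero_iff, hz]
        exact hr.2
      rw [enorm_mul, mul_pow]
      refine mul_le_mul_left ?_ _
      rw [← ofReal_norm, ← ENNReal.ofReal_pow (norm_nonneg _)]
      refine ENNReal.ofReal_le_ofReal ?_
      have h1 := one_sub_norm_involution_sq hζ hz1
      have h2 : 1 - ‖ζ‖ ≤ ‖1 - (starRingEnd ℂ) ζ * z‖ := by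
        have := norm_sub_norm_le 1 ((starRingEnd ℂ) ζ * z)
        rw [norm_mul, RCLike.norm_conj, norm_one] at this
        nlinarith [norm_nonneg ζ, mem_ball_zero_iff.1 hz1]
      have h3 : (1 - ‖ζ‖ ^ 2) * (1 - ‖z‖ ^ 2) / ‖1 - (starRingEnd ℂ) ζ * z‖ ^ 2 ≤
          (1 - ‖ζ‖ ^ 2) * (1 - ‖z‖ ^ 2) / (1 - ‖ζ‖) ^ 2 := by
        have h4 := one_sub_sq_pos hζ
        have h5 := one_sub_sq_pos hz1
        have h6 : 0 < 1 - ‖ζ‖ := by linarith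
        gcongr
      rw [hz] at h3 h1
      linarith

end involution

/-- Composed with the involution `φ`, `z f` becomes `φ · (f ∘ φ)`, which has the Hardy norm of `f ∘
φ`. Two uses of `greenEnergy_add` then show that the Green energy grows by `(1 - |ζ|²)|f(ζ)|²`, and
the normalization of the weight cancels the factor `1 - |ζ|²`. -/
lemma localEnergy_ball_mul {ζ : ℂ} (hζ : ζ ∈ ball (0 : ℂ) 1) {f : ℂ → ℂ}
    (hf : DifferentiableOn ℂ f (ball 0 1)) :
    localEnergy ζ (fun z => z * f z) = localEnergy ζ f + ‖f ζ‖ₑ ^ 2 := by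
  classical
  -- Extension by zero provides global measurability without changing the function on the disc.
  set F : ℂ → ℂ := (ball (0 : ℂ) 1).piecewise (fun u => f (involution ζ u)) (fun _ => 0) with hF
  have hd := differentiableOn_comp_involution hζ hf
  have hFe : ∀ u ∈ ball (0 : ℂ) 1, F u = f (involution ζ u) := fun u hu =>
    piecewise_eq_of_mem _ _ _ hu
  have hFd : DifferentiableOn ℂ F (ball 0 1) := hd.congr hFe
  have hFm : Measurable F :=
    hd.continuousOn.measurable_piecewise continuousOn_const isOpen_ball.measurableSet
  have hcongr : ∀ {G H : ℂ → ℂ}, (∀ u ∈ ball (0 : ℂ) 1, G u = H u) →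
      diskHardyNormSq G = diskHardyNormSq H := fun {G H} h =>
    iSup_congr fun r => iSup_congr fun hr => circleMean_eq_of_circle fun z hz => by
      rw [h z (by rw [mem_ball_zero_iff, hz, abs_of_pos hr.1]; exact hr.2)]
  have h1 := greenEnergy_add hζ hf
  have h2 := greenEnergy_add hζ (f := fun z => z * f z) (differentiableOn_id.mul hf)
  have h3 := diskHardyNormSq_involution_mul hζ hFd hFm
  rw [hcongr hFe, ← h1, hcongr (H := fun u => involution ζ u * f (involution ζ u))
    (fun u hu => by rw [hFe u hu]), ← h2] at h3
  have hp := one_sub_sq_pos hζ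
  have hs : ENNReal.ofReal (1 - ‖ζ‖ ^ 2) + ‖ζ‖ₑ ^ 2 = 1 := by
    rw [← ofReal_norm, ← ENNReal.ofReal_pow (norm_nonneg _),
      ← ENNReal.ofReal_add hp.le (by positivity)]
    simp
  have h4 : greenEnergy ζ (fun z => z * f z) =
      greenEnergy ζ f + ENNReal.ofReal (1 - ‖ζ‖ ^ 2) * ‖f ζ‖ₑ ^ 2 := by
    have h5 : ‖ζ * f ζ‖ₑ ^ 2 ≠ ⊤ := by finiteness
    rw [← ENNReal.add_left_inj h5, h3, enorm_mul, mul_pow, add_assoc, ← add_mul, hs, one_mul]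
  rw [localEnergy_of_mem_ball hζ, localEnergy_of_mem_ball hζ, h4, add_mul, mul_right_comm,
    ← ENNReal.ofReal_mul hp.le, mul_one_div_cancel hp.ne', ENNReal.ofReal_one, one_mul]

/-- Write `f - f(0) = z k`. Then `localEnergy_ball_mul` for `k` bounds `|k(ζ)|²`, hence also `|f(ζ)
- f(0)|²`, by the energy of `f`. -/
lemma enorm_sq_le_localEnergy {ζ : ℂ} (hζ : ζ ∈ ball (0 : ℂ) 1) {f : ℂ → ℂ}
    (hf : DifferentiableOn ℂ f (ball 0 1)) :
    ‖f ζ‖ₑ ^ 2 ≤ 2 * localEnergy ζ f + 2 * ‖f 0‖ₑ ^ 2 := by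
  have hk : DifferentiableOn ℂ (dslope f 0) (ball 0 1) :=
    (Complex.differentiableOn_dslope (isOpen_ball.mem_nhds (by simp))).2 hf
  have hrel : ∀ z, z * dslope f 0 z = f z - f 0 := fun z => by
    simpa using sub_smul_dslope f 0 z
  have h1 := localEnergy_ball_mul hζ hk
  have h2 : localEnergy ζ (fun z => z * dslope f 0 z) = localEnergy ζ f := by
    simp only [hrel, localEnergy, deriv_sub_const]
  have h3 : ‖f ζ - f 0‖ₑ ^ 2 ≤ localEnergy ζ f := by
    rw [← hrel, ← h2, h1, enorm_mul, mul_pow]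
    refine le_trans (mul_le_of_le_one_left' (pow_le_one' ?_ 2)) le_add_self
    rw [← ofReal_norm, ← ENNReal.ofReal_one]
    exact ENNReal.ofReal_le_ofReal (mem_ball_zero_iff.1 hζ).le
  calc ‖f ζ‖ₑ ^ 2 = ‖(f ζ - f 0) + f 0‖ₑ ^ 2 := by rw [sub_add_cancel]
    _ ≤ 2 * ‖f ζ - f 0‖ₑ ^ 2 + 2 * ‖f 0‖ₑ ^ 2 := enorm_add_sq_le _ _
    _ ≤ _ := by gcongr

lemma localEnergy_mul_le {ζ : ℂ} (hζ : ζ ∈ closedBall (0 : ℂ) 1) {f : ℂ → ℂ}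
    (hf : DifferentiableOn ℂ f (ball 0 1)) :
    localEnergy ζ (fun z => z * f z) ≤ 3 * localEnergy ζ f + 2 * ‖f 0‖ₑ ^ 2 := by
  by_cases h : ζ ∈ ball (0 : ℂ) 1
  · rw [localEnergy_ball_mul h hf]
    calc _ ≤ localEnergy ζ f + (2 * localEnergy ζ f + 2 * ‖f 0‖ₑ ^ 2) := by
          gcongr; exact enorm_sq_le_localEnergy h hf
      _ = _ := by ring
  · have h1 : ‖ζ‖ = 1 := le_antisymm (by simpa using hζ) (by simpa using h)
    obtain ⟨a, ha⟩ := exists_hasTaylor hf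
    rw [ha.localEnergy_sphere_mul h1, ha.localEnergy_sphere h1, ha.apply_zero]
    simpa using seqEnergy_shift_le fun m => a m * ζ ^ m

/-! ### Integrating local Dirichlet integrals against the measure -/

lemma measurable_pointWeight : Measurable fun p : ℂ × ℂ => pointWeight p.2 p.1 := by
  classical
  have hg : Measurable (fun p : ℂ × ℂ =>
      greenKernel p.2 p.1 * ENNReal.ofReal (1 / (1 - ‖p.2‖ ^ 2))) := by
    refine Measurable.mul ?_ (by fun_prop)
    refine Measurable.ite (measurableSet_eq_fun measurable_fst measurable_snd)
      measurable_const ?_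
    have : Measurable (fun p : ℂ × ℂ => (starRingEnd ℂ) p.2) :=
      (Complex.continuous_conj.comp continuous_snd).measurable
    fun_prop
  have hp : Measurable (fun p : ℂ × ℂ => poissonKer p.2 p.1) := by
    unfold poissonKer
    fun_prop
  exact Measurable.ite (measurable_snd isOpen_ball.measurableSet) hg hp

lemma weight_eq (μ : Measure ℂ) (w : ℂ) :
    weight μ w = ∫⁻ ζ in closedBall (0 : ℂ) 1, pointWeight ζ w ∂μ := by
  rw [← ball_union_sphere, lintegral_union isClosed_sphere.measurableSet
    (sphere_disjoint_ball.symm), weight]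
  congr 1
  · exact setLIntegral_congr_fun isOpen_ball.measurableSet fun ζ hζ => by
      simp only [pointWeight, if_pos hζ]
  · exact setLIntegral_congr_fun isClosed_sphere.measurableSet fun ζ hζ => by
      rw [pointWeight, if_neg (by simp [mem_sphere_zero_iff_norm.1 hζ])]

lemma measurable_localEnergy (g : ℂ → ℂ) : Measurable fun ζ => localEnergy ζ g := by
  refine Measurable.const_mul ?_ _
  refine Measurable.lintegral_prod_right'
    (f := fun p : ℂ × ℂ => ‖deriv g p.2‖ₑ ^ 2 * pointWeight p.1 p.2) ?_
  exact (((measurable_deriv g).comp measurable_snd).enorm.pow_const 2).mul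
    (measurable_pointWeight.comp measurable_swap)

/-- The Dirichlet integral is the average of the local Dirichlet integrals. -/
lemma diskEnergy_eq (μ : Measure ℂ) [IsFiniteMeasure μ] (g : ℂ → ℂ) :
    diskEnergy μ g = ∫⁻ ζ in closedBall (0 : ℂ) 1, localEnergy ζ g ∂μ := by
  have hm : Measurable fun p : ℂ × ℂ => ‖deriv g p.1‖ₑ ^ 2 * pointWeight p.2 p.1 :=
    (((measurable_deriv g).comp measurable_fst).enorm.pow_const 2).mul measurable_pointWeight
  have h1 : ∀ z, ‖deriv g z‖ₑ ^ 2 * weight μ z =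
      ∫⁻ ζ in closedBall (0 : ℂ) 1, ‖deriv g z‖ₑ ^ 2 * pointWeight ζ z ∂μ := fun z => by
    rw [weight_eq, lintegral_const_mul' _ _ (by finiteness)]
  simp only [diskEnergy, h1, localEnergy]
  rw [lintegral_lintegral_swap hm.aemeasurable, lintegral_const_mul' _ _ ENNReal.ofReal_ne_top]

lemma diskEnergy_mul_le (μ : Measure ℂ) [IsFiniteMeasure μ] {f : ℂ → ℂ}
    (hf : DifferentiableOn ℂ f (ball 0 1)) :
    diskEnergy μ (fun z => z * f z) ≤ 3 * diskEnergy μ f + 2 * μ univ * ‖f 0‖ₑ ^ 2 := by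
  rw [diskEnergy_eq, diskEnergy_eq]
  calc _ ≤ ∫⁻ ζ in closedBall (0 : ℂ) 1, (3 * localEnergy ζ f + 2 * ‖f 0‖ₑ ^ 2) ∂μ :=
        setLIntegral_mono' isClosed_closedBall.measurableSet fun ζ hζ => localEnergy_mul_le hζ hf
    _ = 3 * (∫⁻ ζ in closedBall (0 : ℂ) 1, localEnergy ζ f ∂μ) +
        2 * ‖f 0‖ₑ ^ 2 * μ (closedBall 0 1) := by
      rw [lintegral_add_right _ measurable_const, lintegral_const_mul _ (measurable_localEnergy f),
        setLIntegral_const]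
    _ ≤ _ := by
      rw [mul_right_comm 2 (μ univ)]
      gcongr
      exact subset_univ _

/-- Without mass in the open disc only boundary points contribute. Finite total energy makes the
local energy finite almost everywhere, as the identity at a boundary point requires. -/
lemma diskEnergy_second_difference {μ : Measure ℂ} [IsFiniteMeasure μ]
    (hμ : μ (ball 0 1) = 0) {f : ℂ → ℂ} (hf : DifferentiableOn ℂ f (ball 0 1))
    (h : diskEnergy μ f ≠ ⊤) :
    diskEnergy μ (fun z => z * (z * f z)) + diskEnergy μ f =
      2 * diskEnergy μ (fun z => z * f z) := by
  rw [diskEnergy_eq] at h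
  rw [diskEnergy_eq, diskEnergy_eq, diskEnergy_eq, ← lintegral_add_left (measurable_localEnergy _),
    ← lintegral_const_mul _ (measurable_localEnergy _)]
  refine lintegral_congr_ae ?_
  have h1 := ae_lt_top (measurable_localEnergy f) h
  have h2 : ∀ᵐ ζ ∂μ.restrict (closedBall (0 : ℂ) 1), ζ ∉ ball (0 : ℂ) 1 :=
    ae_restrict_of_ae (measure_eq_zero_iff_ae_notMem.1 hμ)
  filter_upwards [h1, h2, ae_restrict_mem isClosed_closedBall.measurableSet] with ζ h1 h2 h3
  exact localEnergy_sphere_second_difference hf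
    (le_antisymm (by simpa using h3) (by simpa using h2)) h1.ne

lemma diskEnergy_const (μ : Measure ℂ) (c : ℂ) : diskEnergy μ (fun _ => c) = 0 := by
  simp [diskEnergy]

/-- For `f = 1` the second difference of the local energy is `|ζ|² - 1 < 0` inside the disc and `0`
on the circle. A nonpositive function with integral zero vanishes almost everywhere, so the open
disc is null. -/
lemma measure_ball_eq_zero_of_second_difference {μ : Measure ℂ} [IsFiniteMeasure μ]
    (h : diskEnergy μ (fun z => z * (z * 1)) + diskEnergy μ (fun _ => 1) =
      2 * diskEnergy μ (fun z => z * 1)) : μ (ball 0 1) = 0 := by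
  have hz : DifferentiableOn ℂ (fun z : ℂ => z * 1) (ball 0 1) := by fun_prop
  have h1 : DifferentiableOn ℂ (fun _ : ℂ => (1 : ℂ)) (ball 0 1) := by fun_prop
  have l0 : ∀ ζ, localEnergy ζ (fun _ => 1) = 0 := fun ζ => by simp [localEnergy]
  have b1 : ∀ ζ ∈ ball (0 : ℂ) 1, localEnergy ζ (fun z => z * 1) = 1 := fun ζ hζ => by
    rw [localEnergy_ball_mul hζ h1, l0]
    simp
  have b2 : ∀ ζ ∈ ball (0 : ℂ) 1, localEnergy ζ (fun z => z * (z * 1)) = 1 + ‖ζ‖ₑ ^ 2 :=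
    fun ζ hζ => by
      rw [localEnergy_ball_mul hζ hz, b1 ζ hζ, mul_one]
  have hfin : ∀ ζ ∈ closedBall (0 : ℂ) 1, localEnergy ζ (fun z => z * 1) ≤ 2 := fun ζ hζ =>
    (localEnergy_mul_le hζ h1).trans (by simp [l0])
  have hle : ∀ ζ ∈ closedBall (0 : ℂ) 1,
      localEnergy ζ (fun z => z * (z * 1)) ≤ 2 * localEnergy ζ (fun z => z * 1) := by
    intro ζ hζ
    by_cases hb : ζ ∈ ball (0 : ℂ) 1
    · rw [b1 ζ hb, b2 ζ hb, mul_one, show (2 : ENNReal) = 1 + 1 from one_add_one_eq_two.symm]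
      refine add_le_add_right (pow_le_one' ?_ 2) 1
      rw [← ofReal_norm, ← ENNReal.ofReal_one]
      exact ENNReal.ofReal_le_ofReal (mem_ball_zero_iff.1 hb).le
    · have h2 : ‖ζ‖ = 1 := le_antisymm (by simpa using hζ) (by simpa using hb)
      have := localEnergy_sphere_second_difference h1 h2 (by simp [l0])
      rw [l0, add_zero] at this
      exact this.le
  rw [diskEnergy_const, add_zero, diskEnergy_eq, diskEnergy_eq,
    ← lintegral_const_mul _ (measurable_localEnergy _)] at h
  have hfinite : ∫⁻ ζ in closedBall (0 : ℂ) 1, localEnergy ζ (fun z => z * (z * 1)) ∂μ ≠ ⊤ := by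
    rw [h]
    refine ne_top_of_le_ne_top ?_ (setLIntegral_mono' (g := fun _ => 4)
      isClosed_closedBall.measurableSet fun ζ hζ =>
        (mul_le_mul_right (hfin ζ hζ) 2).trans (by norm_num))
    rw [setLIntegral_const]
    finiteness
  -- Pointwise inequality together with equality of finite integrals gives equality almost
  -- everywhere.
  have hae := (ae_eq_of_ae_le_of_lintegral_le
    ((ae_restrict_mem isClosed_closedBall.measurableSet).mono hle) hfinite
    ((measurable_localEnergy _).const_mul 2).aemeasurable h.ge)
  rw [Filter.EventuallyEq, ae_restrict_iff' isClosed_closedBall.measurableSet] at hae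
  rw [measure_eq_zero_iff_ae_notMem]
  filter_upwards [hae] with ζ h3 hb
  have h4 := h3 (ball_subset_closedBall hb)
  rw [b1 ζ hb, b2 ζ hb, mul_one, show (2 : ENNReal) = 1 + 1 from one_add_one_eq_two.symm, ENNReal.add_right_inj (by simp)] at h4
  have h5 : ‖ζ‖ ^ 2 = 1 := by
    rw [← ofReal_norm, ← ENNReal.ofReal_pow (norm_nonneg _), ENNReal.ofReal_eq_one] at h4
    exact h4
  have := one_sub_sq_pos hb
  linarith

/-! ### The norms as suprema of `L²` norms, and quadratic forms -/

/-- The normalized arc length measure on the circle of radius `r`. -/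
noncomputable def circleMeasure (r : ℝ) : Measure ℂ :=
  ENNReal.ofReal (1 / (2 * Real.pi)) •
    (volume.restrict (Ioc 0 (2 * Real.pi))).map (circleMap 0 r)

instance (r : ℝ) : SFinite (circleMeasure r) := by unfold circleMeasure; infer_instance

lemma lintegral_circleMeasure {g : ℂ → ENNReal} (hg : Measurable g) (r : ℝ) :
    ∫⁻ z, g z ∂circleMeasure r = circleMean g r := by
  rw [circleMeasure, lintegral_smul_measure, lintegral_map hg (continuous_circleMap 0 r).measurable,
    smul_eq_mul, circleMean]

/-- The measure `U_μ dA` on the unit disc. -/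
noncomputable def weightedArea (μ : Measure ℂ) : Measure ℂ :=
  ENNReal.ofReal (1 / Real.pi) • (volume.restrict (ball (0 : ℂ) 1)).withDensity (weight μ)

instance (μ : Measure ℂ) : SFinite (weightedArea μ) := by unfold weightedArea; infer_instance

lemma lintegral_weightedArea (μ : Measure ℂ) [IsFiniteMeasure μ] {g : ℂ → ENNReal}
    (hg : Measurable g) : ∫⁻ z, g z ∂weightedArea μ =
      ENNReal.ofReal (1 / Real.pi) * ∫⁻ z in ball (0 : ℂ) 1, g z * weight μ z := by
  rw [weightedArea, lintegral_smul_measure, lintegral_withDensity_eq_lintegral_mul _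
    (measurable_weight μ) hg, smul_eq_mul]
  simp only [Pi.mul_apply, mul_comm]

lemma measurable_slice {F : ℂ × ℂ → ENNReal} (hF : Measurable F) (z : ℂ) :
    Measurable fun w => F (z, w) := hF.comp measurable_prodMk_left

lemma measurable_slice' {F : ℂ × ℂ → ENNReal} (hF : Measurable F) (w : ℂ) :
    Measurable fun z => F (z, w) := hF.comp measurable_prodMk_right

/-- The supremum of the `L²` norms, squared, with respect to a family of measures. -/
noncomputable def supEnergy (ν : ℝ → Measure (ℂ × ℂ)) (Φ : ℂ × ℂ → ℂ) : ENNReal :=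
  ⨆ r ∈ Ioo (0 : ℝ) 1, ∫⁻ p, ‖Φ p‖ₑ ^ 2 ∂ν r

lemma hardyNormSq_eq_supEnergy {f : ℂ × ℂ → ℂ} (hf : Measurable f) :
    hardyNormSq f = supEnergy (fun r => (circleMeasure r).prod (circleMeasure r)) f := by
  refine iSup_congr fun r => iSup_congr fun _ => ?_
  have hm : Measurable fun z => ‖f z‖ₑ ^ 2 := hf.enorm.pow_const 2
  rw [lintegral_prod _ hm.aemeasurable, ← lintegral_circleMeasure (measurable_circleMean hm r)]
  refine lintegral_congr fun z => ?_
  rw [lintegral_circleMeasure (measurable_slice hm z)]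

/-- The derivative in the first variable, with the variables exchanged. -/
noncomputable def sliceDeriv (f : ℂ × ℂ → ℂ) (p : ℂ × ℂ) : ℂ :=
  (ball (0 : ℂ) 1).indicator (fun z => deriv (fun z => f (z, p.1)) z) p.2

lemma sliceDeriv_of_mem (f : ℂ × ℂ → ℂ) {z : ℂ} (hz : z ∈ ball (0 : ℂ) 1) (w : ℂ) :
    sliceDeriv f (w, z) = deriv (fun z => f (z, w)) z := indicator_of_mem hz _

lemma sliceDeriv_of_notMem (f : ℂ × ℂ → ℂ) {z : ℂ} (hz : z ∉ ball (0 : ℂ) 1) (w : ℂ) :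
    sliceDeriv f (w, z) = 0 := indicator_of_notMem hz _

lemma measurable_sliceDeriv {f : ℂ × ℂ → ℂ} (hf : f ∈ holo) : Measurable (sliceDeriv f) :=
  measurable_deriv_slice hf

lemma diskEnergy_slice_eq (μ : Measure ℂ) [IsFiniteMeasure μ] {f : ℂ × ℂ → ℂ} (hf : f ∈ holo)
    (w : ℂ) : diskEnergy μ (fun z => f (z, w)) =
      ∫⁻ z, ‖sliceDeriv f (w, z)‖ₑ ^ 2 ∂weightedArea μ := by
  have hm : Measurable fun p => ‖sliceDeriv f p‖ₑ ^ 2 := (measurable_sliceDeriv hf).enorm.pow_const 2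
  rw [lintegral_weightedArea μ (measurable_slice hm w), diskEnergy]
  congr 1
  exact setLIntegral_congr_fun isOpen_ball.measurableSet fun z hz => by
    simp only [sliceDeriv_of_mem f hz]

lemma energy₁_eq_supEnergy (μ : Measure ℂ) [IsFiniteMeasure μ] {f : ℂ × ℂ → ℂ} (hf : f ∈ holo) :
    energy₁ μ f =
      supEnergy (fun r => (circleMeasure r).prod (weightedArea μ)) (sliceDeriv f) := by
  refine iSup_congr fun r => iSup_congr fun _ => ?_
  have hm : Measurable fun p => ‖sliceDeriv f p‖ₑ ^ 2 := (measurable_sliceDeriv hf).enorm.pow_const 2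
  rw [lintegral_prod _ hm.aemeasurable, ← lintegral_circleMeasure (measurable_diskEnergy_slice μ hf)]
  exact lintegral_congr fun w => diskEnergy_slice_eq μ hf w

lemma iSup_Ioo_add {A B : ℝ → ENNReal} (hA : ∀ r s, 0 < r → r ≤ s → s < 1 → A r ≤ A s)
    (hB : ∀ r s, 0 < r → r ≤ s → s < 1 → B r ≤ B s) :
    ⨆ r ∈ Ioo (0 : ℝ) 1, (A r + B r) =
      (⨆ r ∈ Ioo (0 : ℝ) 1, A r) + ⨆ r ∈ Ioo (0 : ℝ) 1, B r := by
  simp only [iSup_subtype']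
  exact (ENNReal.iSup_add_iSup_of_monotone
    (f := fun r : Ioo (0 : ℝ) 1 => A r) (g := fun r : Ioo (0 : ℝ) 1 => B r)
    (fun r s h => hA r s r.2.1 h s.2.2) (fun r s h => hB r s r.2.1 h s.2.2)).symm

/-- A lower semicontinuous quadratic form on the holomorphic functions on the bidisc, with values
in `[0, ∞]`. -/
structure IsQuadForm (Q : (ℂ × ℂ → ℂ) → ENNReal) : Prop where
  add_le : ∀ f ∈ holo, ∀ g ∈ holo, ∀ t : ℝ, 0 < t →
    Q (f + g) ≤ ENNReal.ofReal (1 + t) * Q f + ENNReal.ofReal (1 + t⁻¹) * Q g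
  parallelogram : ∀ f ∈ holo, ∀ g ∈ holo, Q (f + g) + Q (f - g) = 2 * Q f + 2 * Q g
  smul : ∀ f ∈ holo, ∀ c : ℂ, Q (c • f) = ‖c‖ₑ ^ 2 * Q f
  le_liminf : ∀ (u : ℕ → ℂ × ℂ → ℂ) (f : ℂ × ℂ → ℂ), (∀ n, u n ∈ holo) → f ∈ holo →
    TendstoLocallyUniformlyOn u f atTop bidisc → Q f ≤ liminf (fun n => Q (u n)) atTop

lemma enorm_add_sq_le_of_pos (a b : ℂ) {t : ℝ} (ht : 0 < t) :
    ‖a + b‖ₑ ^ 2 ≤ ENNReal.ofReal (1 + t) * ‖a‖ₑ ^ 2 + ENNReal.ofReal (1 + t⁻¹) * ‖b‖ₑ ^ 2 := by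
  have h : ‖a + b‖ ^ 2 ≤ (1 + t) * ‖a‖ ^ 2 + (1 + t⁻¹) * ‖b‖ ^ 2 := by
    have h1 : 2 * (‖a‖ * ‖b‖) ≤ t * ‖a‖ ^ 2 + t⁻¹ * ‖b‖ ^ 2 := by
      have h2 : t * ‖a‖ ^ 2 + t⁻¹ * ‖b‖ ^ 2 - 2 * (‖a‖ * ‖b‖) = t⁻¹ * (t * ‖a‖ - ‖b‖) ^ 2 := by
        field_simp
        ring
      have h3 : 0 ≤ t⁻¹ * (t * ‖a‖ - ‖b‖) ^ 2 := by positivity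
      linarith
    nlinarith [norm_add_le a b, norm_nonneg (a + b), norm_nonneg a, norm_nonneg b]
  have e : ∀ x : ℂ, ‖x‖ₑ ^ 2 = ENNReal.ofReal (‖x‖ ^ 2) := fun x => by
    rw [ENNReal.ofReal_pow (norm_nonneg _), ofReal_norm]
  rw [e, e, e, ← ENNReal.ofReal_mul (by positivity), ← ENNReal.ofReal_mul (by positivity),
    ← ENNReal.ofReal_add (by positivity) (by positivity)]
  exact ENNReal.ofReal_le_ofReal h

lemma enorm_parallelogram (a b : ℂ) :
    ‖a + b‖ₑ ^ 2 + ‖a - b‖ₑ ^ 2 = 2 * ‖a‖ₑ ^ 2 + 2 * ‖b‖ₑ ^ 2 := by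
  have h : ‖a + b‖ ^ 2 + ‖a - b‖ ^ 2 = 2 * ‖a‖ ^ 2 + 2 * ‖b‖ ^ 2 := by
    have := parallelogram_law_with_norm ℝ a b
    linarith
  have e : ∀ x : ℂ, ‖x‖ₑ ^ 2 = ENNReal.ofReal (‖x‖ ^ 2) := fun x => by
    rw [ENNReal.ofReal_pow (norm_nonneg _), ofReal_norm]
  rw [e, e, e, e, ← ENNReal.ofReal_add (by positivity) (by positivity), h,
    ENNReal.ofReal_add (by positivity) (by positivity), ENNReal.ofReal_mul (by norm_num),
    ENNReal.ofReal_mul (by norm_num)]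
  simp

/-- Common mechanism for the Hardy norm and the energies. Monotonicity in `r` makes the supremum
additive, which preserves the parallelogram law; lower semicontinuity is Fatou's lemma for each `r`.
-/
lemma isQuadForm_supEnergy {Q : (ℂ × ℂ → ℂ) → ENNReal} {ν : ℝ → Measure (ℂ × ℂ)}
    {Λ : (ℂ × ℂ → ℂ) → ℂ × ℂ → ℂ} (hQ : ∀ f ∈ holo, Q f = supEnergy ν (Λ f))
    (hm : ∀ f ∈ holo, Measurable (Λ f))
    (hadd : ∀ f ∈ holo, ∀ g ∈ holo, ∀ p, Λ (f + g) p = Λ f p + Λ g p)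
    (hsmul : ∀ f ∈ holo, ∀ (c : ℂ) p, Λ (c • f) p = c * Λ f p)
    (hmono : ∀ f ∈ holo, ∀ r s : ℝ, 0 < r → r ≤ s → s < 1 →
      ∫⁻ p, ‖Λ f p‖ₑ ^ 2 ∂ν r ≤ ∫⁻ p, ‖Λ f p‖ₑ ^ 2 ∂ν s)
    (hlim : ∀ (u : ℕ → ℂ × ℂ → ℂ) (f : ℂ × ℂ → ℂ), (∀ n, u n ∈ holo) → f ∈ holo →
      TendstoLocallyUniformlyOn u f atTop bidisc →
        ∀ p, Tendsto (fun n => Λ (u n) p) atTop (𝓝 (Λ f p))) : IsQuadForm Q where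
  add_le f hf g hg t ht := by
    rw [hQ _ (holo.add_mem hf hg), hQ _ hf, hQ _ hg]
    refine iSup₂_le fun r hr => ?_
    calc ∫⁻ p, ‖Λ (f + g) p‖ₑ ^ 2 ∂ν r
        ≤ ∫⁻ p, (ENNReal.ofReal (1 + t) * ‖Λ f p‖ₑ ^ 2 +
            ENNReal.ofReal (1 + t⁻¹) * ‖Λ g p‖ₑ ^ 2) ∂ν r := by
          refine lintegral_mono fun p => ?_
          rw [hadd f hf g hg]
          exact enorm_add_sq_le_of_pos _ _ ht
      _ = ENNReal.ofReal (1 + t) * (∫⁻ p, ‖Λ f p‖ₑ ^ 2 ∂ν r) +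
            ENNReal.ofReal (1 + t⁻¹) * ∫⁻ p, ‖Λ g p‖ₑ ^ 2 ∂ν r := by
          rw [lintegral_add_left (((hm f hf).enorm.pow_const 2).const_mul _),
            lintegral_const_mul _ ((hm f hf).enorm.pow_const 2),
            lintegral_const_mul _ ((hm g hg).enorm.pow_const 2)]
      _ ≤ _ := by
          gcongr
          · exact le_iSup₂ (f := fun r (_ : r ∈ Ioo (0 : ℝ) 1) => ∫⁻ p, ‖Λ f p‖ₑ ^ 2 ∂ν r) r hr
          · exact le_iSup₂ (f := fun r (_ : r ∈ Ioo (0 : ℝ) 1) => ∫⁻ p, ‖Λ g p‖ₑ ^ 2 ∂ν r) r hr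
  parallelogram f hf g hg := by
    have hsub : f - g ∈ holo := holo.sub_mem hf hg
    have hadd' := holo.add_mem hf hg
    have hL : ∀ p, Λ (f - g) p = Λ f p - Λ g p := fun p => by
      have e : f - g = f + (-1 : ℂ) • g := by
        rw [neg_one_smul, sub_eq_add_neg]
      rw [e, hadd f hf _ (holo.smul_mem _ hg), hsmul g hg]
      ring
    rw [hQ _ hadd', hQ _ hsub, hQ _ hf, hQ _ hg]
    simp only [supEnergy]
    rw [← iSup_Ioo_add (hmono _ hadd') (hmono _ hsub), two_mul, two_mul,
      ← iSup_Ioo_add (hmono _ hf) (hmono _ hf), ← iSup_Ioo_add (hmono _ hg) (hmono _ hg),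
      ← iSup_Ioo_add]
    · refine iSup_congr fun r => iSup_congr fun _ => ?_
      rw [← lintegral_add_left ((hm _ hadd').enorm.pow_const 2), ← two_mul, ← two_mul,
        ← lintegral_const_mul _ ((hm f hf).enorm.pow_const 2),
        ← lintegral_const_mul _ ((hm g hg).enorm.pow_const 2),
        ← lintegral_add_left (((hm f hf).enorm.pow_const 2).const_mul _)]
      refine lintegral_congr fun p => ?_
      rw [hadd f hf g hg, hL, enorm_parallelogram]
    · exact fun r s h0 hrs h1 => add_le_add (hmono f hf r s h0 hrs h1) (hmono f hf r s h0 hrs h1)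
    · exact fun r s h0 hrs h1 => add_le_add (hmono g hg r s h0 hrs h1) (hmono g hg r s h0 hrs h1)
  smul f hf c := by
    rw [hQ _ (holo.smul_mem c hf), hQ _ hf]
    simp only [supEnergy, ENNReal.mul_iSup, hsmul f hf, enorm_mul, mul_pow]
    exact iSup_congr fun r => iSup_congr fun _ =>
      lintegral_const_mul _ ((hm f hf).enorm.pow_const 2)
  le_liminf u f hu hf h := by
    rw [hQ f hf]
    refine iSup₂_le fun r hr => ?_
    calc ∫⁻ p, ‖Λ f p‖ₑ ^ 2 ∂ν r
        = ∫⁻ p, liminf (fun n => ‖Λ (u n) p‖ₑ ^ 2) atTop ∂ν r := by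
          refine lintegral_congr fun p => ?_
          exact (((ENNReal.continuous_pow 2).tendsto _).comp
            (hlim u f hu hf h p).enorm).liminf_eq.symm
      _ ≤ liminf (fun n => ∫⁻ p, ‖Λ (u n) p‖ₑ ^ 2 ∂ν r) atTop :=
          lintegral_liminf_le fun n => (hm _ (hu n)).enorm.pow_const 2
      _ ≤ _ := by
          refine liminf_le_liminf (Eventually.of_forall fun n => ?_)
          rw [hQ _ (hu n)]
          exact le_iSup₂ (f := fun r (_ : r ∈ Ioo (0 : ℝ) 1) => ∫⁻ p, ‖Λ (u n) p‖ₑ ^ 2 ∂ν r) r hr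

lemma ennreal_liminf_add_le (a b : ℕ → ENNReal) :
    liminf a atTop + liminf b atTop ≤ liminf (fun n => a n + b n) atTop := by
  simp only [liminf_eq_iSup_iInf_of_nat]
  rw [ENNReal.iSup_add_iSup_of_monotone
    (fun m n h => biInf_mono fun i hi => le_trans h hi)
    (fun m n h => biInf_mono fun i hi => le_trans h hi)]
  exact iSup_mono fun n => le_iInf₂ fun i hi => add_le_add (iInf₂_le i hi) (iInf₂_le i hi)

lemma IsQuadForm.add {Q R : (ℂ × ℂ → ℂ) → ENNReal} (hQ : IsQuadForm Q) (hR : IsQuadForm R) :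
    IsQuadForm (fun f => Q f + R f) where
  add_le f hf g hg t ht := by
    refine (add_le_add (hQ.add_le f hf g hg t ht) (hR.add_le f hf g hg t ht)).trans (le_of_eq ?_)
    ring
  parallelogram f hf g hg := by
    have h1 := hQ.parallelogram f hf g hg
    have h2 := hR.parallelogram f hf g hg
    calc _ = (Q (f + g) + Q (f - g)) + (R (f + g) + R (f - g)) := by ring
      _ = _ := by rw [h1, h2]; ring
  smul f hf c := by
    simp only [hQ.smul f hf c, hR.smul f hf c, mul_add]
  le_liminf u f hu hf h :=
    (add_le_add (hQ.le_liminf u f hu hf h) (hR.le_liminf u f hu hf h)).trans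
      (ennreal_liminf_add_le _ _)

lemma IsQuadForm.swap {Q : (ℂ × ℂ → ℂ) → ENNReal} (hQ : IsQuadForm Q) :
    IsQuadForm (fun f => Q (fun z => f z.swap)) where
  add_le _ hf _ hg t ht := hQ.add_le _ (swap_mem_holo hf) _ (swap_mem_holo hg) t ht
  parallelogram _ hf _ hg := hQ.parallelogram _ (swap_mem_holo hf) _ (swap_mem_holo hg)
  smul _ hf c := hQ.smul _ (swap_mem_holo hf) c
  le_liminf _ _ hu hf h := hQ.le_liminf _ _ (fun n => swap_mem_holo (hu n)) (swap_mem_holo hf)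
    (h.comp Prod.swap (fun _ hz => ⟨hz.2, hz.1⟩) continuous_swap.continuousOn)

lemma slice_differentiableOn {f : ℂ × ℂ → ℂ} (hf : f ∈ holo) (w : ℂ) :
    DifferentiableOn ℂ (fun z => f (z, w)) (ball 0 1) := fun _ hz =>
  (differentiableAt_slice hf hz w).differentiableWithinAt

lemma slice_differentiableOn' {f : ℂ × ℂ → ℂ} (hf : f ∈ holo) (z : ℂ) :
    DifferentiableOn ℂ (fun w => f (z, w)) (ball 0 1) :=
  slice_differentiableOn (swap_mem_holo hf) z

lemma tendsto_of_tendstoLocallyUniformlyOn {u : ℕ → ℂ × ℂ → ℂ} {f : ℂ × ℂ → ℂ}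
    (hu : ∀ n, u n ∈ holo) (hf : f ∈ holo) (h : TendstoLocallyUniformlyOn u f atTop bidisc)
    (p : ℂ × ℂ) : Tendsto (fun n => u n p) atTop (𝓝 (f p)) := by
  by_cases hp : p ∈ bidisc
  · exact h.tendsto_at hp
  · simp [(hu _).2 p hp, hf.2 p hp]

lemma tendsto_sliceDeriv {u : ℕ → ℂ × ℂ → ℂ} {f : ℂ × ℂ → ℂ}
    (hu : ∀ n, u n ∈ holo) (hf : f ∈ holo) (h : TendstoLocallyUniformlyOn u f atTop bidisc)
    (p : ℂ × ℂ) : Tendsto (fun n => sliceDeriv (u n) p) atTop (𝓝 (sliceDeriv f p)) := by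
  obtain ⟨w, z⟩ := p
  by_cases hz : z ∈ ball (0 : ℂ) 1
  · simp only [sliceDeriv_of_mem _ hz]
    by_cases hw : w ∈ ball (0 : ℂ) 1
    · have h1 : TendstoLocallyUniformlyOn (fun n z => u n (z, w)) (fun z => f (z, w)) atTop
          (ball 0 1) := h.comp (fun z => (z, w)) (fun _ hz => ⟨hz, hw⟩) (by fun_prop)
      exact (h1.deriv (Eventually.of_forall fun n => slice_differentiableOn (hu n) w)
        isOpen_ball).tendsto_at hz
    · have h0 : ∀ g ∈ holo, (fun z => g (z, w)) = fun _ => 0 := fun g hg =>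
        funext fun z => hg.2 _ fun h => hw h.2
      simp [h0 _ (hu _), h0 f hf]
  · simp [sliceDeriv_of_notMem _ hz]

lemma isQuadForm_hardyNormSq : IsQuadForm hardyNormSq := by
  refine isQuadForm_supEnergy (Λ := id)
    (fun f hf => hardyNormSq_eq_supEnergy (measurable_of_mem_holo hf))
    (fun f hf => measurable_of_mem_holo hf) (fun _ _ _ _ _ => rfl) (fun _ _ _ _ => rfl)
    (fun f hf r s h0 hrs h1 => ?_) fun u f hu hf h p =>
      tendsto_of_tendstoLocallyUniformlyOn hu hf h p
  have hm : Measurable fun z => ‖f z‖ₑ ^ 2 := (measurable_of_mem_holo hf).enorm.pow_const 2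
  simp only [id]
  calc ∫⁻ p, ‖f p‖ₑ ^ 2 ∂(circleMeasure r).prod (circleMeasure r)
      ≤ ∫⁻ p, ‖f p‖ₑ ^ 2 ∂(circleMeasure r).prod (circleMeasure s) := by
        rw [lintegral_prod _ hm.aemeasurable, lintegral_prod _ hm.aemeasurable]
        refine lintegral_mono fun z => ?_
        rw [lintegral_circleMeasure (measurable_slice hm z),
          lintegral_circleMeasure (measurable_slice hm z)]
        exact circleMean_sq_mono (slice_differentiableOn' hf z) h0.le hrs h1
    _ ≤ _ := by
        rw [lintegral_prod_symm _ hm.aemeasurable, lintegral_prod_symm _ hm.aemeasurable]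
        refine lintegral_mono fun z => ?_
        rw [lintegral_circleMeasure (measurable_slice' hm z),
          lintegral_circleMeasure (measurable_slice' hm z)]
        exact circleMean_sq_mono (slice_differentiableOn hf z) h0.le hrs h1

lemma bidisc_eq_ball : bidisc = ball (0 : ℂ × ℂ) 1 := by
  rw [bidisc, ball_prod_same]; rfl

lemma exists_norm_le_of_mem_holo {f : ℂ × ℂ → ℂ} (hf : f ∈ holo) {R : ℝ} (hR : R < 1) :
    ∃ M, ∀ z w : ℂ, ‖z‖ ≤ R → ‖w‖ ≤ R → ‖f (z, w)‖ ≤ M := by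
  have hc : ContinuousOn f (closedBall (0 : ℂ) R ×ˢ closedBall (0 : ℂ) R) :=
    hf.1.continuousOn.mono (prod_mono (closedBall_subset_ball hR) (closedBall_subset_ball hR))
  obtain ⟨M, hM⟩ := ((isCompact_closedBall (0 : ℂ) R).prod
    (isCompact_closedBall (0 : ℂ) R)).exists_bound_of_continuousOn hc
  exact ⟨M, fun z w hz hw => hM (z, w) ⟨by simpa using hz, by simpa using hw⟩⟩

/-- The `z`-derivative is a limit of difference quotients, each holomorphic in `w` and hence with
increasing means. Fatou's lemma on the circle of radius `r` and dominated convergence on that of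
radius `s` pass the inequality to the limit. -/
lemma circleMean_sliceDeriv_mono {f : ℂ × ℂ → ℂ} (hf : f ∈ holo) (z : ℂ) {r s : ℝ}
    (h0 : 0 < r) (hrs : r ≤ s) (h1 : s < 1) :
    circleMean (fun w => ‖sliceDeriv f (w, z)‖ₑ ^ 2) r ≤
      circleMean (fun w => ‖sliceDeriv f (w, z)‖ₑ ^ 2) s := by
  by_cases hz : z ∈ ball (0 : ℂ) 1
  swap
  · simp [sliceDeriv_of_notMem _ hz, circleMean]
  have hm := measurable_of_mem_holo hf
  have hz1 : ‖z‖ < 1 := mem_ball_zero_iff.1 hz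
  set R := (1 + max ‖z‖ s) / 2 with hRdef
  have hmax : max ‖z‖ s < 1 := max_lt hz1 h1
  have hR1 : R < 1 := by rw [hRdef]; linarith
  have hzR : ‖z‖ < R := by rw [hRdef]; linarith [le_max_left ‖z‖ s]
  have hsR : s ≤ R := by rw [hRdef]; linarith [le_max_right ‖z‖ s]
  obtain ⟨M, hM⟩ := exists_norm_le_of_mem_holo hf hR1
  -- The disc of radius `R - ‖z‖` about `z` stays where `M` bounds `f`; the increments `t n` are
  -- smaller than this radius.
  have hρ : 0 < R - ‖z‖ := by linarith
  set t : ℕ → ℝ := fun n => (R - ‖z‖) / ((n : ℝ) + 2) with ht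
  have ht0 : ∀ n, 0 < t n := fun n => by positivity
  have htR : ∀ n, t n < R - ‖z‖ := fun n => by
    have hn : (0 : ℝ) ≤ n := n.cast_nonneg
    rw [ht, div_lt_iff₀ (by positivity)]
    nlinarith
  have htlim : Tendsto t atTop (𝓝 0) := by
    refine Tendsto.div_atTop tendsto_const_nhds ?_
    exact tendsto_atTop_add_const_right _ _ tendsto_natCast_atTop_atTop
  set q : ℕ → ℂ → ℂ := fun n w => ((t n : ℝ) : ℂ)⁻¹ * (f (z + t n, w) - f (z, w)) with hq
  have hqd : ∀ n, DifferentiableOn ℂ (q n) (ball 0 1) := fun n =>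
    ((slice_differentiableOn' hf _).sub (slice_differentiableOn' hf _)).const_mul _
  have hqm : ∀ n, Measurable fun w => ‖q n w‖ₑ ^ 2 := fun n =>
    (((hm.comp measurable_prodMk_left).sub (hm.comp measurable_prodMk_left)).const_mul
      _).enorm.pow_const 2
  have hqlim : ∀ w, Tendsto (fun n => ‖q n w‖ₑ ^ 2) atTop (𝓝 (‖sliceDeriv f (w, z)‖ₑ ^ 2)) := by
    intro w
    refine ((ENNReal.continuous_pow 2).tendsto _).comp (Tendsto.enorm ?_)
    rw [sliceDeriv_of_mem f hz]
    have hd := (differentiableAt_slice hf hz w).hasDerivAt.tendsto_slope_zero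
    refine hd.comp (tendsto_nhdsWithin_iff.2 ⟨?_, Eventually.of_forall fun n => ?_⟩)
    · simpa only [Complex.ofReal_zero, Function.comp_def] using
        (Complex.continuous_ofReal.tendsto 0).comp htlim
    · simpa using (ht0 n).ne'
  have hqb : ∀ n w, ‖w‖ ≤ s → ‖q n w‖ ≤ 2 * M / (R - ‖z‖) := by
    intro n w hw
    have hmem : ∀ u ∈ ball z (R - ‖z‖), ‖u‖ ≤ R := fun u hu => by
      have := norm_add_le (u - z) z
      rw [sub_add_cancel] at this
      rw [mem_ball_iff_norm] at hu
      linarith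
    have hd : DifferentiableOn ℂ (fun u => f (u, w)) (ball z (R - ‖z‖)) :=
      (slice_differentiableOn hf w).mono fun u hu => by
        rw [mem_ball_zero_iff]
        exact (hmem u hu).trans_lt hR1
    have hmaps : MapsTo (fun u => f (u, w)) (ball z (R - ‖z‖)) (closedBall (f (z, w)) (2 * M)) := by
      intro u hu
      rw [mem_closedBall, dist_eq_norm]
      have h2 := norm_sub_le (f (u, w)) (f (z, w))
      have h3 := hM u w (hmem u hu) (hw.trans hsR)
      have h4 := hM z w hzR.le (hw.trans hsR)
      linarith
    -- The Schwarz lemma bounds the difference quotient uniformly in `n` and `w`, which provides the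
    -- dominating constant.
    have h5 := Complex.dist_le_div_mul_dist_of_mapsTo_ball hd hmaps (z := z + t n)
      (by simpa [abs_of_pos (ht0 n)] using htR n)
    rw [dist_eq_norm, dist_eq_norm, add_sub_cancel_left, Complex.norm_real,
      Real.norm_of_nonneg (ht0 n).le] at h5
    simp only [hq, norm_mul, norm_inv, Complex.norm_real, Real.norm_of_nonneg (ht0 n).le]
    rw [inv_mul_le_iff₀ (ht0 n)]
    linarith
  have hlims : Tendsto (fun n => circleMean (fun w => ‖q n w‖ₑ ^ 2) s) atTop
      (𝓝 (circleMean (fun w => ‖sliceDeriv f (w, z)‖ₑ ^ 2) s)) := by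
    refine ENNReal.Tendsto.const_mul ?_ (Or.inr ENNReal.ofReal_ne_top)
    refine tendsto_lintegral_of_dominated_convergence
      (fun _ => ENNReal.ofReal (2 * M / (R - ‖z‖)) ^ 2)
      (fun n => (hqm n).comp (continuous_circleMap 0 s).measurable)
      (fun n => Eventually.of_forall fun θ => ?_) ?_
      (Eventually.of_forall fun θ => hqlim _)
    · refine pow_le_pow_left' ?_ 2
      rw [← ofReal_norm]
      exact ENNReal.ofReal_le_ofReal (hqb n _ (by simp [abs_of_pos (h0.trans_le hrs)]))
    · rw [setLIntegral_const]
      exact ENNReal.mul_ne_top (ENNReal.pow_ne_top ENNReal.ofReal_ne_top)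
        measure_Ioc_lt_top.ne
  have hfatou : circleMean (fun w => ‖sliceDeriv f (w, z)‖ₑ ^ 2) r ≤
      liminf (fun n => circleMean (fun w => ‖q n w‖ₑ ^ 2) r) atTop := by
    have hsm : Measurable fun w => ‖sliceDeriv f (w, z)‖ₑ ^ 2 :=
      ((measurable_sliceDeriv hf).comp measurable_prodMk_right).enorm.pow_const 2
    simp only [← lintegral_circleMeasure (hqm _), ← lintegral_circleMeasure hsm]
    calc _ = ∫⁻ w, liminf (fun n => ‖q n w‖ₑ ^ 2) atTop ∂circleMeasure r :=
          lintegral_congr fun w => (hqlim w).liminf_eq.symm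
      _ ≤ _ := lintegral_liminf_le hqm
  refine hfatou.trans ?_
  rw [← hlims.liminf_eq]
  exact liminf_le_liminf (Eventually.of_forall fun n => circleMean_sq_mono (hqd n) h0.le hrs h1)

lemma isQuadForm_energy₁ (μ : Measure ℂ) [IsFiniteMeasure μ] : IsQuadForm (energy₁ μ) := by
  refine isQuadForm_supEnergy (fun f hf => energy₁_eq_supEnergy μ hf)
    (fun f hf => measurable_sliceDeriv hf) (fun f hf g hg p => ?_) (fun f hf c p => ?_)
    (fun f hf r s h0 hrs h1 => ?_) fun u f hu hf h p => tendsto_sliceDeriv hu hf h p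
  · obtain ⟨w, z⟩ := p
    by_cases hz : z ∈ ball (0 : ℂ) 1
    · simp only [sliceDeriv_of_mem _ hz]
      exact deriv_add (differentiableAt_slice hf hz w) (differentiableAt_slice hg hz w)
    · simp [sliceDeriv_of_notMem _ hz]
  · obtain ⟨w, z⟩ := p
    by_cases hz : z ∈ ball (0 : ℂ) 1
    · simp only [sliceDeriv_of_mem _ hz, Pi.smul_apply, smul_eq_mul, deriv_const_mul_field']
    · simp [sliceDeriv_of_notMem _ hz]
  · have hm : Measurable fun p => ‖sliceDeriv f p‖ₑ ^ 2 :=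
      (measurable_sliceDeriv hf).enorm.pow_const 2
    rw [lintegral_prod_symm _ hm.aemeasurable, lintegral_prod_symm _ hm.aemeasurable]
    refine lintegral_mono fun z => ?_
    rw [lintegral_circleMeasure (measurable_slice' hm z),
      lintegral_circleMeasure (measurable_slice' hm z)]
    exact circleMean_sliceDeriv_mono hf z h0 hrs h1

/-- The square of the norm of `D(μ₁, μ₂)`. -/
noncomputable def totalNormSq (μ₁ μ₂ : Measure ℂ) (f : ℂ × ℂ → ℂ) : ENNReal :=
  hardyNormSq f + dirichletIntegral μ₁ μ₂ f

lemma isQuadForm_totalNormSq (μ₁ μ₂ : Measure ℂ) [IsFiniteMeasure μ₁] [IsFiniteMeasure μ₂] :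
    IsQuadForm (totalNormSq μ₁ μ₂) :=
  isQuadForm_hardyNormSq.add ((isQuadForm_energy₁ μ₁).add (isQuadForm_energy₁ μ₂).swap)

/-! ### Point evaluations and locally uniform limits -/

lemma enorm_sq_apply_le {g : ℂ → ℂ} (hg : DifferentiableOn ℂ g (ball 0 1)) {z : ℂ} {ρ r : ℝ}
    (hz : ‖z‖ ≤ ρ) (hρ : ρ < r) (hr : r < 1) :
    ‖g z‖ₑ ^ 2 ≤ ENNReal.ofReal ((1 - ρ / r)⁻¹ ^ 2) * circleMean (fun z => ‖g z‖ₑ ^ 2) r := by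
  have hρ0 : 0 ≤ ρ := (norm_nonneg z).trans hz
  have hr0 : 0 < r := hρ0.trans_lt hρ
  have hq : ρ / r < 1 := (div_lt_one hr0).2 hρ
  have hq0 : 0 < 1 - ρ / r := by linarith
  obtain ⟨a, ha⟩ := exists_hasTaylor hg
  set A := circleMean (fun z => ‖g z‖ₑ ^ 2) r with hA
  by_cases hAtop : A = ⊤
  · rw [hAtop, ENNReal.mul_top]
    · exact le_top
    · rw [Ne, ENNReal.ofReal_eq_zero, not_le]
      positivity
  -- A single term of Parseval's sum bounds each coefficient; a geometric series of ratio `ρ / r`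
  -- then bounds `g z`.
  have hcoef : ∀ n, ‖a n‖ * r ^ n ≤ √A.toReal := fun n => by
    refine Real.le_sqrt_of_sq_le ?_
    have h1 : ‖a n‖ₑ ^ 2 * ENNReal.ofReal (r ^ (2 * n)) ≤ A := by
      rw [hA, ha.circleMean_sq hr0.le hr]
      exact ENNReal.le_tsum n
    rw [← ofReal_norm, ← ENNReal.ofReal_pow (norm_nonneg _), ← ENNReal.ofReal_mul (by positivity),
      ENNReal.ofReal_le_iff_le_toReal hAtop] at h1
    calc _ = ‖a n‖ ^ 2 * r ^ (2 * n) := by rw [mul_pow, ← pow_mul, mul_comm n]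
      _ ≤ _ := h1
  have hgeo := (hasSum_geometric_of_lt_one (div_nonneg hρ0 hr0.le) hq).mul_left (√A.toReal)
  have hz1 : z ∈ ball (0 : ℂ) 1 := by
    rw [mem_ball_zero_iff]
    linarith
  have hbound : ‖g z‖ ≤ √A.toReal * (1 - ρ / r)⁻¹ := by
    rw [← (ha z hz1).tsum_eq]
    refine tsum_of_norm_bounded hgeo fun n => ?_
    rw [norm_mul, norm_pow, div_pow]
    calc ‖a n‖ * ‖z‖ ^ n ≤ ‖a n‖ * ρ ^ n := by gcongr
      _ = ‖a n‖ * r ^ n * (ρ ^ n / r ^ n) := by field_simp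
      _ ≤ _ := mul_le_mul_of_nonneg_right (hcoef n) (by positivity)
  calc ‖g z‖ₑ ^ 2 = ENNReal.ofReal (‖g z‖ ^ 2) := by
        rw [ENNReal.ofReal_pow (norm_nonneg _), ofReal_norm]
    _ ≤ ENNReal.ofReal ((√A.toReal * (1 - ρ / r)⁻¹) ^ 2) :=
        ENNReal.ofReal_le_ofReal (pow_le_pow_left₀ (norm_nonneg _) hbound 2)
    _ = _ := by
      rw [mul_pow, Real.sq_sqrt ENNReal.toReal_nonneg, mul_comm,
        ENNReal.ofReal_mul (by positivity), ENNReal.ofReal_toReal hAtop]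

/-- Point evaluations on the bidisc are bounded in the Hardy norm, locally uniformly. -/
lemma exists_enorm_sq_le_hardyNormSq {ρ : ℝ} (hρ : ρ < 1) :
    ∃ K : ENNReal, K ≠ ⊤ ∧ ∀ f ∈ holo, ∀ z w : ℂ, ‖z‖ ≤ ρ → ‖w‖ ≤ ρ →
      ‖f (z, w)‖ₑ ^ 2 ≤ K * hardyNormSq f := by
  set r := (1 + max ρ 0) / 2 with hr
  have hmax : max ρ 0 < 1 := max_lt hρ one_pos
  have h1 : r < 1 := by rw [hr]; linarith
  have h2 : ρ < r := by rw [hr]; linarith [le_max_left ρ 0]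
  have h0 : 0 < r := by rw [hr]; linarith [le_max_right ρ 0]
  set K := ENNReal.ofReal ((1 - ρ / r)⁻¹ ^ 2) with hK
  refine ⟨K * K, by finiteness, fun f hf z w hz hw => ?_⟩
  have hm : Measurable fun p => ‖f p‖ₑ ^ 2 := (measurable_of_mem_holo hf).enorm.pow_const 2
  calc ‖f (z, w)‖ₑ ^ 2 ≤ K * circleMean (fun z => ‖f (z, w)‖ₑ ^ 2) r :=
        enorm_sq_apply_le (slice_differentiableOn hf w) hz h2 h1
    _ ≤ K * circleMean (fun z => K * circleMean (fun w => ‖f (z, w)‖ₑ ^ 2) r) r := by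
        gcongr
        exact circleMean_mono (fun z =>
          enorm_sq_apply_le (slice_differentiableOn' hf z) hw h2 h1) r
    _ = K * K * circleMean (fun z => circleMean (fun w => ‖f (z, w)‖ₑ ^ 2) r) r := by
        rw [circleMean_const_mul _ (measurable_circleMean hm r), mul_assoc]
    _ ≤ _ := by
        gcongr
        exact le_iSup₂ (f := fun r (_ : r ∈ Ioo (0 : ℝ) 1) =>
          circleMean (fun z => circleMean (fun w => ‖f (z, w)‖ₑ ^ 2) r) r) r ⟨h0, h1⟩

lemma eq_zero_of_hardyNormSq_eq_zero {f : ℂ × ℂ → ℂ} (hf : f ∈ holo) (h : hardyNormSq f = 0) :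
    f = 0 := by
  funext p
  by_cases hp : p ∈ bidisc
  · have h1 : max ‖p.1‖ ‖p.2‖ < 1 :=
      max_lt (mem_ball_zero_iff.1 hp.1) (mem_ball_zero_iff.1 hp.2)
    obtain ⟨K, _, hK⟩ := exists_enorm_sq_le_hardyNormSq h1
    have := hK f hf p.1 p.2 (le_max_left _ _) (le_max_right _ _)
    rw [h, mul_zero] at this
    simpa using this
  · exact hf.2 p hp

lemma exists_tendstoLocallyUniformlyOn {E F : Type*} [NormedAddCommGroup E] [NormedAddCommGroup F]
    [CompleteSpace F] {u : ℕ → E → F}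
    (h : ∀ R : ℝ, R < 1 → UniformCauchySeqOn u atTop (closedBall 0 R)) :
    ∃ g, TendstoLocallyUniformlyOn u g atTop (ball 0 1) := by
  have hlim : ∀ p ∈ ball (0 : E) 1, ∃ l, Tendsto (fun n => u n p) atTop (𝓝 l) := fun p hp =>
    cauchySeq_tendsto_of_complete ((h ‖p‖ (mem_ball_zero_iff.1 hp)).cauchySeq (by simp))
  classical
  refine ⟨fun p => if hp : p ∈ ball (0 : E) 1 then (hlim p hp).choose else 0,
    tendstoLocallyUniformlyOn_of_forall_exists_nhds fun x hx => ?_⟩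
  obtain ⟨R, hxR, hR⟩ := exists_between (mem_ball_zero_iff.1 hx)
  refine ⟨closedBall 0 R, mem_nhdsWithin_of_mem_nhds
    (closedBall_mem_nhds_of_mem (by simpa using hxR)),
    (h R hR).tendstoUniformlyOn_of_tendsto fun p hp => ?_⟩
  have hp1 : p ∈ ball (0 : E) 1 := closedBall_subset_ball hR hp
  simp only [dif_pos hp1]
  exact (hlim p hp1).choose_spec

lemma uniformCauchySeqOn_of_hardyNormSq {u : ℕ → ℂ × ℂ → ℂ} (hu : ∀ n, u n ∈ holo)
    (h : ∀ ε : ENNReal, 0 < ε → ∃ N, ∀ m ≥ N, ∀ n ≥ N, hardyNormSq (u m - u n) ≤ ε)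
    {R : ℝ} (hR : R < 1) : UniformCauchySeqOn u atTop (closedBall 0 R) := by
  obtain ⟨K, hK, hb⟩ := exists_enorm_sq_le_hardyNormSq hR
  rw [Metric.uniformCauchySeqOn_iff]
  intro ε hε
  have hε2 : 0 < ENNReal.ofReal ((ε / 2) ^ 2) := by
    rw [ENNReal.ofReal_pos]
    positivity
  -- The divisor is `K + 1` rather than `K` because `K` may be zero.
  obtain ⟨N, hN⟩ := h (ENNReal.ofReal ((ε / 2) ^ 2) / (K + 1))
    (ENNReal.div_pos hε2.ne' (by finiteness))
  refine ⟨N, fun m hm n hn p hp => ?_⟩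
  rw [mem_closedBall_zero_iff] at hp
  have h1 := hb _ (holo.sub_mem (hu m) (hu n)) p.1 p.2 ((norm_fst_le p).trans hp)
    ((norm_snd_le p).trans hp)
  have h2 : ‖(u m - u n) p‖ₑ ^ 2 ≤ ENNReal.ofReal ((ε / 2) ^ 2) :=
    calc ‖(u m - u n) p‖ₑ ^ 2 ≤ K * hardyNormSq (u m - u n) := h1
      _ ≤ (K + 1) * (ENNReal.ofReal ((ε / 2) ^ 2) / (K + 1)) :=
          mul_le_mul' le_self_add (hN m hm n hn)
      _ ≤ _ := ENNReal.mul_div_le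
  rw [← ofReal_norm, ← ENNReal.ofReal_pow (norm_nonneg _),
    ENNReal.ofReal_le_ofReal_iff (by positivity), sq_le_sq₀ (norm_nonneg _) (by positivity)] at h2
  rw [dist_eq_norm]
  exact h2.trans_lt (half_lt_self hε)

/-- A Cauchy estimate on a slightly larger ball. Uniform convergence of the derivatives is what
makes the limit differentiable in both variables jointly. -/
lemma uniformCauchySeqOn_fderiv {u : ℕ → ℂ × ℂ → ℂ} (hu : ∀ n, u n ∈ holo)
    (h : ∀ R : ℝ, R < 1 → UniformCauchySeqOn u atTop (closedBall 0 R)) {R : ℝ} (hR : R < 1) :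
    UniformCauchySeqOn (fun n => fderiv ℂ (u n)) atTop (closedBall 0 R) := by
  obtain ⟨R', hRR, hR'⟩ := exists_between hR
  have hδ : 0 < R' - R := by linarith
  rw [Metric.uniformCauchySeqOn_iff]
  intro ε hε
  obtain ⟨N, hN⟩ := Metric.uniformCauchySeqOn_iff.1 (h R' hR') (ε / 4 * (R' - R)) (by positivity)
  refine ⟨N, fun m hm n hn p hp => ?_⟩
  have hsub : ball p (R' - R) ⊆ closedBall 0 R' := by
    refine ball_subset_closedBall.trans (closedBall_subset_closedBall' ?_)
    rw [mem_closedBall] at hp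
    linarith
  have hmem : p ∈ bidisc := by
    rw [bidisc_eq_ball]
    exact closedBall_subset_ball hR hp
  have hdat : ∀ k, DifferentiableAt ℂ (u k) p := fun k =>
    (hu k).1.differentiableAt (isOpen_bidisc.mem_nhds hmem)
  have hd : DifferentiableOn ℂ (u m - u n) (ball p (R' - R)) :=
    ((hu m).1.sub (hu n).1).mono fun x hx => by
      rw [bidisc_eq_ball]
      exact closedBall_subset_ball hR' (hsub hx)
  have hsmall : ∀ x ∈ ball p (R' - R), ‖(u m - u n) x‖ ≤ ε / 4 * (R' - R) := fun x hx => by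
    have := hN m hm n hn x (hsub hx)
    rw [dist_eq_norm] at this
    exact this.le
  have hmaps : MapsTo (u m - u n) (ball p (R' - R))
      (closedBall ((u m - u n) p) (ε / 2 * (R' - R))) := fun x hx => by
    rw [mem_closedBall, dist_eq_norm]
    have h1 := hsmall x hx
    have h2 := hsmall p (mem_ball_self hδ)
    have h3 := norm_sub_le ((u m - u n) x) ((u m - u n) p)
    linarith
  have h4 := Complex.norm_fderiv_le_div_of_mapsTo_ball hd hmaps hδ
  rw [fderiv_sub (hdat m) (hdat n), mul_div_cancel_right₀ _ hδ.ne'] at h4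
  rw [dist_eq_norm]
  exact h4.trans_lt (half_lt_self hε)

/-- A sequence of holomorphic functions that is Cauchy in the Hardy norm converges locally uniformly
to a holomorphic function. -/
lemma exists_holo_limit {u : ℕ → ℂ × ℂ → ℂ} (hu : ∀ n, u n ∈ holo)
    (h : ∀ ε : ENNReal, 0 < ε → ∃ N, ∀ m ≥ N, ∀ n ≥ N, hardyNormSq (u m - u n) ≤ ε) :
    ∃ f ∈ holo, TendstoLocallyUniformlyOn u f atTop bidisc := by
  classical
  have hc := fun R hR => uniformCauchySeqOn_of_hardyNormSq hu h (R := R) hR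
  obtain ⟨g, hg⟩ := exists_tendstoLocallyUniformlyOn hc
  obtain ⟨D, hD⟩ := exists_tendstoLocallyUniformlyOn
    fun R hR => uniformCauchySeqOn_fderiv hu hc (R := R) hR
  rw [← bidisc_eq_ball] at hg hD
  have hd : ∀ x ∈ bidisc, HasFDerivAt g (D x) x := fun x hx =>
    hasFDerivAt_of_tendstoLocallyUniformlyOn isOpen_bidisc hD (fun n y hy =>
      ((hu n).1.differentiableAt (isOpen_bidisc.mem_nhds hy)).hasFDerivAt)
      (fun y hy => hg.tendsto_at hy) hx
  have hEq : EqOn g (bidisc.piecewise g 0) bidisc := fun x hx =>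
    (piecewise_eq_of_mem _ _ _ hx).symm
  refine ⟨bidisc.piecewise g 0, ⟨?_, fun z hz => piecewise_eq_of_notMem _ _ _ hz⟩,
    hg.congr_right hEq⟩
  exact DifferentiableOn.congr (fun x hx => (hd x hx).differentiableAt.differentiableWithinAt)
    fun x hx => (hEq hx).symm

/-! ### From a quadratic form to a Hilbert space with a pair of operators -/

section Abstract

variable {V : Type*} [AddCommGroup V] [Module ℂ V]

/-- A positive definite quadratic form comes from an inner product. -/
lemma exists_core (q : V → ℝ) (h0 : ∀ x, 0 ≤ q x)
    (hadd : ∀ x y (t : ℝ), 0 < t → q (x + y) ≤ (1 + t) * q x + (1 + t⁻¹) * q y)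
    (hpar : ∀ x y, q (x + y) + q (x - y) = 2 * q x + 2 * q y)
    (hsmul : ∀ (c : ℂ) x, q (c • x) = ‖c‖ ^ 2 * q x) (hdef : ∀ x, q x = 0 → x = 0) :
    ∃ c : InnerProductSpace.Core ℂ V, ∀ x, RCLike.re (c.inner x x) = q x := by
  have hzero : q 0 = 0 := by simpa using hsmul 0 0
  let _ : Norm V := ⟨fun x => √(q x)⟩
  have hn : ∀ x : V, ‖x‖ = √(q x) := fun _ => rfl
  have core : NormedSpace.Core ℂ V :=
    { norm_nonneg := fun x => Real.sqrt_nonneg _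
      norm_smul := fun c x => by
        rw [hn, hn, hsmul, Real.sqrt_mul (by positivity), Real.sqrt_sq (norm_nonneg c)]
      norm_triangle := fun x y => by
        rw [hn, hn, hn]
        by_cases hx : q x = 0
        · rw [hdef x hx, zero_add, hzero]
          simp
        by_cases hy : q y = 0
        · rw [hdef y hy, add_zero, hzero]
          simp
        have hx' : 0 < √(q x) := Real.sqrt_pos.2 (lt_of_le_of_ne (h0 x) (Ne.symm hx))
        have hy' : 0 < √(q y) := Real.sqrt_pos.2 (lt_of_le_of_ne (h0 y) (Ne.symm hy))
        -- This `t` minimizes the right side of `hadd` and turns it into `(√(q x) + √(q y))²`.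
        refine Real.sqrt_le_iff.2 ⟨by positivity, (hadd x y (√(q y) / √(q x)) (by positivity)).trans
          (le_of_eq ?_)⟩
        have ex := Real.sq_sqrt (h0 x)
        have ey := Real.sq_sqrt (h0 y)
        set a := √(q x)
        set b := √(q y)
        rw [← ex, ← ey]
        field_simp
        ring
      norm_eq_zero_iff := fun x => by
        rw [hn, Real.sqrt_eq_zero (h0 x)]
        exact ⟨hdef x, fun h => h ▸ hzero⟩ }
  let _ : NormedAddCommGroup V := NormedAddCommGroup.ofCore core
  let _ : NormedSpace ℂ V := NormedSpace.ofCore core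
  have hn2 : ∀ x : V, ‖x‖ * ‖x‖ = q x := fun x => Real.mul_self_sqrt (h0 x)
  -- The Jordan–von Neumann theorem recovers the inner product from the parallelogram law.
  let _ : InnerProductSpace ℂ V := InnerProductSpace.ofNorm (𝕜 := ℂ) fun x y => by
    rw [hn2, hn2, hn2, hn2, hpar]
    ring
  refine ⟨InnerProductSpace.toCore, fun x => ?_⟩
  rw [← hn2 x]
  exact inner_self_eq_norm_mul_norm (𝕜 := ℂ) x

open ContinuousLinearMap in
lemma isToralTwoIsometry_iff {H : Type*} [NormedAddCommGroup H] [InnerProductSpace ℂ H]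
    [CompleteSpace H] {T : Fin 2 → H →L[ℂ] H} (hcomm : ∀ i j, T i * T j = T j * T i) :
    IsToralTwoIsometry T ↔
      ∀ i j x, ‖x‖ ^ 2 - ‖T i x‖ ^ 2 - ‖T j x‖ ^ 2 + ‖T i (T j x)‖ ^ 2 = 0 := by
  have key : ∀ i j x, inner ℂ ((1 - adjoint (T i) * T i - adjoint (T j) * T j +
      adjoint (T i) * adjoint (T j) * T i * T j : H →L[ℂ] H) x) x =
      ((‖x‖ ^ 2 - ‖T i x‖ ^ 2 - ‖T j x‖ ^ 2 + ‖T i (T j x)‖ ^ 2 : ℝ) : ℂ) := by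
    intro i j x
    have hc : T j (T i x) = T i (T j x) := congrArg (fun S : H →L[ℂ] H => S x) (hcomm j i)
    simp only [add_apply, sub_apply, one_apply_eq_self,
      mul_apply_eq_comp, inner_add_left, inner_sub_left,
      adjoint_inner_left, hc, inner_self_eq_norm_sq_to_K]
    push_cast
    rfl
  unfold IsToralTwoIsometry
  constructor
  · rintro ⟨_, h⟩ i j x
    have := key i j x
    rw [h i j, zero_apply, inner_zero_left] at this
    exact_mod_cast this.symm
  · intro h
    refine ⟨hcomm, fun i j => ?_⟩
    -- On a complex space an operator with vanishing quadratic form is zero.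
    have h1 : ((1 - adjoint (T i) * T i - adjoint (T j) * T j +
      adjoint (T i) * adjoint (T j) * T i * T j : H →L[ℂ] H) : H →ₗ[ℂ] H) = 0 := by
      refine (inner_map_self_eq_zero _).1 fun x => ?_
      exact (key i j x).trans (by rw [h i j x, Complex.ofReal_zero])
    ext x
    exact congrArg (fun S : H →ₗ[ℂ] H => S x) h1

lemma exists_hilbert (q : V → ℝ) (h0 : ∀ x, 0 ≤ q x)
    (hadd : ∀ x y (t : ℝ), 0 < t → q (x + y) ≤ (1 + t) * q x + (1 + t⁻¹) * q y)
    (hpar : ∀ x y, q (x + y) + q (x - y) = 2 * q x + 2 * q y)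
    (hsmul : ∀ (c : ℂ) x, q (c • x) = ‖c‖ ^ 2 * q x) (hdef : ∀ x, q x = 0 → x = 0)
    (hcompl : ∀ u : ℕ → V, (∀ ε > 0, ∃ N, ∀ m ≥ N, ∀ n ≥ N, q (u m - u n) ≤ ε) →
      ∃ x, ∀ ε > 0, ∃ N, ∀ n ≥ N, q (u n - x) ≤ ε)
    (L : Fin 2 → V →ₗ[ℂ] V) (hL : ∀ i, ∃ C : ℝ, ∀ x, q (L i x) ≤ C * q x)
    (hcomm : ∀ i j x, L i (L j x) = L j (L i x)) {P : Prop}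
    (hP : (∀ i j x, q x - q (L i x) - q (L j x) + q (L i (L j x)) = 0) ↔ P) :
    ∃ c : InnerProductSpace.Core ℂ V,
      letI : NormedAddCommGroup V := c.toNormedAddCommGroup
      letI : InnerProductSpace ℂ V := InnerProductSpace.ofCore c.toCore
      (∀ x : V, ‖x‖ ^ 2 = q x) ∧ ∃ (_ : CompleteSpace V) (M : Fin 2 → V →L[ℂ] V),
        (∀ j x, M j x = L j x) ∧ (IsToralTwoIsometry M ↔ P) := by
  obtain ⟨c, hc⟩ := exists_core q h0 hadd hpar hsmul hdef
  refine ⟨c, ?_⟩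
  let _ : NormedAddCommGroup V := c.toNormedAddCommGroup
  let _ : InnerProductSpace ℂ V := InnerProductSpace.ofCore c.toCore
  have hq : ∀ x : V, ‖x‖ ^ 2 = q x := fun x => by
    rw [← inner_self_eq_norm_sq (𝕜 := ℂ) x]
    exact hc x
  have hcomplete : CompleteSpace V := by
    refine Metric.complete_of_cauchySeq_tendsto fun u hu => ?_
    rw [Metric.cauchySeq_iff] at hu
    obtain ⟨x, hx⟩ := hcompl u fun ε hε => by
      obtain ⟨N, hN⟩ := hu (√ε) (Real.sqrt_pos.2 hε)
      refine ⟨N, fun m hm n hn => ?_⟩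
      have h1 := hN m hm n hn
      rw [dist_eq_norm] at h1
      rw [← hq, ← Real.sq_sqrt hε.le]
      exact pow_le_pow_left₀ (norm_nonneg _) h1.le 2
    refine ⟨x, Metric.tendsto_atTop.2 fun ε hε => ?_⟩
    obtain ⟨N, hN⟩ := hx ((ε / 2) ^ 2) (by positivity)
    refine ⟨N, fun n hn => ?_⟩
    have h1 := hN n hn
    rw [← hq, sq_le_sq₀ (norm_nonneg _) (by positivity)] at h1
    rw [dist_eq_norm]
    exact h1.trans_lt (half_lt_self hε)
  refine ⟨hq, hcomplete, ?_⟩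
  choose C hC using hL
  set M : Fin 2 → V →L[ℂ] V := fun i => (L i).mkContinuous (√(max (C i) 0)) fun x => by
    have h1 : ‖L i x‖ ^ 2 ≤ max (C i) 0 * ‖x‖ ^ 2 := by
      rw [hq, hq]
      exact (hC i x).trans (mul_le_mul_of_nonneg_right (le_max_left _ _) (h0 x))
    refine (sq_le_sq₀ (norm_nonneg _) (by positivity)).1 ?_
    rw [mul_pow, Real.sq_sqrt (le_max_right _ _)]
    exact h1
  have hM : ∀ j x, M j x = L j x := fun j x => rfl
  refine ⟨M, hM, ?_⟩
  rw [isToralTwoIsometry_iff (fun i j => ContinuousLinearMap.ext fun x => hcomm i j x), ← hP]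
  simp only [hq, hM]

end Abstract

/-! ### Multiplication by the coordinates on the bidisc -/

lemma mul_mem_holo (j : Fin 2) {f : ℂ × ℂ → ℂ} (hf : f ∈ holo) :
    (fun z => coord j z * f z) ∈ holo := by
  refine ⟨DifferentiableOn.mul ?_ hf.1, fun z hz => by simp [hf.2 z hz]⟩
  fin_cases j
  · exact differentiable_fst.differentiableOn
  · exact differentiable_snd.differentiableOn

lemma hardyNormSq_swap {f : ℂ × ℂ → ℂ} (hf : f ∈ holo) :
    hardyNormSq (fun z => f z.swap) = hardyNormSq f := by
  have hm := measurable_of_mem_holo hf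
  rw [hardyNormSq_eq_supEnergy hm,
    hardyNormSq_eq_supEnergy (measurable_of_mem_holo (swap_mem_holo hf))]
  exact iSup_congr fun r => iSup_congr fun _ => lintegral_prod_swap (fun z => ‖f z‖ₑ ^ 2)

lemma enorm_sq_eq_of_norm_eq {z : ℂ} {r : ℝ} (hz : ‖z‖ = |r|) :
    ‖z‖ₑ ^ 2 = ENNReal.ofReal (r ^ 2) := by
  rw [← ofReal_norm, ← ENNReal.ofReal_pow (norm_nonneg _), hz, sq_abs]

lemma tendsto_ofReal_sq : Tendsto (fun r : ℝ => ENNReal.ofReal (r ^ 2)) (𝓝[<] 1) (𝓝 1) := by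
  have : Continuous fun r : ℝ => ENNReal.ofReal (r ^ 2) :=
    ENNReal.continuous_ofReal.comp (by fun_prop)
  simpa using (this.tendsto 1).mono_left nhdsWithin_le_nhds

lemma iSup_sq_mul {A : ℝ → ENNReal} (hA : ∀ r s, 0 < r → r ≤ s → s < 1 → A r ≤ A s) :
    ⨆ r ∈ Ioo (0 : ℝ) 1, ENNReal.ofReal (r ^ 2) * A r = ⨆ r ∈ Ioo (0 : ℝ) 1, A r := by
  refine le_antisymm (iSup₂_mono fun r hr => mul_le_of_le_one_left' ?_)
    (iSup_le_iSup_of_tendsto_one hA tendsto_ofReal_sq fun r _ => le_rfl)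
  rw [← ENNReal.ofReal_one]
  exact ENNReal.ofReal_le_ofReal (pow_le_one₀ hr.1.le hr.2.le)

/-- The factor `|z₁|² = r²` comes out of the mean over radius `r`. It tends to `1` and the means
increase, so the supremum is unchanged. -/
lemma hardyNormSq_fst_mul {f : ℂ × ℂ → ℂ} (hf : f ∈ holo) :
    hardyNormSq (fun z => z.1 * f z) = hardyNormSq f := by
  have hm : Measurable fun z => ‖f z‖ₑ ^ 2 := (measurable_of_mem_holo hf).enorm.pow_const 2
  have h1 : ∀ r, circleMean (fun z => circleMean (fun w => ‖z * f (z, w)‖ₑ ^ 2) r) r =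
      ENNReal.ofReal (r ^ 2) * circleMean (fun z => circleMean (fun w => ‖f (z, w)‖ₑ ^ 2) r) r := by
    intro r
    rw [← circleMean_const_mul _ (measurable_circleMean hm r)]
    refine circleMean_eq_of_circle fun z hz => ?_
    simp only [enorm_mul, mul_pow, enorm_sq_eq_of_norm_eq hz]
    exact circleMean_const_mul _ (measurable_slice hm z) r
  simp only [hardyNormSq, h1]
  refine iSup_sq_mul fun r s h0 hrs hs => ?_
  calc _ ≤ circleMean (fun z => circleMean (fun w => ‖f (z, w)‖ₑ ^ 2) s) r :=
        circleMean_mono (fun z => circleMean_sq_mono (slice_differentiableOn' hf z) h0.le hrs hs) r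
    _ ≤ _ := by
        rw [← lintegral_circleMeasure (measurable_circleMean hm s),
          ← lintegral_circleMeasure (measurable_circleMean hm s)]
        simp only [← lintegral_circleMeasure (measurable_slice hm _)]
        rw [lintegral_lintegral_swap (f := fun z w => ‖f (z, w)‖ₑ ^ 2) hm.aemeasurable,
          lintegral_lintegral_swap (f := fun z w => ‖f (z, w)‖ₑ ^ 2) hm.aemeasurable]
        refine lintegral_mono fun w => ?_
        simp only [lintegral_circleMeasure (measurable_slice' hm w)]
        exact circleMean_sq_mono (slice_differentiableOn hf w) h0.le hrs hs

lemma hardyNormSq_coord_mul (j : Fin 2) {f : ℂ × ℂ → ℂ} (hf : f ∈ holo) :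
    hardyNormSq (fun z => coord j z * f z) = hardyNormSq f := by
  fin_cases j
  · exact hardyNormSq_fst_mul hf
  · rw [← hardyNormSq_swap (mul_mem_holo _ hf), ← hardyNormSq_swap hf]
    exact hardyNormSq_fst_mul (swap_mem_holo hf)

lemma circleMean_diskEnergy_mono (μ : Measure ℂ) [IsFiniteMeasure μ] {f : ℂ × ℂ → ℂ}
    (hf : f ∈ holo) (r s : ℝ) (h0 : 0 < r) (hrs : r ≤ s) (h1 : s < 1) :
    circleMean (fun w => diskEnergy μ (fun z => f (z, w))) r ≤
      circleMean (fun w => diskEnergy μ (fun z => f (z, w))) s := by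
  have hm : Measurable fun p => ‖sliceDeriv f p‖ₑ ^ 2 := (measurable_sliceDeriv hf).enorm.pow_const 2
  have h2 : ∀ r, circleMean (fun w => diskEnergy μ (fun z => f (z, w))) r =
      ∫⁻ z, circleMean (fun w => ‖sliceDeriv f (w, z)‖ₑ ^ 2) r ∂weightedArea μ := by
    intro r
    simp only [diskEnergy_slice_eq μ hf]
    rw [← lintegral_circleMeasure (hm.lintegral_prod_right'),
      lintegral_lintegral_swap (f := fun w z => ‖sliceDeriv f (w, z)‖ₑ ^ 2) hm.aemeasurable]
    simp only [lintegral_circleMeasure (measurable_slice' hm _)]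
  rw [h2, h2]
  exact lintegral_mono fun z => circleMean_sliceDeriv_mono hf z h0 hrs h1

lemma energy₁_snd_mul (μ : Measure ℂ) [IsFiniteMeasure μ] {f : ℂ × ℂ → ℂ} (hf : f ∈ holo) :
    energy₁ μ (fun z => z.2 * f z) = energy₁ μ f := by
  have h1 : ∀ r, circleMean (fun w => diskEnergy μ (fun z => w * f (z, w))) r =
      ENNReal.ofReal (r ^ 2) * circleMean (fun w => diskEnergy μ (fun z => f (z, w))) r := by
    intro r
    rw [← circleMean_const_mul _ (measurable_diskEnergy_slice μ hf)]
    refine circleMean_eq_of_circle fun w hw => ?_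
    rw [diskEnergy_smul, enorm_sq_eq_of_norm_eq hw]
  simp only [energy₁, h1]
  exact iSup_sq_mul (circleMean_diskEnergy_mono μ hf)

/-- The one-variable bound is averaged over `|w| = r`. The resulting mean of `|f(0, w)|²` is at most
the Hardy mean at the same radius, since `|g(0)|²` is at most every circular mean of `|g|²`. -/
lemma energy₁_fst_mul_le (μ : Measure ℂ) [IsFiniteMeasure μ] {f : ℂ × ℂ → ℂ} (hf : f ∈ holo) :
    energy₁ μ (fun z => z.1 * f z) ≤ 3 * energy₁ μ f + 2 * μ univ * hardyNormSq f := by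
  have hm : Measurable fun z => ‖f z‖ₑ ^ 2 := (measurable_of_mem_holo hf).enorm.pow_const 2
  refine iSup₂_le fun r hr => ?_
  calc circleMean (fun w => diskEnergy μ (fun z => z * f (z, w))) r
      ≤ circleMean (fun w => 3 * diskEnergy μ (fun z => f (z, w)) +
          2 * μ univ * ‖f (0, w)‖ₑ ^ 2) r :=
        circleMean_mono (fun w => diskEnergy_mul_le μ (slice_differentiableOn hf w)) r
    _ = 3 * circleMean (fun w => diskEnergy μ (fun z => f (z, w))) r +
          2 * μ univ * circleMean (fun w => ‖f (0, w)‖ₑ ^ 2) r := by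
        rw [circleMean_add ((measurable_diskEnergy_slice μ hf).const_mul 3),
          circleMean_const_mul _ (measurable_diskEnergy_slice μ hf),
          circleMean_const_mul _ (measurable_slice hm 0)]
    _ ≤ _ := by
        gcongr
        · exact le_iSup₂ (f := fun r (_ : r ∈ Ioo (0 : ℝ) 1) =>
            circleMean (fun w => diskEnergy μ (fun z => f (z, w))) r) r hr
        · rw [← hardyNormSq_swap hf]
          refine le_trans (circleMean_mono (fun w => enorm_sq_apply_zero_le
            (slice_differentiableOn hf w) hr.1.le hr.2) r) ?_
          exact le_iSup₂ (f := fun r (_ : r ∈ Ioo (0 : ℝ) 1) =>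
            circleMean (fun w => circleMean (fun z => ‖f (z, w)‖ₑ ^ 2) r) r) r hr

/-- The identity holds for each radius separately, on almost every slice; additivity of the
increasing suprema then transfers it to the energies. -/
lemma energy₁_second_difference {μ : Measure ℂ} [IsFiniteMeasure μ] (hμ : μ (ball 0 1) = 0)
    {f : ℂ × ℂ → ℂ} (hf : f ∈ holo) (h : energy₁ μ f ≠ ⊤) :
    energy₁ μ (fun z => z.1 * (z.1 * f z)) + energy₁ μ f = 2 * energy₁ μ (fun z => z.1 * f z) := by
  have hf1 : (fun z : ℂ × ℂ => z.1 * f z) ∈ holo := mul_mem_holo 0 hf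
  have hf2 : (fun z : ℂ × ℂ => z.1 * (z.1 * f z)) ∈ holo := mul_mem_holo 0 hf1
  simp only [energy₁, ENNReal.mul_iSup]
  rw [← iSup_Ioo_add (circleMean_diskEnergy_mono μ hf2) (circleMean_diskEnergy_mono μ hf)]
  refine iSup_congr fun r => iSup_congr fun hr => ?_
  have hm := measurable_diskEnergy_slice μ hf
  have hm1 := measurable_diskEnergy_slice μ hf1
  have hm2 := measurable_diskEnergy_slice μ hf2
  have hfin : ∫⁻ w, diskEnergy μ (fun z => f (z, w)) ∂circleMeasure r ≠ ⊤ := by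
    rw [lintegral_circleMeasure hm]
    exact ne_top_of_le_ne_top h (le_iSup₂ (f := fun r (_ : r ∈ Ioo (0 : ℝ) 1) =>
      circleMean (fun w => diskEnergy μ (fun z => f (z, w))) r) r hr)
  rw [← lintegral_circleMeasure hm, ← lintegral_circleMeasure hm1, ← lintegral_circleMeasure hm2,
    ← lintegral_add_left hm2, ← lintegral_const_mul _ hm1]
  refine lintegral_congr_ae ?_
  filter_upwards [ae_lt_top hm hfin] with w hw
  exact diskEnergy_second_difference hμ (slice_differentiableOn hf w) hw.ne

lemma circleMean_const (c : ENNReal) (r : ℝ) : circleMean (fun _ => c) r = c := by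
  have hpi : (0 : ℝ) < 2 * Real.pi := by positivity
  rw [circleMean, setLIntegral_const, Real.volume_Ioc, sub_zero, mul_left_comm,
    ← ENNReal.ofReal_mul (by positivity), one_div_mul_cancel hpi.ne', ENNReal.ofReal_one, mul_one]

lemma energy₁_of_fst (μ : Measure ℂ) {f : ℂ × ℂ → ℂ} {g : ℂ → ℂ}
    (h : ∀ z ∈ ball (0 : ℂ) 1, ∀ w ∈ ball (0 : ℂ) 1, f (z, w) = g z) :
    energy₁ μ f = diskEnergy μ g := by
  have h1 : ∀ r ∈ Ioo (0 : ℝ) 1,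
      circleMean (fun w => diskEnergy μ (fun z => f (z, w))) r = diskEnergy μ g := by
    intro r hr
    rw [← circleMean_const (diskEnergy μ g) r]
    refine circleMean_eq_of_circle fun w hw => ?_
    have hw1 : w ∈ ball (0 : ℂ) 1 := by
      rw [mem_ball_zero_iff, hw, abs_of_pos hr.1]
      exact hr.2
    unfold diskEnergy
    congr 1
    exact setLIntegral_congr_fun isOpen_ball.measurableSet fun z hz => by
      simp only [deriv_eqOn_ball (fun z hz => h z hz w hw1) z hz]
  refine le_antisymm (iSup₂_le fun r hr => (h1 r hr).le) ?_
  have hr : (1 / 2 : ℝ) ∈ Ioo (0 : ℝ) 1 := by norm_num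
  rw [← h1 _ hr]
  exact le_iSup₂ (f := fun r (_ : r ∈ Ioo (0 : ℝ) 1) =>
    circleMean (fun w => diskEnergy μ (fun z => f (z, w))) r) _ hr

/-- The constant function `1` on the bidisc. -/
noncomputable def unit : ℂ × ℂ → ℂ := bidisc.indicator fun _ => 1

lemma unit_of_mem {z w : ℂ} (hz : z ∈ ball (0 : ℂ) 1) (hw : w ∈ ball (0 : ℂ) 1) :
    unit (z, w) = 1 := indicator_of_mem (show (z, w) ∈ bidisc from ⟨hz, hw⟩) _

lemma unit_mem_holo : unit ∈ holo :=
  ⟨(differentiableOn_const 1).congr fun _ hz => indicator_of_mem hz _,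
    fun _ hz => indicator_of_notMem hz _⟩

lemma hardyNormSq_unit_le : hardyNormSq unit ≤ 1 := by
  refine iSup₂_le fun r hr => ?_
  have h1 : ∀ p, ‖unit p‖ₑ ^ 2 ≤ 1 := fun p => by
    by_cases hp : p ∈ bidisc
    · simp [unit, hp]
    · simp [unit, hp]
  calc _ ≤ circleMean (fun _ => circleMean (fun _ => 1) r) r :=
        circleMean_mono (fun z => circleMean_mono (fun w => h1 _) r) r
    _ = 1 := by rw [circleMean_const, circleMean_const]

lemma unit_swap : (fun z : ℂ × ℂ => unit z.swap) = unit := by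
  funext z
  by_cases hz : z ∈ bidisc
  · rw [unit, indicator_of_mem (show z.swap ∈ bidisc from ⟨hz.2, hz.1⟩), indicator_of_mem hz]
  · rw [unit, indicator_of_notMem (show z.swap ∉ bidisc from fun h => hz ⟨h.2, h.1⟩),
      indicator_of_notMem hz]

lemma energy₁_unit (μ : Measure ℂ) : energy₁ μ unit = 0 := by
  rw [energy₁_of_fst μ (g := fun _ => 1) fun z hz w hw => unit_of_mem hz hw, diskEnergy_const]

lemma measure_ball_eq_zero_of_energy₁ {μ : Measure ℂ} [IsFiniteMeasure μ]
    (h : energy₁ μ (fun z => z.1 * (z.1 * unit z)) + energy₁ μ unit =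
      2 * energy₁ μ (fun z => z.1 * unit z)) : μ (ball 0 1) = 0 := by
  refine measure_ball_eq_zero_of_second_difference ?_
  rwa [energy₁_of_fst μ (g := fun z => z * (z * 1)) fun z hz w hw => by rw [unit_of_mem hz hw],
    energy₁_of_fst μ (g := fun _ => 1) fun z hz w hw => unit_of_mem hz hw,
    energy₁_of_fst μ (g := fun z => z * 1) fun z hz w hw => by rw [unit_of_mem hz hw]] at h

lemma support_subset_sphere_iff {μ : Measure ℂ} (hμ : μ (closedBall (0 : ℂ) 1)ᶜ = 0) :
    μ.support ⊆ sphere (0 : ℂ) 1 ↔ μ (ball 0 1) = 0 := by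
  constructor
  · intro h
    refine measure_mono_null (t := μ.supportᶜ) (fun z hz hs => ?_) Measure.measure_compl_support
    have h1 := mem_sphere_zero_iff_norm.1 (h hs)
    rw [mem_ball_zero_iff] at hz
    linarith
  · intro h
    refine Measure.support_subset_of_isClosed isClosed_sphere ?_
    rw [mem_ae_iff]
    refine measure_mono_null (t := ball 0 1 ∪ (closedBall 0 1)ᶜ) (fun z hz => ?_)
      (measure_union_null h hμ)
    by_contra hc
    rw [mem_union, not_or, notMem_compl_iff, ← sphere_union_ball] at hc
    exact hc.2.elim hz hc.1

lemma tendstoLocallyUniformlyOn_const_sub {u : ℕ → ℂ × ℂ → ℂ} {f : ℂ × ℂ → ℂ}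
    (h : TendstoLocallyUniformlyOn u f atTop bidisc) (g : ℂ × ℂ → ℂ) :
    TendstoLocallyUniformlyOn (fun n => g - u n) (g - f) atTop bidisc := by
  rw [Metric.tendstoLocallyUniformlyOn_iff] at h ⊢
  intro ε hε x hx
  obtain ⟨t, ht, h1⟩ := h ε hε x hx
  refine ⟨t, ht, h1.mono fun n hn y hy => ?_⟩
  rw [Pi.sub_apply, Pi.sub_apply, dist_sub_left]
  exact hn y hy

lemma mem_dirichletSpace_iff {μ₁ μ₂ : Measure ℂ} [IsFiniteMeasure μ₁] [IsFiniteMeasure μ₂]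
    {f : ℂ × ℂ → ℂ} : f ∈ dirichletSpace μ₁ μ₂ ↔ f ∈ holo ∧ totalNormSq μ₁ μ₂ f < ⊤ := by
  rw [totalNormSq, ENNReal.add_lt_top, ← and_assoc]
  rfl

lemma energy₂_fst_mul (μ : Measure ℂ) [IsFiniteMeasure μ] {f : ℂ × ℂ → ℂ} (hf : f ∈ holo) :
    energy₂ μ (fun z => z.1 * f z) = energy₂ μ f := by
  simp only [energy₂_eq, Prod.fst_swap]
  exact energy₁_snd_mul μ (swap_mem_holo hf)

lemma energy₂_snd_mul_le (μ : Measure ℂ) [IsFiniteMeasure μ] {f : ℂ × ℂ → ℂ} (hf : f ∈ holo) :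
    energy₂ μ (fun z => z.2 * f z) ≤ 3 * energy₂ μ f + 2 * μ univ * hardyNormSq f := by
  simp only [energy₂_eq, Prod.snd_swap]
  rw [← hardyNormSq_swap hf]
  exact energy₁_fst_mul_le μ (swap_mem_holo hf)

lemma energy₂_second_difference {μ : Measure ℂ} [IsFiniteMeasure μ] (hμ : μ (ball 0 1) = 0)
    {f : ℂ × ℂ → ℂ} (hf : f ∈ holo) (h : energy₂ μ f ≠ ⊤) :
    energy₂ μ (fun z => z.2 * (z.2 * f z)) + energy₂ μ f = 2 * energy₂ μ (fun z => z.2 * f z) := by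
  rw [energy₂_eq] at h
  simp only [energy₂_eq, Prod.snd_swap]
  exact energy₁_second_difference hμ (swap_mem_holo hf) h

lemma measure_ball_eq_zero_of_energy₂ {μ : Measure ℂ} [IsFiniteMeasure μ]
    (h : energy₂ μ (fun z => z.2 * (z.2 * unit z)) + energy₂ μ unit =
      2 * energy₂ μ (fun z => z.2 * unit z)) : μ (ball 0 1) = 0 := by
  simp only [energy₂_eq, Prod.snd_swap, congrFun unit_swap] at h
  exact measure_ball_eq_zero_of_energy₁ h

lemma totalNormSq_coord_mul_le (μ₁ μ₂ : Measure ℂ) [IsFiniteMeasure μ₁] [IsFiniteMeasure μ₂]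
    (j : Fin 2) {f : ℂ × ℂ → ℂ} (hf : f ∈ holo) :
    totalNormSq μ₁ μ₂ (fun z => coord j z * f z) ≤
      (3 + 2 * (μ₁ univ + μ₂ univ)) * totalNormSq μ₁ μ₂ f := by
  -- The right side exceeds the left by an explicit sum of nonnegative terms, so the inequality
  -- needs no subtraction in `ENNReal`.
  have key : ∀ a b c m m' : ENNReal,
      a + ((3 * b + 2 * m * a) + c) ≤ (3 + 2 * (m + m')) * (a + (b + c)) := fun a b c m m' => by
    calc a + ((3 * b + 2 * m * a) + c) ≤ (a + ((3 * b + 2 * m * a) + c)) +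
          (2 * a + 2 * c + 2 * m * (b + c) + 2 * m' * (a + (b + c))) := le_self_add
      _ = _ := by ring
  rw [totalNormSq, totalNormSq, dirichletIntegral, dirichletIntegral, hardyNormSq_coord_mul j hf]
  fin_cases j
  · have h0 : (fun z : ℂ × ℂ => coord 0 z * f z) = fun z => z.1 * f z := rfl
    simp only [Fin.zero_eta, h0, energy₂_fst_mul μ₂ hf]
    exact le_trans (by gcongr; exact energy₁_fst_mul_le μ₁ hf) (key _ _ _ _ _)
  · have h0 : (fun z : ℂ × ℂ => coord 1 z * f z) = fun z => z.2 * f z := rfl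
    simp only [Fin.mk_one, h0, energy₁_snd_mul μ₁ hf]
    rw [add_comm (energy₁ μ₁ f), add_comm (energy₁ μ₁ f), add_comm (μ₁ univ)]
    exact le_trans (by gcongr; exact energy₂_snd_mul_le μ₂ hf) (key _ _ _ _ _)

lemma coord_mul_mem_dirichletSpace {μ₁ μ₂ : Measure ℂ} [IsFiniteMeasure μ₁] [IsFiniteMeasure μ₂]
    (j : Fin 2) {f : ℂ × ℂ → ℂ} (hf : f ∈ dirichletSpace μ₁ μ₂) :
    (fun z => coord j z * f z) ∈ dirichletSpace μ₁ μ₂ := by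
  rw [mem_dirichletSpace_iff] at hf ⊢
  refine ⟨mul_mem_holo j hf.1, (totalNormSq_coord_mul_le μ₁ μ₂ j hf.1).trans_lt ?_⟩
  refine ENNReal.mul_lt_top ?_ hf.2
  finiteness

/-! ### The norm of the Dirichlet-type space and its second differences -/

namespace DirichletSpace

variable {μ₁ μ₂ : Measure ℂ} [IsFiniteMeasure μ₁] [IsFiniteMeasure μ₂]

lemma ext_fn {f g : DirichletSpace μ₁ μ₂} (h : f.fn = g.fn) : f = g := Subtype.ext h

lemma fn_mem (f : DirichletSpace μ₁ μ₂) : f.fn ∈ dirichletSpace μ₁ μ₂ := f.2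

lemma fn_mem_holo (f : DirichletSpace μ₁ μ₂) : f.fn ∈ holo := f.2.1.1

lemma totalNormSq_ne_top (f : DirichletSpace μ₁ μ₂) : totalNormSq μ₁ μ₂ f.fn ≠ ⊤ :=
  (mem_dirichletSpace_iff.1 f.2).2.ne

/-- Multiplication by a coordinate function, as a linear map. -/
noncomputable def mulCoord (j : Fin 2) : DirichletSpace μ₁ μ₂ →ₗ[ℂ] DirichletSpace μ₁ μ₂ where
  toFun f := ⟨fun z => coord j z * f.fn z, coord_mul_mem_dirichletSpace j f.fn_mem⟩
  map_add' f g := ext_fn <| funext fun z => mul_add _ (f.fn z) (g.fn z)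
  map_smul' c f := ext_fn <| funext fun z => mul_left_comm _ c (f.fn z)

/-- The square of the norm. -/
noncomputable def normSq (f : DirichletSpace μ₁ μ₂) : ℝ := (totalNormSq μ₁ μ₂ f.fn).toReal

lemma ofReal_normSq (f : DirichletSpace μ₁ μ₂) :
    ENNReal.ofReal f.normSq = totalNormSq μ₁ μ₂ f.fn := ENNReal.ofReal_toReal f.totalNormSq_ne_top

lemma normSq_nonneg (f : DirichletSpace μ₁ μ₂) : 0 ≤ f.normSq := ENNReal.toReal_nonneg

lemma normSq_add_le (f g : DirichletSpace μ₁ μ₂) (t : ℝ) (ht : 0 < t) :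
    (f + g).normSq ≤ (1 + t) * f.normSq + (1 + t⁻¹) * g.normSq := by
  have h0 := f.normSq_nonneg
  have h1 := g.normSq_nonneg
  rw [← ENNReal.ofReal_le_ofReal_iff (by positivity), ENNReal.ofReal_add (by positivity)
    (by positivity), ENNReal.ofReal_mul (by positivity), ENNReal.ofReal_mul (by positivity)]
  simp only [ofReal_normSq]
  exact (isQuadForm_totalNormSq μ₁ μ₂).add_le _ f.fn_mem_holo _ g.fn_mem_holo t ht

lemma normSq_parallelogram (f g : DirichletSpace μ₁ μ₂) :
    (f + g).normSq + (f - g).normSq = 2 * f.normSq + 2 * g.normSq := by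
  have h : (totalNormSq μ₁ μ₂ (f + g).fn + totalNormSq μ₁ μ₂ (f - g).fn).toReal =
      (2 * totalNormSq μ₁ μ₂ f.fn + 2 * totalNormSq μ₁ μ₂ g.fn).toReal := congrArg ENNReal.toReal
    ((isQuadForm_totalNormSq μ₁ μ₂).parallelogram _ f.fn_mem_holo _ g.fn_mem_holo)
  rw [ENNReal.toReal_add (f + g).totalNormSq_ne_top (f - g).totalNormSq_ne_top,
    ENNReal.toReal_add (ENNReal.mul_ne_top (by simp) f.totalNormSq_ne_top)
      (ENNReal.mul_ne_top (by simp) g.totalNormSq_ne_top), ENNReal.toReal_mul,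
    ENNReal.toReal_mul] at h
  exact h

lemma normSq_smul (c : ℂ) (f : DirichletSpace μ₁ μ₂) : (c • f).normSq = ‖c‖ ^ 2 * f.normSq := by
  have h := congrArg ENNReal.toReal ((isQuadForm_totalNormSq μ₁ μ₂).smul _ f.fn_mem_holo c)
  rw [ENNReal.toReal_mul, ENNReal.toReal_pow, toReal_enorm] at h
  exact h

lemma eq_zero_of_normSq_eq_zero (f : DirichletSpace μ₁ μ₂) (h : f.normSq = 0) : f = 0 := by
  have h1 := f.ofReal_normSq
  rw [h, ENNReal.ofReal_zero] at h1
  exact ext_fn (eq_zero_of_hardyNormSq_eq_zero f.fn_mem_holo (add_eq_zero.1 h1.symm).1)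

/-- The Hardy part of the norm yields a locally uniform holomorphic limit `f`; lower semicontinuity
upgrades this to convergence in the full norm and to membership of `f` in the space. -/
lemma exists_limit (u : ℕ → DirichletSpace μ₁ μ₂)
    (hu : ∀ ε > 0, ∃ N, ∀ m ≥ N, ∀ n ≥ N, (u m - u n).normSq ≤ ε) :
    ∃ f, ∀ ε > 0, ∃ N, ∀ n ≥ N, (u n - f).normSq ≤ ε := by
  have hQ := isQuadForm_totalNormSq μ₁ μ₂
  obtain ⟨f, hf, hlim⟩ := exists_holo_limit (u := fun n => (u n).fn)
    (fun n => (u n).fn_mem_holo) fun ε hε => by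
      rcases eq_or_ne ε ⊤ with rfl | hε'
      · exact ⟨0, fun _ _ _ _ => le_top⟩
      obtain ⟨N, hN⟩ := hu ε.toReal (ENNReal.toReal_pos hε.ne' hε')
      refine ⟨N, fun m hm n hn => ?_⟩
      calc _ ≤ totalNormSq μ₁ μ₂ (u m - u n).fn := le_self_add
        _ ≤ ε := by
          rw [← ofReal_normSq, ← ENNReal.ofReal_toReal hε']
          exact ENNReal.ofReal_le_ofReal (hN m hm n hn)
  have h1 : ∀ ε > 0, ∃ N, ∀ n ≥ N, totalNormSq μ₁ μ₂ ((u n).fn - f) ≤ ENNReal.ofReal ε := by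
    intro ε hε
    obtain ⟨N, hN⟩ := hu ε hε
    refine ⟨N, fun n hn => ?_⟩
    -- Here `n` is fixed and `m` tends to infinity in `u n - u m`.
    refine (hQ.le_liminf _ _ (fun m => holo.sub_mem (u n).fn_mem_holo (u m).fn_mem_holo)
      (holo.sub_mem (u n).fn_mem_holo hf) (tendstoLocallyUniformlyOn_const_sub hlim _)).trans ?_
    refine liminf_le_of_le (by isBoundedDefault) fun b hb => ?_
    obtain ⟨m, hm, hbm⟩ := (hb.and (eventually_ge_atTop N)).exists
    refine hm.trans ?_
    change totalNormSq μ₁ μ₂ (u n - u m).fn ≤ _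
    rw [← ofReal_normSq]
    exact ENNReal.ofReal_le_ofReal (hN n hn m hbm)
  have hmem : f ∈ dirichletSpace μ₁ μ₂ := by
    obtain ⟨N, hN⟩ := h1 1 one_pos
    have h2 : (u N).fn - f ∈ dirichletSpace μ₁ μ₂ := mem_dirichletSpace_iff.2
      ⟨holo.sub_mem (u N).fn_mem_holo hf, (hN N le_rfl).trans_lt ENNReal.ofReal_lt_top⟩
    have h3 := (dirichletSpace μ₁ μ₂).sub_mem (u N).fn_mem h2
    rwa [sub_sub_cancel] at h3
  let F : DirichletSpace μ₁ μ₂ := ⟨f, hmem⟩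
  refine ⟨F, fun ε hε => ?_⟩
  obtain ⟨N, hN⟩ := h1 ε hε
  refine ⟨N, fun n hn => ?_⟩
  rw [← ENNReal.ofReal_le_ofReal_iff hε.le, ofReal_normSq]
  exact hN n hn

lemma exists_normSq_mulCoord_le (j : Fin 2) :
    ∃ C : ℝ, ∀ f : DirichletSpace μ₁ μ₂, (mulCoord j f).normSq ≤ C * f.normSq := by
  refine ⟨(3 + 2 * (μ₁ univ + μ₂ univ)).toReal, fun f => ?_⟩
  rw [normSq, normSq, ← ENNReal.toReal_mul]
  refine ENNReal.toReal_mono (ENNReal.mul_ne_top (by finiteness) f.totalNormSq_ne_top) ?_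
  exact totalNormSq_coord_mul_le μ₁ μ₂ j f.fn_mem_holo

lemma mulCoord_comm (i j : Fin 2) (f : DirichletSpace μ₁ μ₂) :
    mulCoord i (mulCoord j f) = mulCoord j (mulCoord i f) :=
  ext_fn <| funext fun z => mul_left_comm (coord i z) (coord j z) (f.fn z)

lemma hardyNormSq_ne_top (f : DirichletSpace μ₁ μ₂) : hardyNormSq f.fn ≠ ⊤ := f.2.1.2.ne

lemma energy₁_ne_top (f : DirichletSpace μ₁ μ₂) : energy₁ μ₁ f.fn ≠ ⊤ :=
  ne_top_of_le_ne_top f.2.2.ne le_self_add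

lemma energy₂_ne_top (f : DirichletSpace μ₁ μ₂) : energy₂ μ₂ f.fn ≠ ⊤ :=
  ne_top_of_le_ne_top f.2.2.ne le_add_self

lemma normSq_eq (f : DirichletSpace μ₁ μ₂) : f.normSq =
    (hardyNormSq f.fn).toReal + ((energy₁ μ₁ f.fn).toReal + (energy₂ μ₂ f.fn).toReal) := by
  rw [← ENNReal.toReal_add f.energy₁_ne_top f.energy₂_ne_top,
    ← ENNReal.toReal_add f.hardyNormSq_ne_top
      (ENNReal.add_ne_top.2 ⟨f.energy₁_ne_top, f.energy₂_ne_top⟩)]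
  rfl

/-- The constant function `1`. -/
noncomputable def one (μ₁ μ₂ : Measure ℂ) [IsFiniteMeasure μ₁] [IsFiniteMeasure μ₂] :
    DirichletSpace μ₁ μ₂ :=
  ⟨unit, mem_dirichletSpace_iff.2 ⟨unit_mem_holo, by
    rw [totalNormSq, dirichletIntegral, energy₂_eq, unit_swap, energy₁_unit, energy₁_unit,
      add_zero, add_zero]
    exact hardyNormSq_unit_le.trans_lt ENNReal.one_lt_top⟩⟩

lemma fn_mulCoord_zero (f : DirichletSpace μ₁ μ₂) :
    (mulCoord 0 f).fn = fun z => z.1 * f.fn z := rfl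

lemma fn_mulCoord_one (f : DirichletSpace μ₁ μ₂) :
    (mulCoord 1 f).fn = fun z => z.2 * f.fn z := rfl

lemma fn_one : (one μ₁ μ₂).fn = unit := rfl

lemma hardyNormSq_mulCoord (j : Fin 2) (f : DirichletSpace μ₁ μ₂) :
    hardyNormSq (mulCoord j f).fn = hardyNormSq f.fn := hardyNormSq_coord_mul j f.fn_mem_holo

lemma energy₁_mulCoord_one (f : DirichletSpace μ₁ μ₂) :
    energy₁ μ₁ (mulCoord 1 f).fn = energy₁ μ₁ f.fn := by
  rw [fn_mulCoord_one, energy₁_snd_mul μ₁ f.fn_mem_holo]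

lemma energy₂_mulCoord_zero (f : DirichletSpace μ₁ μ₂) :
    energy₂ μ₂ (mulCoord 0 f).fn = energy₂ μ₂ f.fn := by
  rw [fn_mulCoord_zero, energy₂_fst_mul μ₂ f.fn_mem_holo]

lemma second_difference_iff {a b c : ENNReal} (ha : a ≠ ⊤) (hb : b ≠ ⊤) (hc : c ≠ ⊤) :
    a + b = 2 * c ↔ a.toReal + b.toReal = 2 * c.toReal := by
  rw [← ENNReal.toReal_eq_toReal_iff' (ENNReal.add_ne_top.2 ⟨ha, hb⟩)
    (ENNReal.mul_ne_top (by simp) hc), ENNReal.toReal_add ha hb, ENNReal.toReal_mul]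
  rfl

/-- Multiplication by `z₁` leaves the Hardy term and `energy₂` unchanged, so both cancel and only
`energy₁` remains. Testing on the constant function detects the mass of `μ₁` in the open disc. -/
lemma second_difference_zero_iff :
    (∀ f : DirichletSpace μ₁ μ₂,
      f.normSq - 2 * (mulCoord 0 f).normSq + (mulCoord 0 (mulCoord 0 f)).normSq = 0) ↔
    μ₁ (ball 0 1) = 0 := by
  have key : ∀ f : DirichletSpace μ₁ μ₂,
      f.normSq - 2 * (mulCoord 0 f).normSq + (mulCoord 0 (mulCoord 0 f)).normSq = 0 ↔
      energy₁ μ₁ (mulCoord 0 (mulCoord 0 f)).fn + energy₁ μ₁ f.fn =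
        2 * energy₁ μ₁ (mulCoord 0 f).fn := fun f => by
    rw [second_difference_iff (energy₁_ne_top _) (energy₁_ne_top _) (energy₁_ne_top _)]
    simp only [normSq_eq, hardyNormSq_mulCoord, energy₂_mulCoord_zero]
    constructor <;> intro h <;> linarith
  simp only [fn_mulCoord_zero] at key
  refine ⟨fun h => ?_, fun h f => ?_⟩
  · have h1 := (key (one μ₁ μ₂)).1 (h _)
    rw [fn_one] at h1
    exact measure_ball_eq_zero_of_energy₁ h1
  · exact (key f).2 (energy₁_second_difference h f.fn_mem_holo f.energy₁_ne_top)

lemma second_difference_one_iff :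
    (∀ f : DirichletSpace μ₁ μ₂,
      f.normSq - 2 * (mulCoord 1 f).normSq + (mulCoord 1 (mulCoord 1 f)).normSq = 0) ↔
    μ₂ (ball 0 1) = 0 := by
  have key : ∀ f : DirichletSpace μ₁ μ₂,
      f.normSq - 2 * (mulCoord 1 f).normSq + (mulCoord 1 (mulCoord 1 f)).normSq = 0 ↔
      energy₂ μ₂ (mulCoord 1 (mulCoord 1 f)).fn + energy₂ μ₂ f.fn =
        2 * energy₂ μ₂ (mulCoord 1 f).fn := fun f => by
    rw [second_difference_iff (energy₂_ne_top _) (energy₂_ne_top _) (energy₂_ne_top _)]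
    simp only [normSq_eq, hardyNormSq_mulCoord, energy₁_mulCoord_one]
    constructor <;> intro h <;> linarith
  simp only [fn_mulCoord_one] at key
  refine ⟨fun h => ?_, fun h f => ?_⟩
  · have h1 := (key (one μ₁ μ₂)).1 (h _)
    rw [fn_one] at h1
    exact measure_ball_eq_zero_of_energy₂ h1
  · exact (key f).2 (energy₂_second_difference h f.fn_mem_holo f.energy₂_ne_top)

/-- Each of the three parts of the norm is invariant under at least one of the two multiplications,
so its mixed difference vanishes whatever the measures are. -/
lemma second_difference_mixed (f : DirichletSpace μ₁ μ₂) :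
    f.normSq - (mulCoord 0 f).normSq - (mulCoord 1 f).normSq +
      (mulCoord 1 (mulCoord 0 f)).normSq = 0 := by
  have h1 : energy₂ μ₂ (mulCoord 1 (mulCoord 0 f)).fn = energy₂ μ₂ (mulCoord 1 f).fn := by
    rw [mulCoord_comm, energy₂_mulCoord_zero]
  simp only [normSq_eq, hardyNormSq_mulCoord, energy₁_mulCoord_one, energy₂_mulCoord_zero, h1]
  ring

lemma second_differences_iff :
    (∀ (i j : Fin 2) (f : DirichletSpace μ₁ μ₂), f.normSq - (mulCoord i f).normSq -
      (mulCoord j f).normSq + (mulCoord i (mulCoord j f)).normSq = 0) ↔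
    μ₁ (ball 0 1) = 0 ∧ μ₂ (ball 0 1) = 0 := by
  rw [← second_difference_zero_iff (μ₂ := μ₂), ← second_difference_one_iff (μ₁ := μ₁)]
  refine ⟨fun h => ⟨fun f => ?_, fun f => ?_⟩, fun h i j f => ?_⟩
  · linarith [h 0 0 f]
  · linarith [h 1 1 f]
  · have h0 := h.1 f
    have h1 := h.2 f
    have h2 := second_difference_mixed f
    have h3 := mulCoord_comm 0 1 f
    fin_cases i <;> fin_cases j <;> simp only [Fin.zero_eta, Fin.mk_one, h3] <;> linarith

end DirichletSpace

end Bidisc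

theorem mainTheorem5 (μ₁ μ₂ : Measure ℂ) [IsFiniteMeasure μ₁] [IsFiniteMeasure μ₂]
    (hμ₁ : μ₁ (closedBall (0 : ℂ) 1)ᶜ = 0) (hμ₂ : μ₂ (closedBall (0 : ℂ) 1)ᶜ = 0) :
    -- The norm of `D(μ₁, μ₂)` comes from an inner product ...
    ∃ c : InnerProductSpace.Core ℂ (Bidisc.DirichletSpace μ₁ μ₂),
      letI : NormedAddCommGroup (Bidisc.DirichletSpace μ₁ μ₂) := c.toNormedAddCommGroup
      letI : InnerProductSpace ℂ (Bidisc.DirichletSpace μ₁ μ₂) := InnerProductSpace.ofCore c.toCore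
      (∀ f : Bidisc.DirichletSpace μ₁ μ₂, ENNReal.ofReal (‖f‖ ^ 2) =
        Bidisc.hardyNormSq f.fn + Bidisc.dirichletIntegral μ₁ μ₂ f.fn) ∧
      -- ... for which it is a Hilbert space on which `M_z` is a pair of bounded operators, and
      ∃ (_ : CompleteSpace (Bidisc.DirichletSpace μ₁ μ₂))
        (M : Fin 2 → Bidisc.DirichletSpace μ₁ μ₂ →L[ℂ] Bidisc.DirichletSpace μ₁ μ₂),
        (∀ (j : Fin 2) (f : Bidisc.DirichletSpace μ₁ μ₂) (z : ℂ × ℂ),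
          (M j f).fn z = Bidisc.coord j z * f.fn z) ∧
        (Bidisc.IsToralTwoIsometry M ↔
          μ₁.support ⊆ sphere (0 : ℂ) 1 ∧ μ₂.support ⊆ sphere (0 : ℂ) 1) := by
  have hP := Bidisc.DirichletSpace.second_differences_iff (μ₁ := μ₁) (μ₂ := μ₂)
  rw [← Bidisc.support_subset_sphere_iff hμ₁, ← Bidisc.support_subset_sphere_iff hμ₂] at hP
  obtain ⟨c, hq, hc, M, hM, hiff⟩ := Bidisc.exists_hilbert Bidisc.DirichletSpace.normSq
    Bidisc.DirichletSpace.normSq_nonneg Bidisc.DirichletSpace.normSq_add_le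
    Bidisc.DirichletSpace.normSq_parallelogram Bidisc.DirichletSpace.normSq_smul
    Bidisc.DirichletSpace.eq_zero_of_normSq_eq_zero Bidisc.DirichletSpace.exists_limit
    Bidisc.DirichletSpace.mulCoord Bidisc.DirichletSpace.exists_normSq_mulCoord_le
    Bidisc.DirichletSpace.mulCoord_comm hP
  refine ⟨c, fun f => ?_, hc, M, fun j f z => ?_, hiff⟩
  · rw [hq f]
    exact f.ofReal_normSq
  · rw [hM]
    rfl
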